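/- Two legitimate nodes $1,2$ and an eavesdropper $e$ move in the plane; let $l_j[i]\in\mathbb{R}^2$ be the location of node $j\in\{1,2,e\}$ in slot $i$, and $s[i]=(l_1[i],l_2[i],l_e[i])$. Assume that $(s[i])_i$ is a stationary Markov process, that $(s[1],\dots,s[n])$ has a joint probability density for every $n$, and that the distances $d_{12}[i]=\|l_1[i]-l_2[i]\|$ and $d_{je}[i]=\|l_j[i]-l_e[i]\|$ $(j=1,2)$ lie almost surely in a fixed interval $[d_{\min},d_{\max}]$ with $d_{\min}>0$. Let $\gamma$ be a positive, non-decreasing function on $[d_{\min},d_{\max}]$, let $\rho_1,\rho_2,\rho_e>0$, and let $P>0$ be the beacon power. In slot $i$ node $j\in\{1,2\}$ observes $o_j[i]=\hat d_j[i]=d_{12}[i]+w_j[i]$, and the eavesdropper, who obtains no angle information, observes $o_e[i]=(\hat d_{1e}[i],\hat d_{2e}[i])$ with $\hat d_{je}[i]=d_{je}[i]+w_{je}[i]$. Given all the locations, the noise terms are independent (over slots and over the four types) and Gaussian, $w_j[i]\sim\mathcal N(0,\gamma(d_{12}[i])\rho_j/P)$ and $w_{je}[i]\sim\mathcal N(0,\gamma(d_{je}[i])\rho_e/P)$.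 Write $\mathbf o_j=(o_j[1],\dots,o_j[n])$, $[x]^+=\max(0,x)$, and let $$R_L=\max\Big\{\lim_{n\to\infty}\tfrac1n\big[I(\mathbf o_1;\mathbf o_2)-I(\mathbf o_1;\mathbf o_e)\big]^+,\ \lim_{n\to\infty}\tfrac1n\big[I(\mathbf o_2;\mathbf o_1)-I(\mathbf o_2;\mathbf o_e)\big]^+\Big\},$$ $$R_U=\lim_{n\to\infty}\tfrac1n\min\big\{I(\mathbf o_1;\mathbf o_2),\,I(\mathbf o_1;\mathbf o_2\mid\mathbf o_e)\big\}$$ be the lower and the upper bound on the secret key rate, with informations in nats. Then for every $P>0$ all these informations are finite and the limits exist, and $$\lim_{P\to\infty}\frac{R_L}{\frac12\log P}=\lim_{P\to\infty}\frac{R_U}{\frac12\log P}=1 .$$ In particular $R_L\to\infty$ as $P\to\infty$. -/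

import Mathlib

open MeasureTheory ProbabilityTheory Filter Topology

noncomputable section

namespace LocationKey

/-- Locations are points of the Euclidean plane. -/
abbrev Plane : Type := EuclideanSpace ℝ (Fin 2)

/-- Lebesgue measure on the plane: a shortcut to Mathlib's own instance. -/
instance : MeasureSpace Plane := measureSpaceOfInnerProductSpace

/-! ### Information measures (in nats) -/

section Information

variable {Ω α β δ : Type*} [MeasurableSpace Ω] [MeasurableSpace α] [MeasurableSpace β]
  [MeasurableSpace δ]

/-- Mutual information `I(X;Y)`: the relative entropy of the joint law with respect to the product
of the marginal laws. -/
def mutualInfo (X : Ω → α) (Y : Ω → β) (μ : Measure Ω) : ENNReal :=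
  InformationTheory.klDiv (μ.map fun ω => (X ω, Y ω)) ((μ.map X).prod (μ.map Y))

/-- Conditional mutual information `I(X;Y|Z)`: the relative entropy of the law of `(Z, (X, Y))`
with respect to the law under which `X` and `Y` are conditionally independent given `Z`, with the
same conditional laws given `Z` and the same law of `Z`. -/
def condMutualInfo [StandardBorelSpace α] [Nonempty α] [StandardBorelSpace β] [Nonempty β]
    (X : Ω → α) (Y : Ω → β) (Z : Ω → δ) (μ : Measure Ω) [IsFiniteMeasure μ] : ENNReal :=
  InformationTheory.klDiv (μ.map fun ω => (Z ω, (X ω, Y ω)))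
    ((μ.map Z).compProd ((condDistrib X Z μ).prod (condDistrib Y Z μ)))

end Information

/-! ### Discrete-time processes -/

section Processes

variable {Ω S : Type*} [MeasurableSpace Ω] [MeasurableSpace S]

/-- The values of a process in the first `n` slots. -/
def block (n : ℕ) (X : ℕ → Ω → S) (ω : Ω) : Fin n → S := fun i => X i ω

/-- Strict stationarity: finite-dimensional laws are invariant under time shifts. -/
def IsStationary (X : ℕ → Ω → S) (μ : Measure Ω) : Prop :=
  ∀ k n : ℕ, μ.map (block n fun i => X (k + i)) = μ.map (block n X)

/-- The Markov property: given the values up to time `n`, the conditional probability of an event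
at time `n + 1` depends only on the value at time `n`. -/
def IsMarkov (X : ℕ → Ω → S) (μ : Measure Ω) : Prop :=
  ∀ (n : ℕ) (B : Set S), MeasurableSet B →
    μ[(X (n + 1) ⁻¹' B).indicator (fun _ => (1 : ℝ)) |
        MeasurableSpace.comap (block (n + 1) X) inferInstance] =ᵐ[μ]
      μ[(X (n + 1) ⁻¹' B).indicator (fun _ => (1 : ℝ)) |
        MeasurableSpace.comap (X n) inferInstance]

end Processes

/-! ### Localization observations -/

section Observations

variable {Ω : Type*}

/-- Distance between two moving nodes. -/
def distance (l l' : ℕ → Ω → Plane) (i : ℕ) (ω : Ω) : ℝ := dist (l i ω) (l' i ω)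

/-- Noisy observation of the distance `d`. If `z` is standard Gaussian white noise independent of
`d`, then given `d` the error in slot `i` has law `N(0, γ(d[i]) ρ / P)`. -/
def noisy (γ : ℝ → ℝ) (ρ P : ℝ) (d z : ℕ → Ω → ℝ) (i : ℕ) (ω : Ω) : ℝ :=
  d i ω + √(γ (d i ω) * ρ / P) * z i ω

/-- Eavesdropper's observation without angle information: its two noisy distances. -/
def pair (x y : ℕ → Ω → ℝ) (i : ℕ) (ω : Ω) : ℝ × ℝ := (x i ω, y i ω)

end Observations

/-! ### The two key-rate bounds -/

section Rates

variable {Ω A B E : Type*} [MeasurableSpace Ω]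
  [MeasurableSpace A] [MeasurableSpace B] [MeasurableSpace E]

/-- `R` is the lower bound
`max (lim (1/n) [I(o₁;o₂) - I(o₁;oₑ)]⁺) (lim (1/n) [I(o₂;o₁) - I(o₂;oₑ)]⁺)`:
all informations are finite, both limits exist, and `R` is their maximum. -/
def IsLowerRate (o₁ : ℕ → Ω → A) (o₂ : ℕ → Ω → B) (oₑ : ℕ → Ω → E) (μ : Measure Ω)
    (R : ℝ) : Prop :=
  (∀ n, mutualInfo (block n o₁) (block n o₂) μ ≠ ⊤ ∧
    mutualInfo (block n o₂) (block n o₁) μ ≠ ⊤ ∧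
    mutualInfo (block n o₁) (block n oₑ) μ ≠ ⊤ ∧
    mutualInfo (block n o₂) (block n oₑ) μ ≠ ⊤) ∧
  ∃ a b : ℝ,
    Tendsto (fun n : ℕ => (1 / (n : ℝ)) *
      max 0 ((mutualInfo (block n o₁) (block n o₂) μ).toReal -
        (mutualInfo (block n o₁) (block n oₑ) μ).toReal)) atTop (𝓝 a) ∧
    Tendsto (fun n : ℕ => (1 / (n : ℝ)) *
      max 0 ((mutualInfo (block n o₂) (block n o₁) μ).toReal -
        (mutualInfo (block n o₂) (block n oₑ) μ).toReal)) atTop (𝓝 b) ∧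
    R = max a b

/-- `R` is the upper bound `lim (1/n) min (I(o₁;o₂)) (I(o₁;o₂|oₑ))`: the informations are finite,
and the limit exists and equals `R`. -/
def IsUpperRate [StandardBorelSpace A] [Nonempty A] [StandardBorelSpace B] [Nonempty B]
    (o₁ : ℕ → Ω → A) (o₂ : ℕ → Ω → B) (oₑ : ℕ → Ω → E) (μ : Measure Ω) [IsFiniteMeasure μ]
    (R : ℝ) : Prop :=
  (∀ n, mutualInfo (block n o₁) (block n o₂) μ ≠ ⊤ ∧
    condMutualInfo (block n o₁) (block n o₂) (block n oₑ) μ ≠ ⊤) ∧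
  Tendsto (fun n : ℕ => (1 / (n : ℝ)) *
    min (mutualInfo (block n o₁) (block n o₂) μ).toReal
      (condMutualInfo (block n o₁) (block n o₂) (block n oₑ) μ).toReal) atTop (𝓝 R)

end Rates

end LocationKey

end

/-! Measure every block of observations by its relative entropy `blockDiv` with respect to i.i.d.
standard Gaussian values, and write D(·) for the resulting rate per slot. The chain rule gives
I(X;Y) = D(X,Y) - D(X) - D(Y) and I(X;Y|Z) = D(X,Y,Z) + D(Z) - D(X,Z) - D(Y,Z). For a stationary
process the relative entropy with respect to a product law is superadditive in the block length, so
a linear upper bound and Fekete's lemma give all the limits. Since D and all informations are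
nonnegative, both key rates lie between D(o₁,o₂) - D(o₁,oₑ) - D(o₂,oₑ) and D(o₁,o₂)
(`exists_rates_of_blockDiv_le`). It remains to see that D(o₁,o₂) is asymptotic to ½ log P and that
D(oⱼ,oₑ) = o(log P).

Lower bound for D(o₁,o₂): by superadditivity one slot suffices. There o₁ - o₂ has second moment
O(1/P), and the Donsker–Varadhan inequality with the test function ½ log P - P(x-y)²/2 gives ½ log P
- O(1) (`NoiseBound.le_blockDiv_nodes`).

Upper bounds: given the past, the three distances have a joint density, because the map from three
points of the plane to their distances pulls null sets back to null sets
(`quasiMeasurePreserving_distances`). The pair (oⱼ,oₑ) consists of noisy readings of three different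
distances, and blurring a bounded density leaves it bounded, uniformly in P. The pair (o₁,o₂) reads
one distance twice, so that one reading has a conditional density with peak of order √P; this costs
½ log P.

The density of the distances need not be bounded. Where it exceeds M, only the peak of the noise
density is used, a power of P; this costs a multiple of δ(M) log P, where δ(M) is the probability of
that event and tends to 0 (`ChannelBound.klDiv_le`). By the Markov property and stationarity, δ
depends neither on the slot nor on P (`exists_blockDiv_le_of_channelBound`). Given ε, one fixes M
first and then lets P grow. -/

noncomputable section

namespace LocationKey

open InformationTheory

/-! ### Relative entropy: chain rule against product measures, upper and lower bounds. -/

section KL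

variable {α β δ : Type*} [MeasurableSpace α] [MeasurableSpace β] [MeasurableSpace δ]

lemma klDiv_map_equiv (P Q : Measure α) [IsFiniteMeasure P] [IsFiniteMeasure Q] (e : α ≃ᵐ β) :
    klDiv (P.map e) (Q.map e) = klDiv P Q := by
  refine le_antisymm (klDiv_map_le P Q e.measurable) ?_
  simpa [Measure.map_map e.symm.measurable e.measurable] using
    klDiv_map_le (P.map e) (Q.map e) e.symm.measurable

/-- The chain rule with the conditional law of the second coordinate compared to the constant kernel
`ν`. -/
lemma klDiv_prod_eq_add_fst [StandardBorelSpace β] [Nonempty β] (P : Measure (α × β))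
    [IsFiniteMeasure P] (m : Measure α) (ν : Measure β) [IsFiniteMeasure m]
    [IsProbabilityMeasure ν] :
    klDiv P (m.prod ν) = klDiv P.fst m + klDiv P (P.fst.prod ν) := by
  have h := klDiv_compProd_eq_add P.fst m P.condKernel (Kernel.const α ν)
  rwa [Measure.compProd_const, Measure.compProd_const, Measure.disintegrate] at h

lemma klDiv_prod_eq_add_snd [StandardBorelSpace α] [Nonempty α] (P : Measure (α × β))
    [IsFiniteMeasure P] (m : Measure α) (ν : Measure β) [IsProbabilityMeasure m]
    [IsFiniteMeasure ν] :
    klDiv P (m.prod ν) = klDiv P.snd ν + klDiv P (m.prod P.snd) := by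
  have h := klDiv_prod_eq_add_fst (P.map Prod.swap) ν m
  rw [Measure.fst_map_swap] at h
  have e1 := klDiv_map_equiv P (m.prod ν) MeasurableEquiv.prodComm
  have e2 := klDiv_map_equiv P (m.prod P.snd) MeasurableEquiv.prodComm
  have hc : ⇑(MeasurableEquiv.prodComm : α × β ≃ᵐ β × α) = Prod.swap := rfl
  rw [hc, Measure.prod_swap] at e1 e2
  rw [← e1, ← e2, h]

lemma klDiv_prod_eq_add [StandardBorelSpace α] [Nonempty α] [StandardBorelSpace β] [Nonempty β]
    (P : Measure (α × β)) [IsProbabilityMeasure P] (m : Measure α) (ν : Measure β)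
    [IsProbabilityMeasure m] [IsProbabilityMeasure ν] :
    klDiv P (m.prod ν) = klDiv P.fst m + klDiv P.snd ν + klDiv P (P.fst.prod P.snd) := by
  rw [klDiv_prod_eq_add_fst, klDiv_prod_eq_add_snd P P.fst ν, add_assoc]

lemma rnDeriv_le_of_le_withDensity {P Q : Measure α} [IsFiniteMeasure P] [IsFiniteMeasure Q]
    {g : α → ENNReal} (hle : P ≤ Q.withDensity g) :
    P ≪ Q ∧ P.rnDeriv Q ≤ᵐ[Q] g := by
  have hac : P ≪ Q := (Measure.absolutelyContinuous_of_le hle).trans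
    (withDensity_absolutelyContinuous _ _)
  refine ⟨hac, ?_⟩
  refine ae_le_of_forall_setLIntegral_le_of_sigmaFinite (Measure.measurable_rnDeriv P Q)
    fun s hs _ => ?_
  rw [Measure.setLIntegral_rnDeriv hac, ← withDensity_apply _ hs]
  exact hle s

/-- A density bound bounds the relative entropy. -/
lemma klDiv_le_of_le_withDensity {P Q : Measure α} [IsProbabilityMeasure P]
    [IsProbabilityMeasure Q] {G : α → ℝ}
    (hle : P ≤ Q.withDensity fun x => ENNReal.ofReal (Real.exp (G x))) (hint : Integrable G P) :
    klDiv P Q ≤ ENNReal.ofReal (∫ x, G x ∂P) := by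
  obtain ⟨hac, hd⟩ := rnDeriv_le_of_le_withDensity hle
  have hp1 : Integrable (fun x => (P.rnDeriv Q x).toReal) Q := Measure.integrable_toReal_rnDeriv
  have hpG : Integrable (fun x => (P.rnDeriv Q x).toReal * G x) Q := by
    simpa using (integrable_rnDeriv_smul_iff (f := G) hac).2 hint
  have hI : Integrable (fun x => (P.rnDeriv Q x).toReal * G x + 1 - (P.rnDeriv Q x).toReal) Q :=
    (hpG.add (integrable_const 1)).sub hp1
  have hval : ∫ x, ((P.rnDeriv Q x).toReal * G x + 1 - (P.rnDeriv Q x).toReal) ∂Q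
      = ∫ x, G x ∂P := by
    have hp2 : Integrable (fun x => (P.rnDeriv Q x).toReal * G x + 1) Q :=
      hpG.add (integrable_const 1)
    rw [integral_sub hp2 hp1, integral_add hpG (integrable_const 1)]
    have := integral_rnDeriv_smul (f := G) hac
    simp only [smul_eq_mul] at this
    rw [this, Measure.integral_toReal_rnDeriv hac]
    simp
  -- With `p` the density, `klFun p = p log p + 1 - p`, and `p ≤ exp G` gives `p log p ≤ p G`. The
  -- terms `1 - p` integrate to zero.
  have hb : ∀ᵐ x ∂Q, klFun (P.rnDeriv Q x).toReal ≤
      (P.rnDeriv Q x).toReal * G x + 1 - (P.rnDeriv Q x).toReal := by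
    filter_upwards [hd] with x hx
    rw [klFun]
    have hle : (P.rnDeriv Q x).toReal ≤ Real.exp (G x) :=
      ENNReal.toReal_le_of_le_ofReal (Real.exp_pos _).le hx
    rcases eq_or_lt_of_le (ENNReal.toReal_nonneg (a := P.rnDeriv Q x)) with h0 | h0
    · simp [← h0]
    · have : Real.log (P.rnDeriv Q x).toReal ≤ G x := by
        rw [← Real.log_exp (G x)]; exact Real.log_le_log h0 hle
      have := mul_le_mul_of_nonneg_left this h0.le
      linarith
  rw [klDiv_eq_lintegral_klFun_of_ac hac, ← hval, ofReal_integral_eq_lintegral_ofReal hI]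
  · exact lintegral_mono_ae (hb.mono fun x hx => ENNReal.ofReal_le_ofReal hx)
  · exact hb.mono fun x hx => (klFun_nonneg ENNReal.toReal_nonneg).trans hx

/-- The Donsker–Varadhan lower bound. -/
lemma ofReal_integral_le_klDiv {P Q : Measure α} [IsProbabilityMeasure P]
    [IsProbabilityMeasure Q] {f : α → ℝ} (hf : Measurable f)
    (hQ : ∫⁻ x, ENNReal.ofReal (Real.exp (f x)) ∂Q ≤ 1) (hint : Integrable f P) :
    ENNReal.ofReal (∫ x, f x ∂P) ≤ klDiv P Q := by
  by_cases hac : P ≪ Q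
  swap; · simp [klDiv_of_not_ac hac]
  by_cases hllr : Integrable (llr P Q) P
  swap; · simp [klDiv_of_not_integrable hllr]
  have hp1 : Integrable (fun x => (P.rnDeriv Q x).toReal) Q := Measure.integrable_toReal_rnDeriv
  have hpf : Integrable (fun x => (P.rnDeriv Q x).toReal * f x) Q := by
    simpa using (integrable_rnDeriv_smul_iff (f := f) hac).2 hint
  have hexp : Integrable (fun x => Real.exp (f x)) Q := by
    refine ⟨by fun_prop, ?_⟩
    rw [hasFiniteIntegral_iff_ofReal (ae_of_all _ fun _ => (Real.exp_pos _).le)]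
    exact hQ.trans_lt ENNReal.one_lt_top
  have hexp1 : ∫ x, Real.exp (f x) ∂Q ≤ 1 := by
    rw [integral_eq_lintegral_of_nonneg_ae (ae_of_all _ fun _ => (Real.exp_pos _).le) (by fun_prop)]
    exact ENNReal.toReal_le_of_le_ofReal zero_le_one (by simpa using hQ)
  have hk : Integrable (fun x => klFun (P.rnDeriv Q x).toReal) Q :=
    (integrable_klFun_rnDeriv_iff hac).2 hllr
  have key : ∫ x, f x ∂P ≤ (klDiv P Q).toReal := by
    rw [toReal_klDiv_eq_integral_klFun hac]
    have h1 := integral_rnDeriv_smul (f := f) hac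
    simp only [smul_eq_mul] at h1
    -- Pointwise convex duality: `klFun p ≥ p f - exp f + 1`, which is `t + 1 ≤ exp t` at `t = f -
    -- log p`, multiplied by `p`.
    have h2 : ∫ x, ((P.rnDeriv Q x).toReal * f x - Real.exp (f x) + 1) ∂Q ≤
        ∫ x, klFun (P.rnDeriv Q x).toReal ∂Q := by
      refine integral_mono ((hpf.sub hexp).add (integrable_const 1)) hk fun x => ?_
      have hp : 0 ≤ (P.rnDeriv Q x).toReal := ENNReal.toReal_nonneg
      generalize (P.rnDeriv Q x).toReal = p at hp
      simp only [klFun]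
      rcases eq_or_lt_of_le hp with h0 | h0
      · simp [← h0, (Real.exp_pos _).le]
      · have hh := Real.add_one_le_exp (f x - Real.log p)
        rw [Real.exp_sub, Real.exp_log h0, le_div_iff₀ h0] at hh
        nlinarith
    have h3 : Integrable (fun x => (P.rnDeriv Q x).toReal * f x - Real.exp (f x)) Q :=
      hpf.sub hexp
    rw [integral_add h3 (integrable_const 1), integral_sub hpf hexp, h1] at h2
    simp at h2
    linarith
  exact ENNReal.ofReal_le_of_le_toReal key

end KL

/-! ### Mutual and conditional mutual information through relative entropies. -/

section RandomVariables

variable {Ω α β δ : Type*} [MeasurableSpace Ω] [MeasurableSpace α] [MeasurableSpace β]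
  [MeasurableSpace δ] {μ : Measure Ω} [IsProbabilityMeasure μ]

lemma klDiv_pair_eq_add_mutualInfo [StandardBorelSpace α] [Nonempty α] [StandardBorelSpace β]
    [Nonempty β] {X : Ω → α} {Y : Ω → β} (hX : Measurable X) (hY : Measurable Y)
    (m : Measure α) (ν : Measure β) [IsProbabilityMeasure m] [IsProbabilityMeasure ν] :
    klDiv (μ.map fun ω => (X ω, Y ω)) (m.prod ν) =
      klDiv (μ.map X) m + klDiv (μ.map Y) ν + mutualInfo X Y μ := by
  have : IsProbabilityMeasure (μ.map fun ω => (X ω, Y ω)) :=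
    Measure.isProbabilityMeasure_map (by fun_prop)
  rw [klDiv_prod_eq_add, Measure.fst_map_prodMk hY, Measure.snd_map_prodMk hX, mutualInfo]

lemma mutualInfo_comm {X : Ω → α} {Y : Ω → β} (hX : Measurable X) (hY : Measurable Y) :
    mutualInfo X Y μ = mutualInfo Y X μ := by
  have : IsProbabilityMeasure (μ.map X) := Measure.isProbabilityMeasure_map hX.aemeasurable
  have : IsProbabilityMeasure (μ.map Y) := Measure.isProbabilityMeasure_map hY.aemeasurable
  have : IsProbabilityMeasure (μ.map fun ω => (X ω, Y ω)) :=
    Measure.isProbabilityMeasure_map (by fun_prop)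
  have hc : ⇑(MeasurableEquiv.prodComm : α × β ≃ᵐ β × α) = Prod.swap := rfl
  rw [mutualInfo, ← klDiv_map_equiv _ _ MeasurableEquiv.prodComm, hc, Measure.prod_swap,
    Measure.map_map measurable_swap (by fun_prop)]
  rfl

/-- Conditional independence given `z`, read sequentially: draw `(z, y)`, then `x` from a kernel
that ignores `y`. In this form the chain rule applies. -/
lemma compProd_prod_map_left {Z : Measure δ} [IsProbabilityMeasure Z] (κ : Kernel δ α)
    (η : Kernel δ β) [IsMarkovKernel κ] [IsMarkovKernel η] :
    (Z ⊗ₘ (κ.prod η)).map (fun p => ((p.1, p.2.2), p.2.1)) =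
      (Z ⊗ₘ η) ⊗ₘ (κ.comap Prod.fst measurable_fst) := by
  refine Measure.ext_of_lintegral _ fun f hf => ?_
  rw [lintegral_map hf (by fun_prop), Measure.lintegral_compProd (by fun_prop),
    Measure.lintegral_compProd hf, Measure.lintegral_compProd (by fun_prop)]
  refine lintegral_congr fun z => ?_
  simp only [Kernel.prod_apply, Kernel.comap_apply]
  rw [lintegral_prod_symm' _ (by fun_prop)]

lemma compProd_prod_const_map {Z : Measure δ} [IsProbabilityMeasure Z] (κ : Kernel δ α)
    [IsMarkovKernel κ] (ν : Measure β) [IsProbabilityMeasure ν] :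
    ((Z ⊗ₘ κ).prod ν).map (fun p => ((p.1.1, p.2), p.1.2)) =
      (Z.prod ν) ⊗ₘ (κ.comap Prod.fst measurable_fst) := by
  refine Measure.ext_of_lintegral _ fun f hf => ?_
  rw [lintegral_map hf (by fun_prop), lintegral_prod _ (by fun_prop),
    Measure.lintegral_compProd (by fun_prop), Measure.lintegral_compProd hf,
    lintegral_prod _ hf.lintegral_kernel_prod_right'.aemeasurable]
  refine lintegral_congr fun z => ?_
  simp only [Kernel.comap_apply]
  rw [lintegral_lintegral_swap (by fun_prop)]

/-- The relative entropies of `(Z,X,Y)`, `(Z,X)`, `(Z,Y)` and `Z` with respect to product reference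
measures determine the conditional mutual information. -/
lemma klDiv_triple_add_eq [StandardBorelSpace α] [Nonempty α] [StandardBorelSpace β]
    [Nonempty β] [StandardBorelSpace δ] [Nonempty δ]
    {X : Ω → α} {Y : Ω → β} {Z : Ω → δ} (hX : Measurable X) (hY : Measurable Y)
    (hZ : Measurable Z) (m : Measure α) (ν : Measure β) (ζ : Measure δ)
    [IsProbabilityMeasure m] [IsProbabilityMeasure ν] [IsProbabilityMeasure ζ] :
    klDiv (μ.map fun ω => (Z ω, (X ω, Y ω))) (ζ.prod (m.prod ν)) + klDiv (μ.map Z) ζ =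
      klDiv (μ.map fun ω => (Z ω, X ω)) (ζ.prod m) + klDiv (μ.map fun ω => (Z ω, Y ω)) (ζ.prod ν) +
        condMutualInfo X Y Z μ := by
  have : IsProbabilityMeasure (μ.map Z) := Measure.isProbabilityMeasure_map hZ.aemeasurable
  have : IsProbabilityMeasure (μ.map fun ω => (Z ω, X ω)) :=
    Measure.isProbabilityMeasure_map (by fun_prop)
  have : IsProbabilityMeasure (μ.map fun ω => (Z ω, Y ω)) :=
    Measure.isProbabilityMeasure_map (by fun_prop)
  have : IsProbabilityMeasure (μ.map fun ω => (Z ω, (X ω, Y ω))) :=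
    Measure.isProbabilityMeasure_map (by fun_prop)
  have : IsProbabilityMeasure (μ.map fun ω => ((Z ω, Y ω), X ω)) :=
    Measure.isProbabilityMeasure_map (by fun_prop)
  have : IsProbabilityMeasure (μ.map fun ω => ((Z ω, X ω), Y ω)) :=
    Measure.isProbabilityMeasure_map (by fun_prop)
  set κ := condDistrib X Z μ
  set η := condDistrib Y Z μ
  have hκ : μ.map Z ⊗ₘ κ = μ.map fun ω => (Z ω, X ω) := compProd_map_condDistrib hX.aemeasurable
  have hη : μ.map Z ⊗ₘ η = μ.map fun ω => (Z ω, Y ω) := compProd_map_condDistrib hY.aemeasurable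
  have hY' : μ.map (fun ω => (Z ω, Y ω)) ⊗ₘ condDistrib X (fun ω => (Z ω, Y ω)) μ =
      μ.map fun ω => ((Z ω, Y ω), X ω) := compProd_map_condDistrib hX.aemeasurable
  let e : δ × (α × β) ≃ᵐ (δ × β) × α :=
    { toFun := fun p => ((p.1, p.2.2), p.2.1)
      invFun := fun p => (p.1.1, (p.2, p.1.2))
      left_inv := fun _ => rfl
      right_inv := fun _ => rfl
      measurable_toFun := by simp only [Equiv.coe_fn_mk]; fun_prop
      measurable_invFun := by simp only [Equiv.coe_fn_symm_mk]; fun_prop }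
  have he : ⇑e = fun p => ((p.1, p.2.2), p.2.1) := rfl
  let e' : (δ × α) × β ≃ᵐ (δ × β) × α :=
    { toFun := fun p => ((p.1.1, p.2), p.1.2)
      invFun := fun p => ((p.1.1, p.2), p.1.2)
      left_inv := fun _ => rfl
      right_inv := fun _ => rfl
      measurable_toFun := by simp only [Equiv.coe_fn_mk]; fun_prop
      measurable_invFun := by simp only [Equiv.coe_fn_symm_mk]; fun_prop }
  have he' : ⇑e' = fun p => ((p.1.1, p.2), p.1.2) := rfl
  have hI : condMutualInfo X Y Z μ =
      klDiv (μ.map fun ω => ((Z ω, Y ω), X ω))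
        ((μ.map fun ω => (Z ω, Y ω)) ⊗ₘ (κ.comap Prod.fst measurable_fst)) := by
    rw [condMutualInfo, ← klDiv_map_equiv _ _ e, he, compProd_prod_map_left, hη,
      Measure.map_map (by fun_prop) (by fun_prop)]
    rfl
  -- Chain rule in the order `(Z, Y)`, then `X`. The reference draws `X` from `κ`, given `Z` alone,
  -- so the conditional term is exactly the conditional mutual information in the form `hI`.
  have h1 : klDiv (μ.map fun ω => ((Z ω, X ω), Y ω)) ((μ.map fun ω => (Z ω, X ω)).prod ν) =
      klDiv (μ.map fun ω => (Z ω, Y ω)) ((μ.map Z).prod ν) + condMutualInfo X Y Z μ := by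
    rw [← klDiv_map_equiv _ _ e', he', Measure.map_map (by fun_prop) (by fun_prop), ← hκ,
      compProd_prod_const_map, hI]
    have := klDiv_compProd_eq_add (μ.map fun ω => (Z ω, Y ω)) ((μ.map Z).prod ν)
      (condDistrib X (fun ω => (Z ω, Y ω)) μ) (κ.comap Prod.fst measurable_fst)
    rw [hY'] at this
    exact this
  have h2 : klDiv (μ.map fun ω => (Z ω, (X ω, Y ω))) (ζ.prod (m.prod ν)) =
      klDiv (μ.map fun ω => ((Z ω, X ω), Y ω)) ((ζ.prod m).prod ν) := by
    rw [← klDiv_map_equiv _ _ (MeasurableEquiv.prodAssoc (α := δ) (β := α) (γ := β)),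
      Measure.prodAssoc_prod, Measure.map_map (MeasurableEquiv.measurable _) (by fun_prop)]
    rfl
  have h3 := klDiv_prod_eq_add_fst (μ.map fun ω => ((Z ω, X ω), Y ω)) (ζ.prod m) ν
  have h4 := klDiv_prod_eq_add_fst (μ.map fun ω => (Z ω, Y ω)) ζ ν
  rw [Measure.fst_map_prodMk hY] at h3 h4
  rw [h2, h3, h4, h1]
  ring

end RandomVariables

lemma snoc_block {Ω S : Type*} (X : ℕ → Ω → S) (n : ℕ) (ω : Ω) :
    (Fin.snoc (block n X ω) (X n ω) : Fin (n + 1) → S) = block (n + 1) X ω := by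
  ext i
  refine Fin.lastCases ?_ (fun j => ?_) i
  · simp [block]
  · simp [block]

/-! ### Relative entropy of blocks of a process and its rate. -/

section Blocks

variable {Ω S S' S'' : Type*} [MeasurableSpace Ω] [MeasurableSpace S] [MeasurableSpace S']
  [MeasurableSpace S'']

@[fun_prop]
lemma measurable_block {X : ℕ → Ω → S} (hX : ∀ i, Measurable (X i)) (n : ℕ) :
    Measurable (block n X) :=
  measurable_pi_lambda _ fun i => hX i

lemma measurePreserving_append (ν : Measure S) [SigmaFinite ν] (m n : ℕ) :
    MeasurePreserving (fun p : (Fin m → S) × (Fin n → S) => Fin.append p.1 p.2)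
      ((Measure.pi fun _ => ν).prod (Measure.pi fun _ => ν)) (Measure.pi fun _ => ν) := by
  have hmeas : Measurable (fun p : (Fin m → S) × (Fin n → S) => Fin.append p.1 p.2) := by
    refine measurable_pi_lambda _ fun i => ?_
    refine Fin.addCases (fun j => ?_) (fun j => ?_) i
    · simp only [Fin.append_left]; fun_prop
    · simp only [Fin.append_right]; fun_prop
  refine ⟨hmeas, (Measure.pi_eq fun s hs => ?_).symm⟩
  rw [Measure.map_apply hmeas (MeasurableSet.univ_pi hs)]
  have : (fun p : (Fin m → S) × (Fin n → S) => Fin.append p.1 p.2) ⁻¹' (Set.univ.pi s) =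
      (Set.univ.pi fun i => s (Fin.castAdd n i)) ×ˢ (Set.univ.pi fun i => s (Fin.natAdd m i)) := by
    ext p
    simp only [Set.mem_preimage, Set.mem_pi, Set.mem_univ, true_imp_iff, Set.mem_prod]
    constructor
    · exact fun h => ⟨fun i => by simpa using h (Fin.castAdd n i),
        fun i => by simpa using h (Fin.natAdd m i)⟩
    · rintro ⟨h1, h2⟩ i
      refine Fin.addCases (fun j => ?_) (fun j => ?_) i
      · simpa using h1 j
      · simpa using h2 j
  rw [this, Measure.prod_prod, Measure.pi_pi, Measure.pi_pi, Fin.prod_univ_add]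

lemma measurePreserving_split (ν : Measure S) [SigmaFinite ν] (m n : ℕ) :
    MeasurePreserving (fun f : Fin (m + n) → S =>
      ((fun i => f (Fin.castAdd n i), fun i => f (Fin.natAdd m i)) : (Fin m → S) × (Fin n → S)))
      (Measure.pi fun _ => ν) ((Measure.pi fun _ => ν).prod (Measure.pi fun _ => ν)) := by
  refine ⟨by fun_prop, ?_⟩
  have h := measurePreserving_append ν m n
  rw [← h.map_eq, Measure.map_map (by fun_prop) h.measurable]
  convert Measure.map_id
  ext p <;> simp

lemma measurePreserving_snoc (ν : Measure S) [SigmaFinite ν] (n : ℕ) :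
    MeasurePreserving (fun p : (Fin n → S) × S => (Fin.snoc p.1 p.2 : Fin (n + 1) → S))
      ((Measure.pi fun _ => ν).prod ν) (Measure.pi fun _ => ν) := by
  have hmeas : Measurable (fun p : (Fin n → S) × S => (Fin.snoc p.1 p.2 : Fin (n + 1) → S)) := by
    refine measurable_pi_lambda _ fun i => ?_
    refine Fin.lastCases ?_ (fun j => ?_) i
    · simp only [Fin.snoc_last]; fun_prop
    · simp only [Fin.snoc_castSucc]; fun_prop
  refine ⟨hmeas, (Measure.pi_eq fun s hs => ?_).symm⟩
  rw [Measure.map_apply hmeas (MeasurableSet.univ_pi hs)]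
  have : (fun p : (Fin n → S) × S => (Fin.snoc p.1 p.2 : Fin (n + 1) → S)) ⁻¹' (Set.univ.pi s) =
      (Set.univ.pi fun i => s (Fin.castSucc i)) ×ˢ s (Fin.last n) := by
    ext p
    simp only [Set.mem_preimage, Set.mem_pi, Set.mem_univ, true_imp_iff, Set.mem_prod]
    constructor
    · exact fun h => ⟨fun i => by simpa using h (Fin.castSucc i), by simpa using h (Fin.last n)⟩
    · rintro ⟨h1, h2⟩ i
      refine Fin.lastCases ?_ (fun j => ?_) i
      · simpa using h2
      · simpa using h1 j
  rw [this, Measure.prod_prod, Measure.pi_pi, Fin.prod_univ_castSucc]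

/-- Relative entropy of the first `n` values of a process with respect to i.i.d. values. -/
def blockDiv (X : ℕ → Ω → S) (ν : Measure S) (μ : Measure Ω) (n : ℕ) : ENNReal :=
  klDiv (μ.map (block n X)) (Measure.pi fun _ => ν)

variable {μ : Measure Ω} [IsProbabilityMeasure μ] {ν : Measure S} [IsProbabilityMeasure ν]

lemma isProbabilityMeasure_map_block {X : ℕ → Ω → S} (hX : ∀ i, Measurable (X i)) (n : ℕ) :
    IsProbabilityMeasure (μ.map (block n X)) :=
  Measure.isProbabilityMeasure_map (by fun_prop)

lemma blockDiv_zero {X : ℕ → Ω → S} (hX : ∀ i, Measurable (X i)) : blockDiv X ν μ 0 = 0 := by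
  have := isProbabilityMeasure_map_block (μ := μ) hX 0
  have : μ.map (block 0 X) = Measure.pi fun _ => ν := by
    ext s _
    rcases (Set.subsingleton_of_subsingleton (s := s)).eq_empty_or_singleton with h | ⟨x, h⟩
    · simp [h]
    · have : s = Set.univ := by ext y; simp [h, Subsingleton.elim y x]
      rw [this, measure_univ, measure_univ]
  rw [blockDiv, this, klDiv_self]

/-- Regrouping coordinates is a measurable equivalence that matches the two product references. It
links the entropies of a joint process to the informations between blocks. -/
lemma blockDiv_pair {ν' : Measure S'} [IsProbabilityMeasure ν'] {X : ℕ → Ω → S} {Y : ℕ → Ω → S'}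
    (hX : ∀ i, Measurable (X i)) (hY : ∀ i, Measurable (Y i)) (n : ℕ) :
    blockDiv (fun i ω => (X i ω, Y i ω)) (ν.prod ν') μ n =
      klDiv (μ.map fun ω => (block n X ω, block n Y ω))
        ((Measure.pi fun _ => ν).prod (Measure.pi fun _ => ν')) := by
  have hXY : ∀ i, Measurable fun ω => (X i ω, Y i ω) := fun i => (hX i).prodMk (hY i)
  have := isProbabilityMeasure_map_block (μ := μ) hXY n
  have h := measurePreserving_arrowProdEquivProdArrow S S' (Fin n) (fun _ => ν) (fun _ => ν')
  rw [blockDiv, ← klDiv_map_equiv _ _ (MeasurableEquiv.arrowProdEquivProdArrow S S' (Fin n)),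
    h.map_eq, Measure.map_map h.measurable (measurable_block hXY n)]
  rfl

lemma blockDiv_triple {ν' : Measure S'} [IsProbabilityMeasure ν'] {ν'' : Measure S''}
    [IsProbabilityMeasure ν''] {X : ℕ → Ω → S} {Y : ℕ → Ω → S'} {Z : ℕ → Ω → S''}
    (hX : ∀ i, Measurable (X i)) (hY : ∀ i, Measurable (Y i)) (hZ : ∀ i, Measurable (Z i)) (n : ℕ) :
    blockDiv (fun i ω => (X i ω, (Y i ω, Z i ω))) (ν.prod (ν'.prod ν'')) μ n =
      klDiv (μ.map fun ω => (block n X ω, (block n Y ω, block n Z ω)))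
        ((Measure.pi fun _ => ν).prod
          ((Measure.pi fun _ => ν').prod (Measure.pi fun _ => ν''))) := by
  have hYZ : ∀ i, Measurable fun ω => (Y i ω, Z i ω) := fun i => (hY i).prodMk (hZ i)
  have : IsProbabilityMeasure (μ.map fun ω => (block n X ω, block n (fun i ω => (Y i ω, Z i ω)) ω)) :=
    Measure.isProbabilityMeasure_map (by fun_prop)
  have h := measurePreserving_arrowProdEquivProdArrow S' S'' (Fin n) (fun _ => ν') (fun _ => ν'')
  let e := (MeasurableEquiv.refl (Fin n → S)).prodCongr
    (MeasurableEquiv.arrowProdEquivProdArrow S' S'' (Fin n))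
  have he : ⇑e = Prod.map id (MeasurableEquiv.arrowProdEquivProdArrow S' S'' (Fin n)) := rfl
  rw [blockDiv_pair hX hYZ, ← klDiv_map_equiv _ _ e,
    Measure.map_map e.measurable (by fun_prop), he,
    ← Measure.map_prod_map _ _ measurable_id h.measurable, h.map_eq, Measure.map_id]
  rfl

variable [StandardBorelSpace S] [Nonempty S]

/-- Against a product reference, the relative entropy of two adjacent blocks is the sum of the
separate ones plus their mutual information. The latter is dropped, and stationarity moves the
second block to the origin. -/
lemma blockDiv_add_le {X : ℕ → Ω → S} (hX : ∀ i, Measurable (X i)) (hstat : IsStationary X μ)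
    (m n : ℕ) : blockDiv X ν μ m + blockDiv X ν μ n ≤ blockDiv X ν μ (m + n) := by
  have := isProbabilityMeasure_map_block (μ := μ) hX (m + n)
  have hs := measurePreserving_split ν m n
  have h := klDiv_map_le (μ.map (block (m + n) X)) (Measure.pi fun _ => ν) hs.measurable
  rw [hs.map_eq, Measure.map_map hs.measurable (by fun_prop)] at h
  refine le_trans ?_ h
  have h2 := klDiv_pair_eq_add_mutualInfo (μ := μ) (measurable_block hX m)
    (measurable_block (fun i => hX (m + i)) n) (Measure.pi fun _ => ν) (Measure.pi fun _ => ν)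
  rw [hstat m n] at h2
  exact le_self_add.trans h2.ge

lemma blockDiv_succ_le {X : ℕ → Ω → S} (hX : ∀ i, Measurable (X i)) (n : ℕ) :
    blockDiv X ν μ (n + 1) ≤ blockDiv X ν μ n +
      klDiv (μ.map fun ω => (block n X ω, X n ω)) ((μ.map (block n X)).prod ν) := by
  have : IsProbabilityMeasure (μ.map fun ω => (block n X ω, X n ω)) :=
    Measure.isProbabilityMeasure_map (by fun_prop)
  have hs := measurePreserving_snoc ν n
  have h := klDiv_map_le (μ.map fun ω => (block n X ω, X n ω))
    ((Measure.pi fun _ => ν).prod ν) hs.measurable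
  rw [hs.map_eq, Measure.map_map hs.measurable (by fun_prop), klDiv_prod_eq_add_fst,
    Measure.fst_map_prodMk (hX n)] at h
  have he : (fun p : (Fin n → S) × S => (Fin.snoc p.1 p.2 : Fin (n + 1) → S)) ∘
      (fun ω => (block n X ω, X n ω)) = block (n + 1) X := funext (snoc_block X n)
  rwa [he] at h

/-- A uniform bound on the conditional relative entropy given the past of a driving process gives
a linear bound on the relative entropy. -/
lemma blockDiv_le_mul {T : Type*} [MeasurableSpace T] {U : ℕ → Ω → T} {G : T → S}
    (hU : ∀ i, Measurable (U i)) (hG : Measurable G)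
    (hstat : IsStationary (fun i ω => G (U i ω)) μ) {C : ENNReal}
    (hC : ∀ n, klDiv (μ.map fun ω => (block (n + 1) U ω, G (U (n + 1) ω)))
      ((μ.map (block (n + 1) U)).prod ν) ≤ C) (n : ℕ) :
    blockDiv (fun i ω => G (U i ω)) ν μ n ≤ n * C := by
  have hX : ∀ i, Measurable (fun ω => G (U i ω)) := fun i => by fun_prop
  induction n with
  | zero => simp [blockDiv_zero hX]
  | succ n ih =>
    rcases n with _ | n
    · have h1 := hstat 1 1
      have : IsProbabilityMeasure (μ.map fun ω => G (U 1 ω)) :=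
        Measure.isProbabilityMeasure_map (hX 1).aemeasurable
      have : IsProbabilityMeasure (μ.map (block (0 + 1) U)) :=
        isProbabilityMeasure_map_block hU _
      have : IsProbabilityMeasure (μ.map fun ω => (block (0 + 1) U ω, G (U (0 + 1) ω))) :=
        Measure.isProbabilityMeasure_map (by fun_prop)
      have hm : Measurable (fun (x : S) (_ : Fin 1) => x) := by fun_prop
      have h2 := klDiv_map_le (μ.map fun ω => G (U 1 ω)) ν hm
      have hν : ν.map (fun (x : S) (_ : Fin 1) => x) = Measure.pi fun _ => ν := by
        refine (Measure.pi_eq fun s hs => ?_).symm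
        rw [Measure.map_apply hm (MeasurableSet.univ_pi hs)]
        simp only [Finset.univ_unique, Fin.default_eq_zero, Fin.isValue, Finset.prod_singleton]
        congr 1
        ext x
        simp [Fin.forall_fin_one]
      rw [hν, Measure.map_map hm (hX 1)] at h2
      have h3 := klDiv_map_le (μ.map fun ω => (block (0 + 1) U ω, G (U (0 + 1) ω)))
        ((μ.map (block (0 + 1) U)).prod ν) measurable_snd
      rw [Measure.map_map measurable_snd (by fun_prop), Measure.map_snd_prod, measure_univ,
        one_smul] at h3
      simp only [zero_add, Nat.cast_one, one_mul]
      refine le_trans ?_ (h3.trans (hC 0))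
      refine le_trans (le_of_eq ?_) h2
      rw [blockDiv, ← h1]
      congr 2
      ext ω i
      simp [block]
    · refine (blockDiv_succ_le hX (n + 1)).trans ?_
      have : IsProbabilityMeasure (μ.map (block (n + 1) U)) :=
        isProbabilityMeasure_map_block hU _
      have : IsProbabilityMeasure (μ.map fun ω => (block (n + 1) U ω, G (U (n + 1) ω))) :=
        Measure.isProbabilityMeasure_map (by fun_prop)
      -- The past outputs are functions of the past driving values. By data processing, conditioning
      -- on less lowers the relative entropy.
      have hg : Measurable (fun (b : Fin (n + 1) → T) i => G (b i)) := by fun_prop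
      have h := klDiv_map_le (μ.map fun ω => (block (n + 1) U ω, G (U (n + 1) ω)))
        ((μ.map (block (n + 1) U)).prod ν) (hg.prodMap measurable_id)
      rw [← Measure.map_prod_map _ _ hg measurable_id, Measure.map_id,
        Measure.map_map hg (by fun_prop), Measure.map_map (by fun_prop) (by fun_prop)] at h
      have h' := h.trans (hC n)
      calc _ ≤ ((n + 1 : ℕ) : ENNReal) * C + C := add_le_add ih h'
        _ = _ := by push_cast; ring

/-- Existence of the relative entropy rate. -/
lemma exists_tendsto_blockDiv {X : ℕ → Ω → S} (hX : ∀ i, Measurable (X i))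
    (hstat : IsStationary X μ) {C : ℝ} (hC0 : 0 ≤ C)
    (hC : ∀ n, blockDiv X ν μ n ≤ n * ENNReal.ofReal C) :
    ∃ L : ℝ, Tendsto (fun n : ℕ => (1 / (n : ℝ)) * (blockDiv X ν μ n).toReal) atTop (𝓝 L) ∧
      (blockDiv X ν μ 1).toReal ≤ L ∧ 0 ≤ L := by
  have hfin : ∀ n, blockDiv X ν μ n ≠ ⊤ := fun n =>
    ((hC n).trans_lt (ENNReal.mul_lt_top (by simp) ENNReal.ofReal_lt_top)).ne
  have hub : ∀ n, (blockDiv X ν μ n).toReal ≤ n * C := fun n => by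
    refine ENNReal.toReal_le_of_le_ofReal (by positivity) ?_
    rw [ENNReal.ofReal_mul (by positivity), ENNReal.ofReal_natCast]
    exact hC n
  -- Fekete's lemma is applied to the negative of the superadditive sequence.
  have hsub : Subadditive fun n => -(blockDiv X ν μ n).toReal := fun m n => by
    have := ENNReal.toReal_mono (hfin (m + n)) (blockDiv_add_le (ν := ν) hX hstat m n)
    rw [ENNReal.toReal_add (hfin m) (hfin n)] at this
    linarith
  have hbdd : BddBelow (Set.range fun n : ℕ => -(blockDiv X ν μ n).toReal / n) := by
    refine ⟨-C, ?_⟩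
    rintro _ ⟨n, rfl⟩
    rcases Nat.eq_zero_or_pos n with rfl | hn
    · simpa using hC0
    · have : (0 : ℝ) < n := by exact_mod_cast hn
      simp only
      rw [le_div_iff₀ this]
      linarith [hub n]
  have hlim : Tendsto (fun n : ℕ => (1 / (n : ℝ)) * (blockDiv X ν μ n).toReal) atTop
      (𝓝 (-hsub.lim)) := by
    refine (hsub.tendsto_lim hbdd).neg.congr fun n => ?_
    ring
  refine ⟨_, hlim, ?_, ge_of_tendsto' hlim fun n => by positivity⟩
  -- The rate is the supremum of the ratios over positive lengths, and length one is among them;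
  -- hence a single slot bounds the rate below.
  have := hsub.lim_le_div hbdd one_ne_zero
  simp at this
  linarith

end Blocks

/-! ### Rearrangements of products of measures and kernels. -/

section Rearrange

variable {α β γ δ : Type*} [MeasurableSpace α] [MeasurableSpace β] [MeasurableSpace γ]
  [MeasurableSpace δ]

lemma map_compProd_comap (m : Measure α) [IsProbabilityMeasure m] {e : α → β} (he : Measurable e)
    (κ : Kernel β γ) [IsMarkovKernel κ] :
    m.map e ⊗ₘ κ = (m ⊗ₘ κ.comap e he).map (Prod.map e id) := by
  have : IsProbabilityMeasure (m.map e) := Measure.isProbabilityMeasure_map he.aemeasurable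
  refine Measure.ext_of_lintegral _ fun f hf => ?_
  rw [lintegral_map hf (by fun_prop), Measure.lintegral_compProd hf,
    Measure.lintegral_compProd (by fun_prop), lintegral_map hf.lintegral_kernel_prod_right' he]
  rfl

lemma map_prod_left (m : Measure α) [SFinite m] (ν : Measure γ) [SFinite ν] {e : α → β}
    (he : Measurable e) : (m.map e).prod ν = (m.prod ν).map (Prod.map e id) := by
  have := Measure.map_prod_map m ν he measurable_id
  rwa [Measure.map_id] at this

/-- Used with `P` the past motion, `Q` the past noise and `ν` the fresh noise: the past noise joins
the past, and the fresh noise stays a separate factor. -/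
lemma compProd_prod_prod_map (P : Measure α) [IsProbabilityMeasure P] (κ : Kernel α γ)
    [IsMarkovKernel κ] (Q : Measure β) [IsProbabilityMeasure Q] (ν : Measure δ)
    [IsProbabilityMeasure ν] :
    ((P ⊗ₘ κ).prod (Q.prod ν)).map
        (fun p : (α × γ) × (β × δ) => (((p.1.1, p.2.1), p.1.2), p.2.2)) =
      ((P.prod Q) ⊗ₘ κ.comap Prod.fst measurable_fst).prod ν := by
  rw [← compProd_prod_const_map κ Q]
  rw [map_prod_left _ _ (by fun_prop), ← Measure.prodAssoc_prod,
    Measure.map_map (by fun_prop) (MeasurableEquiv.measurable _)]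
  rfl

end Rearrange

/-! ### Stationary Markov motion with independent noise. -/

section Markov

variable {Ω S N : Type*} [MeasurableSpace Ω] [MeasurableSpace S] [MeasurableSpace N]
  {μ : Measure Ω}

lemma map_eq_of_isStationary {X : ℕ → Ω → S} (hX : ∀ i, Measurable (X i))
    (hstat : IsStationary X μ) (n : ℕ) : μ.map (X n) = μ.map (X 0) := by
  have h := congrArg (Measure.map fun b : Fin 1 → S => b 0) (hstat n 1)
  rw [Measure.map_map (by fun_prop) (measurable_block (fun i => hX (n + i)) 1),
    Measure.map_map (by fun_prop) (measurable_block hX 1)] at h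
  exact h

lemma map_pair_eq_of_isStationary {X : ℕ → Ω → S} (hX : ∀ i, Measurable (X i))
    (hstat : IsStationary X μ) (n : ℕ) :
    μ.map (fun ω => (X n ω, X (n + 1) ω)) = μ.map (fun ω => (X 0 ω, X 1 ω)) := by
  have h := congrArg (Measure.map fun b : Fin 2 → S => (b 0, b 1)) (hstat n 2)
  rw [Measure.map_map (by fun_prop) (measurable_block (fun i => hX (n + i)) 2),
    Measure.map_map (by fun_prop) (measurable_block hX 2)] at h
  exact h

lemma isStationary_comp {X : ℕ → Ω → S} (hX : ∀ i, Measurable (X i)) (hstat : IsStationary X μ)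
    {G : S → N} (hG : Measurable G) : IsStationary (fun i ω => G (X i ω)) μ := fun k n => by
  have hg : Measurable fun (b : Fin n → S) i => G (b i) := by fun_prop
  have h := congrArg (Measure.map fun (b : Fin n → S) i => G (b i)) (hstat k n)
  rw [Measure.map_map hg (measurable_block (fun i => hX (k + i)) n),
    Measure.map_map hg (measurable_block hX n)] at h
  exact h

variable [IsProbabilityMeasure μ]

/-- One kernel serves all slots. Stationarity identifies the conditional law given `s n` with the
one given `s 0`, and the Markov property extends the conditioning to the whole past; the joint laws
are compared on rectangles. -/
lemma exists_transition_kernel [StandardBorelSpace S] [Nonempty S] {s : ℕ → Ω → S}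
    (hs : ∀ i, Measurable (s i)) (hstat : IsStationary s μ) (hmarkov : IsMarkov s μ) :
    ∃ κ : Kernel S S, IsMarkovKernel κ ∧
      μ.map (fun ω => (s 0 ω, s 1 ω)) = μ.map (s 0) ⊗ₘ κ ∧
      ∀ n, μ.map (fun ω => (block (n + 1) s ω, s (n + 1) ω)) =
        μ.map (block (n + 1) s) ⊗ₘ κ.comap (fun b => b (Fin.last n)) (by fun_prop) := by
  have hpair : μ.map (fun ω => (s 0 ω, s 1 ω)) = μ.map (s 0) ⊗ₘ condDistrib (s 1) (s 0) μ :=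
    (compProd_map_condDistrib (hs 1).aemeasurable).symm
  refine ⟨condDistrib (s 1) (s 0) μ, inferInstance, hpair, fun n => ?_⟩
  set κ := condDistrib (s 1) (s 0) μ
  have hb : Measurable (block (n + 1) s) := measurable_block hs _
  have := isProbabilityMeasure_map_block (μ := μ) hs (n + 1)
  have : IsProbabilityMeasure (μ.map fun ω => (block (n + 1) s ω, s (n + 1) ω)) :=
    Measure.isProbabilityMeasure_map (by fun_prop)
  have hn : condDistrib (s (n + 1)) (s n) μ =ᵐ[μ.map (s n)] κ := by
    refine condDistrib_ae_eq_of_measure_eq_compProd_of_measurable (hs n) (hs (n + 1)) ?_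
    rw [map_pair_eq_of_isStationary hs hstat n, map_eq_of_isStationary hs hstat n, hpair]
  have hn' := ae_of_ae_map (hs n).aemeasurable hn
  refine Measure.ext_prod fun {C B} hC hB => ?_
  rw [Measure.map_apply (by fun_prop) (hC.prod hB), Measure.compProd_apply_prod hC hB,
    setLIntegral_map hC (Kernel.measurable_coe _ hB) hb]
  -- The Markov property enters here: the kernel at the last position is a version of the
  -- conditional probability given the full block.
  have h1 : (fun ω => (κ (s n ω)).real B) =ᵐ[μ]
      μ[(s (n + 1) ⁻¹' B).indicator (fun _ => (1 : ℝ)) |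
        MeasurableSpace.comap (block (n + 1) s) inferInstance] := by
    refine EventuallyEq.trans ?_ (hmarkov n B hB).symm
    refine EventuallyEq.trans ?_ (condDistrib_ae_eq_condExp (μ := μ) (hs n) (hs (n + 1)) hB)
    filter_upwards [hn'] with ω hω
    rw [hω]
  have h2 : ∫ ω in block (n + 1) s ⁻¹' C, (κ (s n ω)).real B ∂μ =
      μ.real (block (n + 1) s ⁻¹' C ∩ s (n + 1) ⁻¹' B) := by
    rw [setIntegral_congr_ae (hb hC) (h1.mono fun ω h _ => h),
      setIntegral_condExp hb.comap_le ((integrable_const _).indicator (hs _ hB)) ⟨C, hC, rfl⟩,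
      setIntegral_indicator (hs _ hB)]
    simp
  have h3 : ∫⁻ ω in block (n + 1) s ⁻¹' C, κ (s n ω) B ∂μ =
      μ (block (n + 1) s ⁻¹' C ∩ s (n + 1) ⁻¹' B) := by
    rw [← ofReal_measureReal, ← h2, ofReal_integral_eq_lintegral_ofReal]
    · simp
    · refine Integrable.of_bound (C := 1) ?_ (ae_of_all _ fun ω => ?_)
      · exact ((Kernel.measurable_coe κ hB).comp (hs n)).ennreal_toReal.aestronglyMeasurable
      · rw [Real.norm_of_nonneg measureReal_nonneg]
        exact measureReal_le_one
    · exact ae_of_all _ fun ω => measureReal_nonneg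
  rw [Set.mk_preimage_prod]
  exact h3.symm

variable {s : ℕ → Ω → S} {ζ : ℕ → Ω → N} {ν : Measure N}

lemma isStationary_pair (hs : ∀ i, Measurable (s i)) (hζ : ∀ i, Measurable (ζ i))
    (hstat : IsStationary s μ)
    (hlaw : ∀ k n, μ.map (block n fun i => ζ (k + i)) = Measure.pi fun _ => ν)
    (hind : IndepFun (fun ω i => s i ω) (fun ω i => ζ i ω) μ) :
    IsStationary (fun i ω => (s i ω, ζ i ω)) μ := by
  have key : ∀ k n, μ.map (block n fun i ω => (s (k + i) ω, ζ (k + i) ω)) =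
      ((μ.map (block n s)).prod (Measure.pi fun _ => ν)).map
        fun (p : (Fin n → S) × (Fin n → N)) i => (p.1 i, p.2 i) := fun k n => by
    have h1 : IndepFun (block n fun i => s (k + i)) (block n fun i => ζ (k + i)) μ :=
      hind.comp (φ := fun (f : ℕ → S) (i : Fin n) => f (k + i))
        (ψ := fun (f : ℕ → N) (i : Fin n) => f (k + i))
        (by fun_prop) (by fun_prop)
    rw [indepFun_iff_map_prod_eq_prod_map_map (by fun_prop) (by fun_prop), hlaw, hstat] at h1
    rw [← h1, Measure.map_map (by fun_prop) (by fun_prop)]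
    rfl
  intro k n
  have h0 := key 0 n
  simp only [Nat.zero_add] at h0
  rw [key k n, h0]

variable [IsProbabilityMeasure ν]

/-- The past noise is independent of the motion, so it does not help to predict the next position.
The fresh noise is independent of the whole past and of that position. -/
lemma map_block_pair_succ (hs : ∀ i, Measurable (s i)) (hζ : ∀ i, Measurable (ζ i))
    (hlaw : ∀ n, μ.map (block n ζ) = Measure.pi fun _ => ν)
    (hind : IndepFun (fun ω i => s i ω) (fun ω i => ζ i ω) μ) {κ : Kernel S S} [IsMarkovKernel κ]
    {n : ℕ} (hκ : μ.map (fun ω => (block (n + 1) s ω, s (n + 1) ω)) =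
        μ.map (block (n + 1) s) ⊗ₘ κ.comap (fun b => b (Fin.last n)) (by fun_prop)) :
    μ.map (fun ω => ((block (n + 1) (fun i ω => (s i ω, ζ i ω)) ω, s (n + 1) ω), ζ (n + 1) ω)) =
      (μ.map (block (n + 1) fun i ω => (s i ω, ζ i ω)) ⊗ₘ
        κ.comap (fun b => (b (Fin.last n)).1) (by fun_prop)).prod ν := by
  have := isProbabilityMeasure_map_block (μ := μ) hs (n + 1)
  have hU : ∀ i, Measurable fun ω => (s i ω, ζ i ω) := fun i => by fun_prop
  have := isProbabilityMeasure_map_block (μ := μ) hU (n + 1)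
  have hζ2 : μ.map (fun ω => (block (n + 1) ζ ω, ζ (n + 1) ω)) =
      (Measure.pi fun _ => ν).prod ν := by
    have h := measurePreserving_split ν (n + 1) 1
    have h' : MeasurePreserving (fun f : Fin (n + 1 + 1) → N =>
        ((fun i => f (Fin.castSucc i), f (Fin.last (n + 1))) : (Fin (n + 1) → N) × N))
        (Measure.pi fun _ => ν) ((Measure.pi fun _ => ν).prod ν) := by
      have h1 : MeasurePreserving (fun f : Fin 1 → N => f 0) (Measure.pi fun _ => ν) ν :=
        measurePreserving_eval (fun _ : Fin 1 => ν) 0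
      exact ((MeasurePreserving.id _).prod h1).comp h
    rw [← h'.map_eq, ← hlaw (n + 1 + 1), Measure.map_map h'.measurable (by fun_prop)]
    rfl
  have hind2 : IndepFun (fun ω => (block (n + 1) s ω, s (n + 1) ω))
      (fun ω => (block (n + 1) ζ ω, ζ (n + 1) ω)) μ :=
    hind.comp (φ := fun f : ℕ → S => ((fun i : Fin (n + 1) => f i), f (n + 1)))
      (ψ := fun f : ℕ → N => ((fun i : Fin (n + 1) => f i), f (n + 1))) (by fun_prop) (by fun_prop)
  have hind1 : IndepFun (block (n + 1) s) (block (n + 1) ζ) μ :=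
    hind2.comp measurable_fst measurable_fst
  rw [indepFun_iff_map_prod_eq_prod_map_map (by fun_prop) (by fun_prop), hκ, hζ2] at hind2
  rw [indepFun_iff_map_prod_eq_prod_map_map (by fun_prop) (by fun_prop), hlaw] at hind1
  have e1 : μ.map (block (n + 1) fun i ω => (s i ω, ζ i ω)) =
      (((μ.map (block (n + 1) s)).prod (Measure.pi fun _ => ν))).map
        fun (p : (Fin (n + 1) → S) × (Fin (n + 1) → N)) i => (p.1 i, p.2 i) := by
    rw [← hind1, Measure.map_map (by fun_prop) (by fun_prop)]
    rfl
  have e2 : μ.map (fun ω => ((block (n + 1) (fun i ω => (s i ω, ζ i ω)) ω, s (n + 1) ω),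
        ζ (n + 1) ω)) =
      (μ.map fun ω => ((block (n + 1) s ω, s (n + 1) ω), (block (n + 1) ζ ω, ζ (n + 1) ω))).map
        fun (p : ((Fin (n + 1) → S) × S) × ((Fin (n + 1) → N) × N)) =>
          (((fun i => (p.1.1 i, p.2.1 i) : Fin (n + 1) → S × N), p.1.2), p.2.2) := by
    rw [Measure.map_map (by fun_prop) (by fun_prop)]
    rfl
  have e3 := compProd_prod_prod_map (μ.map (block (n + 1) s))
    (κ.comap (fun b => b (Fin.last n)) (by fun_prop)) (Measure.pi fun _ : Fin (n + 1) => ν) ν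
  let e : (Fin (n + 1) → S) × (Fin (n + 1) → N) → (Fin (n + 1) → S × N) := fun p i => (p.1 i, p.2 i)
  have he : Measurable e := by fun_prop
  have e4 := map_compProd_comap ((μ.map (block (n + 1) s)).prod (Measure.pi fun _ => ν)) he
    (κ.comap (fun b : Fin (n + 1) → S × N => (b (Fin.last n)).1) (by fun_prop))
  rw [e2, hind2, e1, e4]
  rw [map_prod_left _ _ (by fun_prop)]
  have e5 : (κ.comap (fun b : Fin (n + 1) → S × N => (b (Fin.last n)).1) (by fun_prop)).comap e he =
      (κ.comap (fun b : Fin (n + 1) → S => b (Fin.last n)) (by fun_prop)).comap Prod.fst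
        measurable_fst := rfl
  rw [e5, ← e3, Measure.map_map (by fun_prop) (by fun_prop)]
  rfl

end Markov

/-! ### The distances of three points of the plane with a density have a density. -/

section Distances

open MeasureTheory.Measure

/-- Fubini: almost every slice of a null set is null. Triangular maps thus reduce to
lower-dimensional ones, and no Jacobian is needed. -/
lemma quasiMeasurePreserving_skew {α β γ δ : Type*} [MeasurableSpace α] [MeasurableSpace β]
    [MeasurableSpace γ] [MeasurableSpace δ] {μ : Measure α} {ν : Measure β} {τ : Measure γ}
    {σ : Measure δ} [SFinite ν] [SFinite σ] {f : α → γ} {g : α → β → δ}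
    (hg : Measurable (Function.uncurry g)) (hf : QuasiMeasurePreserving f μ τ)
    (hgq : ∀ᵐ x ∂μ, QuasiMeasurePreserving (g x) ν σ) :
    QuasiMeasurePreserving (fun p : α × β => (f p.1, g p.1 p.2)) (μ.prod ν) (τ.prod σ) := by
  have hm : Measurable (fun p : α × β => (f p.1, g p.1 p.2)) :=
    (hf.measurable.comp measurable_fst).prodMk hg
  refine ⟨hm, AbsolutelyContinuous.mk fun s hs h0 => ?_⟩
  rw [map_apply hm hs, measure_prod_null (hm hs)]
  rw [measure_prod_null hs] at h0
  filter_upwards [hgq, hf.ae h0] with x hx h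
  exact hx.preimage_null h

/-- The preimage of a set lies in the union of `{0}` and the images of its positive part under the
two branches `√` and `-√`. These are differentiable there and send null sets to null sets. -/
lemma quasiMeasurePreserving_sq :
    QuasiMeasurePreserving (fun y : ℝ => y ^ 2) volume volume := by
  refine ⟨by fun_prop, AbsolutelyContinuous.mk fun s hs h0 => ?_⟩
  rw [map_apply (by fun_prop) hs]
  have hd : DifferentiableOn ℝ Real.sqrt (s ∩ Set.Ioi 0) := fun x hx =>
    (Real.hasDerivAt_sqrt (ne_of_gt hx.2)).differentiableAt.differentiableWithinAt
  have hs0 : volume (s ∩ Set.Ioi 0) = 0 := measure_mono_null Set.inter_subset_left h0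
  have h1 := addHaar_image_eq_zero_of_differentiableOn_of_addHaar_eq_zero volume hd hs0
  have h2 := addHaar_image_eq_zero_of_differentiableOn_of_addHaar_eq_zero volume hd.neg hs0
  refine measure_mono_null (t := {0} ∪ (Real.sqrt '' (s ∩ Set.Ioi 0)) ∪
    ((-Real.sqrt) '' (s ∩ Set.Ioi 0))) (fun y hy => ?_) ?_
  · rcases lt_trichotomy y 0 with h | h | h
    · exact Or.inr ⟨y ^ 2, ⟨hy, sq_pos_of_neg h⟩, by simp [Real.sqrt_sq_eq_abs, abs_of_neg h]⟩
    · exact Or.inl (Or.inl h)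
    · exact Or.inl (Or.inr ⟨y ^ 2, ⟨hy, sq_pos_of_pos h⟩,
        by simp [Real.sqrt_sq_eq_abs, abs_of_pos h]⟩)
  · exact measure_union_null (measure_union_null (by simp) h1) h2

lemma quasiMeasurePreserving_affine {a : ℝ} (ha : a ≠ 0) (b : ℝ) :
    QuasiMeasurePreserving (fun y : ℝ => a * y + b) volume volume := by
  have h1 : QuasiMeasurePreserving (fun y : ℝ => a * y) volume volume := by
    refine ⟨by fun_prop, ?_⟩
    rw [Real.map_volume_mul_left ha]
    exact smul_absolutelyContinuous
  exact (measurePreserving_add_right volume b).quasiMeasurePreserving.comp h1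

/-- The matrix with rows `u` and its rotation by a right angle sends `v` to `(x, y)` with `x² + y² =
|u|²|v|²`. The map is therefore an invertible linear map followed by the triangular map `(x, y) ↦
(x, (x² + y²)/|u|²)`. -/
lemma quasiMeasurePreserving_dot_normSq {u : Fin 2 → ℝ} (hu : u ≠ 0) :
    QuasiMeasurePreserving
      (fun v : Fin 2 → ℝ => (u 0 * v 0 + u 1 * v 1, v 0 ^ 2 + v 1 ^ 2)) volume
      (volume.prod volume) := by
  have hk : 0 < u 0 ^ 2 + u 1 ^ 2 := by
    by_contra h
    have h0 : u 0 = 0 := by nlinarith [sq_nonneg (u 0), sq_nonneg (u 1)]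
    have h1 : u 1 = 0 := by nlinarith [sq_nonneg (u 0), sq_nonneg (u 1)]
    exact hu (by ext i; fin_cases i <;> simp [h0, h1])
  let M : Matrix (Fin 2) (Fin 2) ℝ := !![u 0, u 1; -u 1, u 0]
  have hM : M.det ≠ 0 := by
    simp only [M, Matrix.det_fin_two_of]
    nlinarith
  have h1 : QuasiMeasurePreserving (Matrix.toLin' M) volume volume := by
    refine ⟨(LinearMap.continuous_on_pi _).measurable, ?_⟩
    rw [Real.map_matrix_volume_pi_eq_smul_volume_pi hM]
    exact smul_absolutelyContinuous
  have h2 := (volume_preserving_finTwoArrow ℝ).quasiMeasurePreserving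
  have h3 : QuasiMeasurePreserving
      (fun p : ℝ × ℝ => (p.1, (u 0 ^ 2 + u 1 ^ 2)⁻¹ * p.2 ^ 2 + (u 0 ^ 2 + u 1 ^ 2)⁻¹ * p.1 ^ 2))
      (volume.prod volume) (volume.prod volume) :=
    quasiMeasurePreserving_skew (f := fun x : ℝ => x)
      (g := fun x y : ℝ => (u 0 ^ 2 + u 1 ^ 2)⁻¹ * y ^ 2 + (u 0 ^ 2 + u 1 ^ 2)⁻¹ * x ^ 2)
      (by fun_prop) (QuasiMeasurePreserving.id _)
      (ae_of_all _ fun x => (quasiMeasurePreserving_affine (inv_ne_zero hk.ne') _).comp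
        quasiMeasurePreserving_sq)
  have h4 := (h3.comp h2).comp h1
  refine cast (congrArg (fun f => QuasiMeasurePreserving f volume (volume.prod volume))
    (funext fun v => ?_)) h4
  symm
  simp only [Function.comp_apply, Matrix.toLin'_apply, MeasurableEquiv.finTwoArrow_apply, M]
  simp only [Matrix.mulVec, dotProduct, Fin.sum_univ_two, Matrix.of_apply, Matrix.cons_val_zero,
    Matrix.cons_val_one]
  refine Prod.ext rfl ?_
  simp only
  field_simp
  ring

lemma dist_sq_plane (p q : Plane) : dist p q ^ 2 = (q 0 - p 0) ^ 2 + (q 1 - p 1) ^ 2 := by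
  rw [EuclideanSpace.dist_eq, Real.sq_sqrt (by positivity), Fin.sum_univ_two, Real.dist_eq,
    Real.dist_eq, sq_abs, sq_abs]
  ring

lemma quasiMeasurePreserving_ofLp_sub (p : Plane) :
    QuasiMeasurePreserving (fun r : Plane => (WithLp.ofLp (r - p) : Fin 2 → ℝ)) volume volume :=
  (EuclideanSpace.volume_preserving_symm_measurableEquiv_toLp (Fin 2)).quasiMeasurePreserving.comp
    (measurePreserving_sub_right volume p).quasiMeasurePreserving

lemma quasiMeasurePreserving_dist_sq (p : Plane) :
    QuasiMeasurePreserving (fun q : Plane => dist p q ^ 2) volume volume := by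
  have h := quasiMeasurePreserving_dot_normSq (u := ![1, 0]) (by simp)
  have h2 := (quasiMeasurePreserving_snd (μ := (volume : Measure ℝ)) (ν := (volume : Measure ℝ))).comp
    (h.comp (quasiMeasurePreserving_ofLp_sub p))
  convert h2 using 1
  ext q
  simp [dist_sq_plane]

/-- Since `|r-q|² = |r-p|² - 2⟨q-p, r-p⟩ + |q-p|²`, the second squared distance is, for a fixed
first one, affine in the inner product with slope `-2`. -/
lemma quasiMeasurePreserving_dist_sq_pair {p q : Plane} (hpq : q ≠ p) :
    QuasiMeasurePreserving (fun r : Plane => (dist p r ^ 2, dist q r ^ 2)) volume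
      (volume.prod volume) := by
  have hu : (WithLp.ofLp (q - p) : Fin 2 → ℝ) ≠ 0 := by
    intro h
    exact hpq (sub_eq_zero.1 ((WithLp.ofLp_eq_zero 2).1 h))
  have h := (quasiMeasurePreserving_dot_normSq hu).comp (quasiMeasurePreserving_ofLp_sub p)
  have hsw : QuasiMeasurePreserving (Prod.swap : ℝ × ℝ → ℝ × ℝ) (volume.prod volume)
      (volume.prod volume) :=
    (measurePreserving_swap (μ := (volume : Measure ℝ)) (ν := (volume : Measure ℝ))).quasiMeasurePreserving
  have h3 : QuasiMeasurePreserving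
      (fun z : ℝ × ℝ => (z.1, (-2) * z.2 + (z.1 + dist p q ^ 2)))
      (volume.prod volume) (volume.prod volume) :=
    quasiMeasurePreserving_skew (f := fun x : ℝ => x)
      (g := fun x y : ℝ => (-2) * y + (x + dist p q ^ 2))
      (by fun_prop) (QuasiMeasurePreserving.id _)
      (ae_of_all _ fun x => quasiMeasurePreserving_affine (by norm_num) _)
  refine cast (congrArg (fun f => QuasiMeasurePreserving f volume (volume.prod volume))
    (funext fun r => ?_)) (h3.comp (hsw.comp h))
  symm
  simp only [Function.comp_apply, Prod.swap, dist_sq_plane, PiLp.sub_apply]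
  refine Prod.ext rfl ?_
  simp only
  ring

/-- The three mutual distances of three points in the plane. -/
def distances (x : Plane × Plane × Plane) : ℝ × ℝ × ℝ :=
  (dist x.1 x.2.1, (dist x.1 x.2.2, dist x.2.1 x.2.2))

@[fun_prop]
lemma measurable_distances : Measurable distances := by
  unfold distances
  fun_prop

/-- The squared distances are treated by placing the points one after another; the exceptional case
of coinciding first two points has measure zero. -/
lemma quasiMeasurePreserving_distances : QuasiMeasurePreserving distances volume volume := by
  have h : QuasiMeasurePreserving (fun x : Plane × Plane × Plane =>
      (dist x.1 x.2.1 ^ 2, (dist x.1 x.2.2 ^ 2, dist x.2.1 x.2.2 ^ 2))) volume volume := by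
    refine QuasiMeasurePreserving.prod_of_right (by fun_prop) (ae_of_all _ fun p => ?_)
    refine quasiMeasurePreserving_skew (f := fun q : Plane => dist p q ^ 2)
      (g := fun q r : Plane => (dist p r ^ 2, dist q r ^ 2)) (by
        simp only [Function.uncurry_def]; fun_prop) (quasiMeasurePreserving_dist_sq p) ?_
    have : ∀ᵐ q : Plane, q ≠ p := by simp [ae_iff]
    exact this.mono fun q hq => quasiMeasurePreserving_dist_sq_pair hq
  refine ⟨measurable_distances, AbsolutelyContinuous.mk fun s hs h0 => ?_⟩
  rw [map_apply measurable_distances hs]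
  let sq : ℝ × ℝ × ℝ → ℝ × ℝ × ℝ := fun d => (d.1 ^ 2, (d.2.1 ^ 2, d.2.2 ^ 2))
  have hsq : DifferentiableOn ℝ sq s := by
    refine Differentiable.differentiableOn ?_
    fun_prop
  have : (volume : Measure (ℝ × ℝ × ℝ)).IsAddHaarMeasure :=
    Measure.prod.instIsAddHaarMeasure (volume : Measure ℝ)
      ((volume : Measure ℝ).prod (volume : Measure ℝ))
  -- Passing from squares to distances requires no square root: the coordinatewise square of a null
  -- set is null, and its preimage under the squared distances contains the preimage wanted.
  have h1 := addHaar_image_eq_zero_of_differentiableOn_of_addHaar_eq_zero volume hsq h0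
  refine measure_mono_null (fun x hx => ?_) (h.preimage_null h1)
  exact ⟨distances x, hx, rfl⟩

end Distances

/-! ### Relative entropy of the output of a noisy channel. -/

section Channels

variable {E N F : Type*} [MeasurableSpace E] [MeasurableSpace N] [MeasurableSpace F]

/-- A noisy channel `x = g(d, z)`, with noise `z` of law `ξ`, whose output has, given the input `d`,
a density with respect to `νF` that is at most `B * exp H`, and at most `c * exp H` on average over
the input law `νE`. For inputs in `K` the mean of `H` is at most `C`. -/
structure ChannelBound (νE : Measure E) (ξ : Measure N) (νF : Measure F) (g : E → N → F)
    (K : Set E) (H : F → ℝ) (B c C : ℝ) : Prop where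
  measurable_channel : Measurable (Function.uncurry g)
  measurable_exponent : Measurable H
  exponent_nonneg : ∀ x, 0 ≤ H x
  exists_density : ∃ w : E → F → ENNReal, Measurable (Function.uncurry w) ∧
    (∀ d, ξ.map (g d) = νF.withDensity (w d)) ∧
    (∀ d x, w d x ≤ ENNReal.ofReal (B * Real.exp (H x))) ∧
    ∀ x, ∫⁻ d, w d x ∂νE ≤ ENNReal.ofReal (c * Real.exp (H x))
  mean_exponent_le : ∀ d ∈ K, ∫⁻ z, ENNReal.ofReal (H (g d z)) ∂ξ ≤ ENNReal.ofReal C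

variable {A : Type*} [MeasurableSpace A]

/-- The uniform law on two points. -/
def fairCoin : Measure Bool := (2⁻¹ : ENNReal) • (Measure.dirac true + Measure.dirac false)

instance : IsProbabilityMeasure fairCoin := ⟨by
  simp [fairCoin, ENNReal.inv_two_add_inv_two]⟩

lemma lintegral_fairCoin (f : Bool → ENNReal) :
    ∫⁻ b, f b ∂fairCoin = 2⁻¹ * (f true + f false) := by
  simp [fairCoin, lintegral_add_measure, mul_add]

/-- The term `log 2` in the exponent pays for the weight `2⁻¹` of one face of `fairCoin`. -/
lemma mul_exp_log_two_add {x h : ℝ} (hx : 0 < x) :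
    2⁻¹ * ENNReal.ofReal (Real.exp (Real.log 2 + Real.log x + h)) =
      ENNReal.ofReal (x * Real.exp h) := by
  rw [Real.exp_add, Real.exp_add, Real.exp_log two_pos, Real.exp_log hx, mul_assoc,
    ENNReal.ofReal_mul two_pos.le, ENNReal.ofReal_ofNat, ← mul_assoc,
    ENNReal.inv_mul_cancel two_ne_zero ENNReal.ofNat_ne_top, one_mul]

/-- The tag `t` selects inputs whose conditional density is at most `M`. On these, integrating
against `νE` costs `M` and allows the averaged bound `c`; on the others only the peak `B` is
available. Keeping the tag in the output lets the bound depend on the case, at the price of a factor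
`2`. -/
lemma ChannelBound.map_le_withDensity {νE : Measure E} {ξ : Measure N} {νF : Measure F}
    {g : E → N → F} {K : Set E} {H : F → ℝ} {B c C : ℝ}
    [IsProbabilityMeasure νE] [IsProbabilityMeasure ξ] [IsProbabilityMeasure νF]
    (h : ChannelBound νE ξ νF g K H B c C) (hB : 1 ≤ B) (hc : 1 ≤ c) {M : ℝ} (hM : 1 ≤ M)
    (P : Measure A) [IsProbabilityMeasure P] (κ : Kernel A E) [IsMarkovKernel κ]
    {f : A → E → ENNReal} (hf : Measurable (Function.uncurry f))
    (hκ : ∀ᵐ a ∂P, κ a = νE.withDensity (f a)) {t : A × E → Bool} (ht : Measurable t)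
    (htf : ∀ p, t p = true → f p.1 p.2 ≤ ENNReal.ofReal M) :
    ((P ⊗ₘ κ).prod ξ).map (fun p => ((p.1.1, t p.1), g p.1.2 p.2)) ≤
      ((P.prod fairCoin).prod νF).withDensity fun q => ENNReal.ofReal (Real.exp
        (Real.log 2 + Real.log (bif q.1.2 then c * M else B) + H q.2)) := by
  obtain ⟨w, hw, hgw, hwB, hwc⟩ := h.exists_density
  have hg := h.measurable_channel
  have hH := h.measurable_exponent
  have hg' : Measurable fun p : (A × E) × N => g p.1.2 p.2 :=
    hg.comp (by fun_prop : Measurable fun p : (A × E) × N => (p.1.2, p.2))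
  have hw' : Measurable fun p : (A × E) × F => w p.1.2 p.2 :=
    hw.comp (by fun_prop : Measurable fun p : (A × E) × F => (p.1.2, p.2))
  have hw1 : ∀ d, Measurable (w d) := fun d => hw.comp measurable_prodMk_left
  have hw2 : ∀ x, Measurable fun d => w d x := fun x => hw.comp measurable_prodMk_right
  have hg1 : ∀ d, Measurable (g d) := fun d => hg.comp measurable_prodMk_left
  have hG : Measurable fun q : (A × Bool) × F => ENNReal.ofReal (Real.exp
        (Real.log 2 + Real.log (bif q.1.2 then c * M else B) + H q.2)) := by
    have : Measurable fun b : Bool => Real.log (bif b then c * M else B) := measurable_of_finite _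
    have h2 := this.comp (by fun_prop : Measurable fun q : (A × Bool) × F => q.1.2)
    have h3 : Measurable fun q : (A × Bool) × F => H q.2 := by fun_prop
    exact ((h2.const_add _).add h3).exp.ennreal_ofReal
  refine Measure.le_iff.2 fun s hs => ?_
  set φ : (A × Bool) × F → ENNReal := s.indicator 1 with hφ
  have hφm : Measurable φ := measurable_one.indicator hs
  rw [← lintegral_indicator_one hs, ← lintegral_indicator_one hs,
    lintegral_withDensity_eq_lintegral_mul _ hG hφm, lintegral_map hφm (by fun_prop),
    lintegral_prod _ (by fun_prop), lintegral_prod _ (by fun_prop)]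
  have hin : ∀ p : A × E, ∫⁻ z, φ ((p.1, t p), g p.2 z) ∂ξ =
      ∫⁻ x, w p.2 x * φ ((p.1, t p), x) ∂νF := fun p => by
    rw [← lintegral_map (μ := ξ) (f := fun x => φ ((p.1, t p), x)) (by fun_prop) (hg1 p.2), hgw,
      lintegral_withDensity_eq_lintegral_mul _ (hw1 _) (by fun_prop)]
    rfl
  simp only [hin]
  have hm1 : Measurable fun q : (A × E) × F => w q.1.2 q.2 * φ ((q.1.1, t q.1), q.2) :=
    hw'.mul (by fun_prop)
  rw [Measure.lintegral_compProd hm1.lintegral_prod_right']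
  have hm2 : Measurable fun q : A × Bool => ∫⁻ x, ((fun q : (A × Bool) × F =>
      ENNReal.ofReal (Real.exp (Real.log 2 + Real.log (bif q.1.2 then c * M else B) + H q.2))) * φ)
        (q, x) ∂νF := (hG.mul hφm).lintegral_prod_right'
  rw [lintegral_prod _ hm2.aemeasurable]
  refine lintegral_mono_ae ?_
  filter_upwards [hκ] with a ha
  have hm3 : Measurable (Function.uncurry fun (d : E) (x : F) => w d x * φ ((a, t (a, d)), x)) :=
    hm1.comp (by fun_prop : Measurable fun q : E × F => ((a, q.1), q.2))
  rw [lintegral_fairCoin, lintegral_lintegral_swap hm3.aemeasurable,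
    ← lintegral_add_left (by
      exact (hG.mul hφm).comp (by fun_prop : Measurable fun x : F => ((a, true), x))),
    ← lintegral_const_mul]
  swap
  · exact ((hG.mul hφm).comp (by fun_prop : Measurable fun x : F => ((a, true), x))).add
      ((hG.mul hφm).comp (by fun_prop : Measurable fun x : F => ((a, false), x)))
  refine lintegral_mono fun x => ?_
  have hbound : ∀ d, w d x * φ ((a, t (a, d)), x) ≤
      φ ((a, true), x) * ({d | t (a, d) = true}.indicator (fun d => w d x) d) +
        φ ((a, false), x) * w d x := fun d => by
    by_cases hd : t (a, d) = true
    · simp [hd, mul_comm]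
    · simp [hd, mul_comm]
  have hT : MeasurableSet {d | t (a, d) = true} :=
    (ht.comp measurable_prodMk_left) (measurableSet_singleton true)
  -- Here the conditional law of the input is replaced by `M` times `νE`, so that the density is
  -- averaged over the input.
  have hI1 : ∫⁻ d, {d | t (a, d) = true}.indicator (fun d => w d x) d ∂κ a ≤
      ENNReal.ofReal (c * M * Real.exp (H x)) := by
    have hfa : Measurable (f a) := hf.comp measurable_prodMk_left
    rw [ha, lintegral_withDensity_eq_lintegral_mul _ hfa
      ((hw2 x).indicator hT)]
    calc _ ≤ ∫⁻ d, ENNReal.ofReal M * w d x ∂νE := by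
          refine lintegral_mono fun d => ?_
          by_cases hd : t (a, d) = true
          · simp only [Pi.mul_apply, Set.mem_ofPred_eq, hd, Set.indicator_of_mem]
            gcongr
            exact htf _ hd
          · simp [hd]
      _ ≤ ENNReal.ofReal M * ENNReal.ofReal (c * Real.exp (H x)) := by
          rw [lintegral_const_mul _ (hw2 x)]
          gcongr
          exact hwc x
      _ = _ := by
          rw [← ENNReal.ofReal_mul (by linarith)]
          congr 1
          ring
  have hI2 : ∫⁻ d, w d x ∂κ a ≤ ENNReal.ofReal (B * Real.exp (H x)) := by
    refine (lintegral_mono fun d => hwB d x).trans ?_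
    simp
  calc _ ≤ φ ((a, true), x) * ∫⁻ d, {d | t (a, d) = true}.indicator (fun d => w d x) d ∂κ a +
        φ ((a, false), x) * ∫⁻ d, w d x ∂κ a := by
        rw [← lintegral_const_mul _ ((hw2 x).indicator hT), ← lintegral_const_mul _ (hw2 x),
          ← lintegral_add_left (((hw2 x).indicator hT).const_mul _)]
        exact lintegral_mono hbound
    _ ≤ φ ((a, true), x) * ENNReal.ofReal (c * M * Real.exp (H x)) +
        φ ((a, false), x) * ENNReal.ofReal (B * Real.exp (H x)) := by gcongr
    _ = _ := by
        rw [← mul_exp_log_two_add (by positivity), ← mul_exp_log_two_add (by positivity)]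
        simp only [Pi.mul_apply, cond_true, cond_false]
        ring

/-- Relative entropy bound for the output of a channel, given past data. Inputs whose conditional
density exceeds `M` only contribute through their probability. -/
lemma ChannelBound.klDiv_le {νE : Measure E} {ξ : Measure N} {νF : Measure F}
    {g : E → N → F} {K : Set E} {H : F → ℝ} {B c C : ℝ}
    [IsProbabilityMeasure νE] [IsProbabilityMeasure ξ] [IsProbabilityMeasure νF]
    (h : ChannelBound νE ξ νF g K H B c C) (hB : 1 ≤ B) (hc : 1 ≤ c) (hC : 0 ≤ C) {M : ℝ}
    (hM : 1 ≤ M) (P : Measure A) [IsProbabilityMeasure P] (κ : Kernel A E) [IsMarkovKernel κ]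
    {f : A → E → ENNReal} (hf : Measurable (Function.uncurry f))
    (hκ : ∀ᵐ a ∂P, κ a = νE.withDensity (f a)) (hK : ∀ᵐ p ∂(P ⊗ₘ κ), p.2 ∈ K) :
    klDiv (((P ⊗ₘ κ).prod ξ).map fun p => (p.1.1, g p.1.2 p.2)) (P.prod νF) ≤
      ENNReal.ofReal (Real.log 2 + Real.log (c * M) +
        (P ⊗ₘ κ).real {p | ENNReal.ofReal M < f p.1 p.2} * Real.log B + C) := by
  classical
  have hg := h.measurable_channel
  have hH := h.measurable_exponent
  have hg' : Measurable fun p : (A × E) × N => g p.1.2 p.2 :=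
    hg.comp (by fun_prop : Measurable fun p : (A × E) × N => (p.1.2, p.2))
  have hf' : Measurable fun p : A × E => f p.1 p.2 := hf
  have hS : MeasurableSet {p : A × E | ENNReal.ofReal M < f p.1 p.2} :=
    measurableSet_lt measurable_const hf'
  let t : A × E → Bool := fun p => decide (f p.1 p.2 ≤ ENNReal.ofReal M)
  have ht : Measurable t := by
    refine measurable_to_bool ?_
    have : t ⁻¹' {true} = {p | f p.1 p.2 ≤ ENNReal.ofReal M} := by ext p; simp [t]
    rw [this]
    exact measurableSet_le hf' measurable_const
  have hle := h.map_le_withDensity hB hc hM P κ hf hκ ht (fun p hp => by simpa [t] using hp)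
  have hm : Measurable fun p : (A × E) × N => ((p.1.1, t p.1), g p.1.2 p.2) := by fun_prop
  have hpr : IsProbabilityMeasure
      (((P ⊗ₘ κ).prod ξ).map fun p => ((p.1.1, t p.1), g p.1.2 p.2)) :=
    Measure.isProbabilityMeasure_map hm.aemeasurable
  -- the exponent is integrable, with mean at most `C`
  have hHi : ∫⁻ p, ENNReal.ofReal (H (g p.1.2 p.2)) ∂((P ⊗ₘ κ).prod ξ) ≤ ENNReal.ofReal C := by
    rw [lintegral_prod _ (by fun_prop)]
    calc _ ≤ ∫⁻ _, ENNReal.ofReal C ∂(P ⊗ₘ κ) :=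
          lintegral_mono_ae (hK.mono fun p hp => h.mean_exponent_le p.2 hp)
      _ = _ := by simp
  have hHint : Integrable (fun p : (A × E) × N => H (g p.1.2 p.2)) ((P ⊗ₘ κ).prod ξ) := by
    refine ⟨(hH.comp hg').aestronglyMeasurable, ?_⟩
    rw [hasFiniteIntegral_iff_ofReal (ae_of_all _ fun _ => h.exponent_nonneg _)]
    exact hHi.trans_lt ENNReal.ofReal_lt_top
  have hHC : ∫ p, H (g p.1.2 p.2) ∂((P ⊗ₘ κ).prod ξ) ≤ C := by
    rw [integral_eq_lintegral_of_nonneg_ae (ae_of_all _ fun _ => h.exponent_nonneg _)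
      (hH.comp hg').aestronglyMeasurable]
    exact ENNReal.toReal_le_of_le_ofReal hC hHi
  have hb : Measurable fun b : Bool => Real.log (bif b then c * M else B) := measurable_of_finite _
  have hbi : Integrable (fun p : (A × E) × N => Real.log (bif t p.1 then c * M else B))
      ((P ⊗ₘ κ).prod ξ) := by
    refine Integrable.of_bound (C := |Real.log (c * M)| + |Real.log B|)
      (hb.comp (by fun_prop)).aestronglyMeasurable (ae_of_all _ fun p => ?_)
    cases t p.1 <;> simp [abs_nonneg]
  have hGm : Measurable fun q : (A × Bool) × F =>
      Real.log 2 + Real.log (bif q.1.2 then c * M else B) + H q.2 := by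
    have h3 : Measurable fun q : (A × Bool) × F => H q.2 := by fun_prop
    exact ((hb.comp (by fun_prop : Measurable fun q : (A × Bool) × F => q.1.2)).const_add _).add h3
  have hGi : Integrable (fun q : (A × Bool) × F =>
      Real.log 2 + Real.log (bif q.1.2 then c * M else B) + H q.2)
      (((P ⊗ₘ κ).prod ξ).map fun p => ((p.1.1, t p.1), g p.1.2 p.2)) := by
    rw [integrable_map_measure hGm.aestronglyMeasurable hm.aemeasurable]
    exact ((integrable_const _).add hbi).add hHint
  have h1 := klDiv_le_of_le_withDensity hle hGi
  -- Forgetting the tag does not increase the relative entropy.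
  have h2 := klDiv_map_le (((P ⊗ₘ κ).prod ξ).map fun p => ((p.1.1, t p.1), g p.1.2 p.2))
    ((P.prod fairCoin).prod νF) (measurable_fst.prodMap measurable_id)
  rw [Measure.map_map (by fun_prop) hm, ← Measure.map_prod_map _ _ measurable_fst measurable_id,
    Measure.map_id, Measure.map_fst_prod, measure_univ, one_smul] at h2
  refine (h2.trans h1).trans (ENNReal.ofReal_le_ofReal ?_)
  rw [integral_map hm.aemeasurable hGm.aestronglyMeasurable]
  have hind : Integrable (fun p : (A × E) × N => {p : A × E | ENNReal.ofReal M <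
      f p.1 p.2}.indicator (fun _ => Real.log B) p.1) ((P ⊗ₘ κ).prod ξ) := by
    have : Integrable ({p : A × E | ENNReal.ofReal M < f p.1 p.2}.indicator fun _ => Real.log B)
      (P ⊗ₘ κ) := (integrable_const _).indicator hS
    exact this.comp_fst ξ
  have hB0 : 0 ≤ Real.log B := Real.log_nonneg hB
  have hcM0 : 0 ≤ Real.log (c * M) := Real.log_nonneg (by nlinarith)
  -- Both logarithms are nonnegative, so `log (c * M)` may be charged to all inputs, while `log B`
  -- is charged only where the density exceeds `M`.
  calc _ ≤ ∫ p, ((Real.log 2 + Real.log (c * M)) + {p : A × E | ENNReal.ofReal M <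
        f p.1 p.2}.indicator (fun _ => Real.log B) p.1 + H (g p.1.2 p.2)) ∂((P ⊗ₘ κ).prod ξ) := by
        refine integral_mono (((integrable_const _).add hbi).add hHint)
          (((integrable_const _).add hind).add hHint) fun p => ?_
        simp only
        by_cases hp : f p.1.1 p.1.2 ≤ ENNReal.ofReal M
        · simp [t, hp]
        · simp [t, hp, not_le.1 hp]
          linarith
    _ = Real.log 2 + Real.log (c * M) +
        (P ⊗ₘ κ).real {p | ENNReal.ofReal M < f p.1 p.2} * Real.log B +
          ∫ p, H (g p.1.2 p.2) ∂((P ⊗ₘ κ).prod ξ) := by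
        have hi1 : Integrable (fun p : (A × E) × N => (Real.log 2 + Real.log (c * M)) +
            {p : A × E | ENNReal.ofReal M < f p.1 p.2}.indicator (fun _ => Real.log B) p.1)
            ((P ⊗ₘ κ).prod ξ) := (integrable_const _).add hind
        rw [integral_add hi1 hHint, integral_add (integrable_const _) hind,
          integral_fun_fst (μ := P ⊗ₘ κ) (ν := ξ) (f := {p : A × E | ENNReal.ofReal M <
            f p.1 p.2}.indicator fun _ => Real.log B), integral_indicator_const _ hS]
        simp
    _ ≤ _ := by linarith

end Channels

/-! ### Combining channels. -/

section ChannelOperations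

variable {E E₁ E₂ N N₁ N₂ F F₁ F₂ : Type*} [MeasurableSpace E] [MeasurableSpace E₁]
  [MeasurableSpace E₂] [MeasurableSpace N] [MeasurableSpace N₁] [MeasurableSpace N₂]
  [MeasurableSpace F] [MeasurableSpace F₁] [MeasurableSpace F₂]
  {νE : Measure E} {ν₁ : Measure E₁} {ν₂ : Measure E₂} {ξ : Measure N} {ξ₁ : Measure N₁}
  {ξ₂ : Measure N₂} {νF : Measure F} {η₁ : Measure F₁} {η₂ : Measure F₂}

lemma ChannelBound.mono {g : E → N → F} {K : Set E} {H : F → ℝ} {B c C B' c' C' : ℝ}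
    (h : ChannelBound νE ξ νF g K H B c C) (hB : B ≤ B') (hc : c ≤ c') (hC : C ≤ C') :
    ChannelBound νE ξ νF g K H B' c' C' where
  measurable_channel := h.measurable_channel
  measurable_exponent := h.measurable_exponent
  exponent_nonneg := h.exponent_nonneg
  exists_density := by
    obtain ⟨w, hw, hgw, hwB, hwc⟩ := h.exists_density
    refine ⟨w, hw, hgw, fun d x => (hwB d x).trans ?_, fun x => (hwc x).trans ?_⟩ <;> gcongr
  mean_exponent_le d hd := (h.mean_exponent_le d hd).trans (ENNReal.ofReal_le_ofReal hC)

/-- Needed because each observation uses only some components of the noise of a slot. -/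
lemma ChannelBound.comp_noise {g : E → N → F} {K : Set E} {H : F → ℝ} {B c C : ℝ}
    (h : ChannelBound νE ξ νF g K H B c C) {π : N₁ → N} (hπ : MeasurePreserving π ξ₁ ξ) :
    ChannelBound νE ξ₁ νF (fun d z => g d (π z)) K H B c C where
  measurable_channel := h.measurable_channel.comp
    (measurable_fst.prodMk (hπ.measurable.comp measurable_snd))
  measurable_exponent := h.measurable_exponent
  exponent_nonneg := h.exponent_nonneg
  exists_density := by
    obtain ⟨w, hw, hgw, hwB, hwc⟩ := h.exists_density
    refine ⟨w, hw, fun d => ?_, hwB, hwc⟩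
    have hgd : Measurable (g d) := h.measurable_channel.comp measurable_prodMk_left
    rw [← hgw, ← hπ.map_eq, Measure.map_map hgd hπ.measurable]
    rfl
  mean_exponent_le d hd := by
    have hm : Measurable fun z => ENNReal.ofReal (H (g d z)) :=
      (h.measurable_exponent.comp (h.measurable_channel.comp measurable_prodMk_left)).ennreal_ofReal
    rw [hπ.lintegral_comp hm]
    exact h.mean_exponent_le d hd

lemma ChannelBound.comp_fst [IsProbabilityMeasure ν₂] [SFinite ν₁] {g : E₁ → N → F} {K : Set E₁}
    (K' : Set E₂) {H : F → ℝ} {B c C : ℝ} (h : ChannelBound ν₁ ξ νF g K H B c C) :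
    ChannelBound (ν₁.prod ν₂) ξ νF (fun d z => g d.1 z) (K ×ˢ K') H B c C where
  measurable_channel := h.measurable_channel.comp (by fun_prop :
    Measurable fun p : (E₁ × E₂) × N => (p.1.1, p.2))
  measurable_exponent := h.measurable_exponent
  exponent_nonneg := h.exponent_nonneg
  exists_density := by
    obtain ⟨w, hw, hgw, hwB, hwc⟩ := h.exists_density
    refine ⟨fun d => w d.1, hw.comp (by fun_prop :
      Measurable fun p : (E₁ × E₂) × F => (p.1.1, p.2)), fun d => hgw d.1, fun d => hwB d.1,
      fun x => ?_⟩
    have hw2 : Measurable fun d => w d x := hw.comp measurable_prodMk_right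
    rw [lintegral_prod _ (by fun_prop)]
    simpa using hwc x
  mean_exponent_le d hd := h.mean_exponent_le d.1 hd.1

lemma ChannelBound.comp_snd [IsProbabilityMeasure ν₁] [SFinite ν₂] {g : E₂ → N → F} {K : Set E₂}
    (K' : Set E₁) {H : F → ℝ} {B c C : ℝ} (h : ChannelBound ν₂ ξ νF g K H B c C) :
    ChannelBound (ν₁.prod ν₂) ξ νF (fun d z => g d.2 z) (K' ×ˢ K) H B c C where
  measurable_channel := h.measurable_channel.comp (by fun_prop :
    Measurable fun p : (E₁ × E₂) × N => (p.1.2, p.2))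
  measurable_exponent := h.measurable_exponent
  exponent_nonneg := h.exponent_nonneg
  exists_density := by
    obtain ⟨w, hw, hgw, hwB, hwc⟩ := h.exists_density
    refine ⟨fun d => w d.2, hw.comp (by fun_prop :
      Measurable fun p : (E₁ × E₂) × F => (p.1.2, p.2)), fun d => hgw d.2, fun d => hwB d.2,
      fun x => ?_⟩
    have hw2 : Measurable fun d => w d x := hw.comp measurable_prodMk_right
    rw [lintegral_prod _ (by fun_prop)]
    simpa using hwc x
  mean_exponent_le d hd := h.mean_exponent_le d.2 hd.2

lemma lintegral_add_exponent_le [IsProbabilityMeasure ξ₁] [IsProbabilityMeasure ξ₂]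
    {H₁ : N₁ → ℝ} {H₂ : N₂ → ℝ} (hm₁ : Measurable H₁) (hm₂ : Measurable H₂)
    (h₁ : ∀ x, 0 ≤ H₁ x) (h₂ : ∀ x, 0 ≤ H₂ x) {C₁ C₂ : ℝ} (hC₁ : 0 ≤ C₁) (hC₂ : 0 ≤ C₂)
    (hl₁ : ∫⁻ z, ENNReal.ofReal (H₁ z) ∂ξ₁ ≤ ENNReal.ofReal C₁)
    (hl₂ : ∫⁻ z, ENNReal.ofReal (H₂ z) ∂ξ₂ ≤ ENNReal.ofReal C₂) :
    ∫⁻ z, ENNReal.ofReal (H₁ z.1 + H₂ z.2) ∂(ξ₁.prod ξ₂) ≤ ENNReal.ofReal (C₁ + C₂) := by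
  simp_rw [fun z : N₁ × N₂ => ENNReal.ofReal_add (h₁ z.1) (h₂ z.2)]
  rw [lintegral_add_left (by fun_prop), ENNReal.ofReal_add hC₁ hC₂, lintegral_prod _ (by fun_prop),
    lintegral_prod _ (by fun_prop)]
  simpa using add_le_add hl₁ hl₂

/-- Two channels with independent noises and the same input. -/
lemma ChannelBound.prodMk [IsProbabilityMeasure ξ₁] [IsProbabilityMeasure ξ₂]
    [IsProbabilityMeasure η₁] [IsProbabilityMeasure η₂] {g₁ : E → N₁ → F₁} {g₂ : E → N₂ → F₂}
    {K : Set E} {H₁ : F₁ → ℝ} {H₂ : F₂ → ℝ} {B₁ c₁ C₁ B₂ c₂ C₂ : ℝ}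
    (h₁ : ChannelBound νE ξ₁ η₁ g₁ K H₁ B₁ c₁ C₁) (h₂ : ChannelBound νE ξ₂ η₂ g₂ K H₂ B₂ c₂ C₂)
    (hB₁ : 0 ≤ B₁) (hC₁ : 0 ≤ C₁) (hC₂ : 0 ≤ C₂) :
    ChannelBound νE (ξ₁.prod ξ₂) (η₁.prod η₂) (fun d z => (g₁ d z.1, g₂ d z.2)) K
      (fun x => H₁ x.1 + H₂ x.2) (B₁ * B₂) (B₁ * c₂) (C₁ + C₂) where
  measurable_channel := (h₁.measurable_channel.comp (by fun_prop :
      Measurable fun p : E × (N₁ × N₂) => (p.1, p.2.1))).prodMk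
    (h₂.measurable_channel.comp (by fun_prop : Measurable fun p : E × (N₁ × N₂) => (p.1, p.2.2)))
  measurable_exponent := (h₁.measurable_exponent.comp measurable_fst).add
    (h₂.measurable_exponent.comp measurable_snd)
  exponent_nonneg x := add_nonneg (h₁.exponent_nonneg _) (h₂.exponent_nonneg _)
  exists_density := by
    obtain ⟨w₁, hw₁, hgw₁, hwB₁, hwc₁⟩ := h₁.exists_density
    obtain ⟨w₂, hw₂, hgw₂, hwB₂, hwc₂⟩ := h₂.exists_density
    have hw1 : ∀ d, Measurable (w₁ d) := fun d => hw₁.comp measurable_prodMk_left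
    have hw2 : ∀ d, Measurable (w₂ d) := fun d => hw₂.comp measurable_prodMk_left
    have hg₁ : ∀ d, Measurable (g₁ d) := fun d => h₁.measurable_channel.comp measurable_prodMk_left
    have hg₂ : ∀ d, Measurable (g₂ d) := fun d => h₂.measurable_channel.comp measurable_prodMk_left
    refine ⟨fun d x => w₁ d x.1 * w₂ d x.2, (hw₁.comp (by fun_prop :
      Measurable fun p : E × (F₁ × F₂) => (p.1, p.2.1))).mul (hw₂.comp (by fun_prop :
      Measurable fun p : E × (F₁ × F₂) => (p.1, p.2.2))), fun d => ?_, fun d x => ?_, fun x => ?_⟩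
    · have e : (fun z : N₁ × N₂ => (g₁ d z.1, g₂ d z.2)) = Prod.map (g₁ d) (g₂ d) := rfl
      have i₁ : SFinite (η₁.withDensity (w₁ d)) := by rw [← hgw₁]; infer_instance
      have i₂ : SFinite (η₂.withDensity (w₂ d)) := by rw [← hgw₂]; infer_instance
      rw [e, ← Measure.map_prod_map _ _ (hg₁ d) (hg₂ d), hgw₁, hgw₂,
        prod_withDensity (hw1 _) (hw2 _)]
    · calc _ ≤ ENNReal.ofReal (B₁ * Real.exp (H₁ x.1)) * ENNReal.ofReal (B₂ * Real.exp (H₂ x.2)) :=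
          mul_le_mul' (hwB₁ d x.1) (hwB₂ d x.2)
        _ = _ := by
          rw [← ENNReal.ofReal_mul (by positivity), Real.exp_add]
          congr 1
          ring
    -- Both outputs share the input, and the average over it is spent on the second density; the
    -- first is bounded by its peak. Hence the factor `B₁` in the averaged constant.
    · have hm₂ : Measurable fun d => w₂ d x.2 := hw₂.comp measurable_prodMk_right
      calc _ ≤ ∫⁻ d, ENNReal.ofReal (B₁ * Real.exp (H₁ x.1)) * w₂ d x.2 ∂νE :=
          lintegral_mono fun d => mul_le_mul_left (hwB₁ d x.1) _
        _ ≤ ENNReal.ofReal (B₁ * Real.exp (H₁ x.1)) * ENNReal.ofReal (c₂ * Real.exp (H₂ x.2)) := by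
          rw [lintegral_const_mul _ hm₂]
          exact mul_le_mul_right (hwc₂ x.2) _
        _ = _ := by
          rw [← ENNReal.ofReal_mul (by positivity), Real.exp_add]
          congr 1
          ring
  mean_exponent_le d hd := lintegral_add_exponent_le
    (h₁.measurable_exponent.comp (h₁.measurable_channel.comp measurable_prodMk_left))
    (h₂.measurable_exponent.comp (h₂.measurable_channel.comp measurable_prodMk_left))
    (fun _ => h₁.exponent_nonneg _) (fun _ => h₂.exponent_nonneg _) hC₁ hC₂
    (h₁.mean_exponent_le d hd) (h₂.mean_exponent_le d hd)

/-- Two channels with independent noises and independent inputs. -/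
lemma ChannelBound.prodMap [IsProbabilityMeasure ξ₁] [IsProbabilityMeasure ξ₂]
    [IsProbabilityMeasure η₁] [IsProbabilityMeasure η₂] [IsProbabilityMeasure ν₁]
    [IsProbabilityMeasure ν₂] {g₁ : E₁ → N₁ → F₁} {g₂ : E₂ → N₂ → F₂}
    {K₁ : Set E₁} {K₂ : Set E₂} {H₁ : F₁ → ℝ} {H₂ : F₂ → ℝ} {B₁ c₁ C₁ B₂ c₂ C₂ : ℝ}
    (h₁ : ChannelBound ν₁ ξ₁ η₁ g₁ K₁ H₁ B₁ c₁ C₁) (h₂ : ChannelBound ν₂ ξ₂ η₂ g₂ K₂ H₂ B₂ c₂ C₂)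
    (hB₁ : 0 ≤ B₁) (hc₁ : 0 ≤ c₁) (hC₁ : 0 ≤ C₁) (hC₂ : 0 ≤ C₂) :
    ChannelBound (ν₁.prod ν₂) (ξ₁.prod ξ₂) (η₁.prod η₂) (fun d z => (g₁ d.1 z.1, g₂ d.2 z.2))
      (K₁ ×ˢ K₂) (fun x => H₁ x.1 + H₂ x.2) (B₁ * B₂) (c₁ * c₂) (C₁ + C₂) where
  measurable_channel := (h₁.measurable_channel.comp (by fun_prop :
      Measurable fun p : (E₁ × E₂) × (N₁ × N₂) => (p.1.1, p.2.1))).prodMk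
    (h₂.measurable_channel.comp
      (by fun_prop : Measurable fun p : (E₁ × E₂) × (N₁ × N₂) => (p.1.2, p.2.2)))
  measurable_exponent := (h₁.measurable_exponent.comp measurable_fst).add
    (h₂.measurable_exponent.comp measurable_snd)
  exponent_nonneg x := add_nonneg (h₁.exponent_nonneg _) (h₂.exponent_nonneg _)
  exists_density := by
    obtain ⟨w₁, hw₁, hgw₁, hwB₁, hwc₁⟩ := h₁.exists_density
    obtain ⟨w₂, hw₂, hgw₂, hwB₂, hwc₂⟩ := h₂.exists_density
    have hw1 : ∀ d, Measurable (w₁ d) := fun d => hw₁.comp measurable_prodMk_left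
    have hw2 : ∀ d, Measurable (w₂ d) := fun d => hw₂.comp measurable_prodMk_left
    have hg₁ : ∀ d, Measurable (g₁ d) := fun d => h₁.measurable_channel.comp measurable_prodMk_left
    have hg₂ : ∀ d, Measurable (g₂ d) := fun d => h₂.measurable_channel.comp measurable_prodMk_left
    refine ⟨fun d x => w₁ d.1 x.1 * w₂ d.2 x.2, (hw₁.comp (by fun_prop :
      Measurable fun p : (E₁ × E₂) × (F₁ × F₂) => (p.1.1, p.2.1))).mul (hw₂.comp (by fun_prop :
      Measurable fun p : (E₁ × E₂) × (F₁ × F₂) => (p.1.2, p.2.2))), fun d => ?_, fun d x => ?_,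
      fun x => ?_⟩
    · have e : (fun z : N₁ × N₂ => (g₁ d.1 z.1, g₂ d.2 z.2)) = Prod.map (g₁ d.1) (g₂ d.2) := rfl
      have i₁ : SFinite (η₁.withDensity (w₁ d.1)) := by rw [← hgw₁]; infer_instance
      have i₂ : SFinite (η₂.withDensity (w₂ d.2)) := by rw [← hgw₂]; infer_instance
      rw [e, ← Measure.map_prod_map _ _ (hg₁ d.1) (hg₂ d.2), hgw₁, hgw₂,
        prod_withDensity (hw1 _) (hw2 _)]
    · calc _ ≤ ENNReal.ofReal (B₁ * Real.exp (H₁ x.1)) * ENNReal.ofReal (B₂ * Real.exp (H₂ x.2)) :=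
          mul_le_mul' (hwB₁ d.1 x.1) (hwB₂ d.2 x.2)
        _ = _ := by
          rw [← ENNReal.ofReal_mul (by positivity), Real.exp_add]
          congr 1
          ring
    -- For independent inputs the average factors, and no peak enters.
    · have hm₁ : Measurable fun d => w₁ d x.1 := hw₁.comp measurable_prodMk_right
      have hm₂ : Measurable fun d => w₂ d x.2 := hw₂.comp measurable_prodMk_right
      rw [lintegral_prod_mul hm₁.aemeasurable hm₂.aemeasurable]
      calc _ ≤ ENNReal.ofReal (c₁ * Real.exp (H₁ x.1)) * ENNReal.ofReal (c₂ * Real.exp (H₂ x.2)) :=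
          mul_le_mul' (hwc₁ x.1) (hwc₂ x.2)
        _ = _ := by
          rw [← ENNReal.ofReal_mul (by positivity), Real.exp_add]
          congr 1
          ring
  mean_exponent_le d hd := lintegral_add_exponent_le
    (h₁.measurable_exponent.comp (h₁.measurable_channel.comp measurable_prodMk_left))
    (h₂.measurable_exponent.comp (h₂.measurable_channel.comp measurable_prodMk_left))
    (fun _ => h₁.exponent_nonneg _) (fun _ => h₂.exponent_nonneg _) hC₁ hC₂
    (h₁.mean_exponent_le d.1 hd.1) (h₂.mean_exponent_le d.2 hd.2)

end ChannelOperations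

/-! ### The Gaussian channel. -/

section GaussianChannel

/-- The standard Gaussian law. -/
abbrev stdGaussian : Measure ℝ := gaussianReal 0 1

/-- Minus the logarithm of the standard Gaussian density. -/
def gaussianExponent (x : ℝ) : ℝ := x ^ 2 / 2 + Real.log √(2 * Real.pi)

lemma one_le_sqrt_two_pi : 1 ≤ √(2 * Real.pi) := by
  rw [Real.one_le_sqrt]
  nlinarith [Real.pi_gt_three]

lemma gaussianPDF_mul_exp_gaussianExponent (x : ℝ) :
    gaussianPDF 0 1 x * ENNReal.ofReal (Real.exp (gaussianExponent x)) = 1 := by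
  have h : 0 < √(2 * Real.pi) := zero_lt_one.trans_le one_le_sqrt_two_pi
  rw [gaussianPDF, ← ENNReal.ofReal_mul (gaussianPDFReal_nonneg _ _ _), gaussianPDFReal,
    gaussianExponent, Real.exp_add, Real.exp_log h]
  rw [show (√(2 * Real.pi * ((1 : NNReal) : ℝ)))⁻¹ *
      Real.exp (-(x - 0) ^ 2 / (2 * ((1 : NNReal) : ℝ))) *
      (Real.exp (x ^ 2 / 2) * √(2 * Real.pi)) = ((√(2 * Real.pi))⁻¹ * √(2 * Real.pi)) *
      (Real.exp (-(x ^ 2 / 2)) * Real.exp (x ^ 2 / 2)) by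
    simp only [NNReal.coe_one, mul_one, sub_zero]
    rw [neg_div]
    ring]
  rw [inv_mul_cancel₀ h.ne', ← Real.exp_add]
  simp

lemma gaussianPDF_le_inv_sqrt {v : NNReal} {a : ℝ} (ha : 0 < a) (hv : a ≤ v) (d x : ℝ) :
    gaussianPDF d v x ≤ ENNReal.ofReal (√a)⁻¹ := by
  refine ENNReal.ofReal_le_ofReal ?_
  rw [gaussianPDFReal]
  have h1 : √a ≤ √(2 * Real.pi * v) := Real.sqrt_le_sqrt (by nlinarith [Real.pi_gt_three])
  have h2 : Real.exp (-(x - d) ^ 2 / (2 * v)) ≤ 1 := by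
    rw [Real.exp_le_one_iff, neg_div]
    have : 0 ≤ (x - d) ^ 2 / (2 * v) := by positivity
    linarith
  have h3 : 0 < √a := Real.sqrt_pos.2 ha
  calc _ ≤ (√a)⁻¹ * 1 := mul_le_mul (inv_anti₀ h3 h1) h2 (Real.exp_pos _).le (by positivity)
    _ = _ := mul_one _

/-- Replacing the variance by its upper bound and exchanging mean and argument makes the right side
a probability density in `d`, although the variance on the left may itself depend on `d`. -/
lemma gaussianPDF_le_mul_gaussianPDF {v : NNReal} {a b : ℝ} (ha : 0 < a) (hv : a ≤ v) (hb : v ≤ b)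
    (d x : ℝ) :
    gaussianPDF d v x ≤ ENNReal.ofReal √(b / a) * gaussianPDF x b.toNNReal d := by
  have hv0 : (0 : ℝ) < v := ha.trans_le hv
  have hb0 : 0 < b := hv0.trans_le hb
  rw [gaussianPDF, gaussianPDF, ← ENNReal.ofReal_mul (by positivity)]
  refine ENNReal.ofReal_le_ofReal ?_
  rw [gaussianPDFReal, gaussianPDFReal, Real.coe_toNNReal _ hb0.le, ← mul_assoc]
  refine mul_le_mul ?_ ?_ (Real.exp_pos _).le (by positivity)
  · have e : √(b / a) * (√(2 * Real.pi * b))⁻¹ = (√(2 * Real.pi * a))⁻¹ := by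
      rw [Real.sqrt_div hb0.le, Real.sqrt_mul (by positivity) b, Real.sqrt_mul (by positivity) a]
      have := Real.sqrt_pos.2 ha
      have := Real.sqrt_pos.2 hb0
      field_simp
    rw [e]
    exact inv_anti₀ (by positivity) (Real.sqrt_le_sqrt (by gcongr))
  · refine Real.exp_le_exp.2 ?_
    rw [neg_div, neg_div, neg_le_neg_iff, show (d - x) ^ 2 = (x - d) ^ 2 by ring]
    gcongr

lemma map_add_sqrt_mul_stdGaussian (d v : ℝ) (hv : 0 ≤ v) :
    stdGaussian.map (fun z => d + √v * z) = gaussianReal d v.toNNReal := by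
  have h1 := gaussianReal_map_const_mul (μ := 0) (v := 1) √v
  have h2 := gaussianReal_map_const_add (μ := √v * 0) (v := NNReal.mk (√v ^ 2) (sq_nonneg _) * 1) d
  rw [← h1, Measure.map_map (by fun_prop) (by fun_prop)] at h2
  rw [show (fun z => d + √v * z) = (fun x => d + x) ∘ (fun x => √v * x) from rfl, h2]
  congr 1
  · simp
  · ext
    simp [Real.sq_sqrt hv, hv]

lemma integral_sq_stdGaussian : ∫ z, z ^ 2 ∂stdGaussian = 1 := by
  have h := variance_fun_id_gaussianReal (μ := 0) (v := 1)
  rw [variance_of_integral_eq_zero (by fun_prop) (by simp)] at h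
  simpa using h

lemma integrable_sq_stdGaussian : Integrable (fun z : ℝ => z ^ 2) stdGaussian :=
  (memLp_id_gaussianReal (μ := 0) (v := 1) 2).integrable_sq

/-- Additive Gaussian noise whose variance depends on the input. -/
lemma channelBound_gaussian {v : ℝ → ℝ} (hv : Measurable v) {a b : ℝ} (ha : 0 < a)
    (hav : ∀ d, a ≤ v d) (hvb : ∀ d, v d ≤ b) {l u : ℝ} (hl : 0 ≤ l) :
    ChannelBound stdGaussian stdGaussian stdGaussian (fun d z => d + √(v d) * z) (Set.Icc l u)
      gaussianExponent (√a)⁻¹ √(b / a) (u ^ 2 + b + Real.log √(2 * Real.pi)) where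
  measurable_channel := by
    simp only [Function.uncurry_def]
    fun_prop
  measurable_exponent := by
    unfold gaussianExponent
    fun_prop
  exponent_nonneg x := add_nonneg (by positivity) (Real.log_nonneg one_le_sqrt_two_pi)
  exists_density := by
    have hv0 : ∀ d, 0 < v d := fun d => ha.trans_le (hav d)
    have hm : Measurable (Function.uncurry fun d x => gaussianPDF d (v d).toNNReal x) := by
      unfold gaussianPDF gaussianPDFReal
      simp only [Function.uncurry_def]
      fun_prop
    have he : Measurable fun x => ENNReal.ofReal (Real.exp (gaussianExponent x)) := by
      unfold gaussianExponent
      fun_prop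
    -- The factor `exp (gaussianExponent x)` converts a Lebesgue density into a density with respect
    -- to `stdGaussian`.
    refine ⟨fun d x => ENNReal.ofReal (Real.exp (gaussianExponent x)) *
      gaussianPDF d (v d).toNNReal x, (he.comp measurable_snd).mul hm, fun d => ?_, fun d x => ?_,
      fun x => ?_⟩
    · rw [map_add_sqrt_mul_stdGaussian _ _ (hv0 d).le, stdGaussian, gaussianReal_of_var_ne_zero _ one_ne_zero,
        gaussianReal_of_var_ne_zero _ (by simpa using hv0 d),
        ← withDensity_mul (f := gaussianPDF 0 1) (g := fun x =>
          ENNReal.ofReal (Real.exp (gaussianExponent x)) * gaussianPDF d (v d).toNNReal x)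
          _ (measurable_gaussianPDF _ _) (he.mul (measurable_gaussianPDF _ _))]
      congr 1
      ext x
      rw [Pi.mul_apply, ← mul_assoc, gaussianPDF_mul_exp_gaussianExponent, one_mul]
    · rw [mul_comm, ENNReal.ofReal_mul (by positivity)]
      refine mul_le_mul_right ?_ _
      exact gaussianPDF_le_inv_sqrt ha (by rw [Real.coe_toNNReal _ (hv0 d).le]; exact hav d) d x
    · have hmx : Measurable fun d => gaussianPDF d (v d).toNNReal x :=
        hm.comp measurable_prodMk_right
      rw [lintegral_const_mul _ hmx, mul_comm, ENNReal.ofReal_mul (by positivity)]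
      gcongr
      rw [stdGaussian, gaussianReal_of_var_ne_zero _ one_ne_zero,
        lintegral_withDensity_eq_lintegral_mul _ (measurable_gaussianPDF _ _) hmx]
      -- The density of the Gaussian input law is at most `1` and is dropped; what remains
      -- integrates to one up to `√(b / a)`, a ratio from which `P` cancels.
      calc _ ≤ ∫⁻ d, ENNReal.ofReal √(b / a) * gaussianPDF x b.toNNReal d := by
            refine lintegral_mono fun d => ?_
            have h1 : gaussianPDF 0 1 d ≤ 1 := by
              simpa using gaussianPDF_le_inv_sqrt (v := 1) one_pos (by simp) 0 d
            have h2 := gaussianPDF_le_mul_gaussianPDF (v := (v d).toNNReal) (b := b) ha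
              (by rw [Real.coe_toNNReal _ (hv0 d).le]; exact hav d)
              (by rw [Real.coe_toNNReal _ (hv0 d).le]; exact hvb d) d x
            calc _ ≤ 1 * gaussianPDF d (v d).toNNReal x := mul_le_mul_left h1 _
              _ ≤ _ := by rwa [one_mul]
        _ = _ := by
            rw [lintegral_const_mul _ (measurable_gaussianPDF _ _), lintegral_gaussianPDF_eq_one,
              mul_one]
            have : 0 < b := (hv0 0).trans_le (hvb 0)
            simpa using this
  mean_exponent_le d hd := by
    have hv0 : 0 ≤ v d := ha.le.trans (hav d)
    have hlog : 0 ≤ Real.log √(2 * Real.pi) := Real.log_nonneg one_le_sqrt_two_pi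
    have hint : Integrable (fun z => d ^ 2 + v d * z ^ 2 + Real.log √(2 * Real.pi)) stdGaussian :=
      ((integrable_const _).add (integrable_sq_stdGaussian.const_mul _)).add (integrable_const _)
    calc _ ≤ ∫⁻ z, ENNReal.ofReal (d ^ 2 + v d * z ^ 2 + Real.log √(2 * Real.pi)) ∂stdGaussian := by
          refine lintegral_mono fun z => ENNReal.ofReal_le_ofReal ?_
          rw [gaussianExponent]
          nlinarith [sq_nonneg (d - √(v d) * z), Real.sq_sqrt hv0]
      _ = ENNReal.ofReal (d ^ 2 + v d + Real.log √(2 * Real.pi)) := by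
          rw [← ofReal_integral_eq_lintegral_ofReal hint (ae_of_all _ fun z => by positivity)]
          have hi1 : Integrable (fun z => d ^ 2 + v d * z ^ 2) stdGaussian :=
            (integrable_const _).add (integrable_sq_stdGaussian.const_mul _)
          rw [integral_add hi1 (integrable_const _), integral_add (integrable_const _)
            (integrable_sq_stdGaussian.const_mul _), integral_const_mul, integral_sq_stdGaussian]
          simp
      _ ≤ _ := by
          refine ENNReal.ofReal_le_ofReal ?_
          have h1 : d ^ 2 ≤ u ^ 2 := pow_le_pow_left₀ (hl.trans hd.1) hd.2 2
          linarith [hvb d]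

end GaussianChannel

/-! ### Linear growth of the relative entropy for channels driven by Markov motion. -/

section NoisyFunctions

variable {Ω S N E : Type*} [MeasurableSpace Ω] [MeasurableSpace S] [MeasurableSpace N]
  [MeasurableSpace E] {μ : Measure Ω} [IsProbabilityMeasure μ]

/-- Continuity from above: the sets decrease to one on which `f` is infinite. -/
lemma tendsto_measureReal_lt_ofReal {α : Type*} [MeasurableSpace α] (P : Measure α)
    [IsFiniteMeasure P] {f : α → ENNReal} (hf : Measurable f) (hfin : ∀ᵐ a ∂P, f a ≠ ⊤) :
    Tendsto (fun M : ℝ => P.real {a | ENNReal.ofReal M < f a}) atTop (𝓝 0) := by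
  have h : Tendsto (fun M : ℝ => P {a | ENNReal.ofReal M < f a}) atTop
      (𝓝 (P (⋂ M : ℝ, {a | ENNReal.ofReal M < f a}))) := by
    refine tendsto_measure_iInter_atTop
      (fun M => (measurableSet_lt measurable_const hf).nullMeasurableSet) ?_
      ⟨0, measure_ne_top _ _⟩
    intro M M' hM a ha
    exact (ENNReal.ofReal_le_ofReal hM).trans_lt ha
  have h0 : P (⋂ M : ℝ, {a | ENNReal.ofReal M < f a}) = 0 := by
    refine measure_mono_null (fun a ha => ?_) (ae_iff.1 hfin)
    simp only [Set.mem_iInter, Set.mem_ofPred_eq] at ha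
    intro hne
    refine hne (?_ : f a = ⊤)
    by_contra hcon
    have := ha (f a).toReal
    rw [ENNReal.ofReal_toReal hcon] at this
    exact lt_irrefl _ this
  rw [h0] at h
  have := (ENNReal.tendsto_toReal ENNReal.zero_ne_top).comp h
  simpa [Measure.real, Function.comp_def] using this

/-- For a stationary Markov process `s` and independent noise `ζ`, the relative entropy of the
output of a channel with input `D (s i)` grows linearly, with a rate in which the peak `B` of the
channel density only enters with a weight that can be made small. -/
lemma exists_blockDiv_le_of_channelBound [StandardBorelSpace S] [Nonempty S]
    [MeasurableSpace.CountablyGenerated E]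
    {s : ℕ → Ω → S} {ζ : ℕ → Ω → N} {ν : Measure N} [IsProbabilityMeasure ν]
    (hs : ∀ i, Measurable (s i)) (hζ : ∀ i, Measurable (ζ i)) (hstat : IsStationary s μ)
    (hlaw : ∀ k n, μ.map (block n fun i => ζ (k + i)) = Measure.pi fun _ => ν)
    (hind : IndepFun (fun ω i => s i ω) (fun ω i => ζ i ω) μ)
    {D : S → E} (hD : Measurable D) {νE : Measure E} [IsProbabilityMeasure νE]
    {κ : Kernel S S} [IsMarkovKernel κ]
    (hκ : ∀ n, μ.map (fun ω => (block (n + 1) s ω, s (n + 1) ω)) =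
        μ.map (block (n + 1) s) ⊗ₘ κ.comap (fun b => b (Fin.last n)) (by fun_prop))
    (hac : ∀ᵐ x ∂(μ.map (s 0)), (κ x).map D ≪ νE)
    {K : Set E} (hKm : MeasurableSet K) (hK : ∀ n, ∀ᵐ ω ∂μ, D (s n ω) ∈ K) :
    ∃ δ : ℝ → ℝ, Tendsto δ atTop (𝓝 0) ∧ ∀ {F : Type} [MeasurableSpace F]
      [StandardBorelSpace F] [Nonempty F] (νF : Measure F)
      [IsProbabilityMeasure νF] {g : E → N → F} {H : F → ℝ} {B c C M : ℝ},
      ChannelBound νE ν νF g K H B c C → 1 ≤ B → 1 ≤ c → 0 ≤ C → 1 ≤ M → ∀ n,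
      blockDiv (fun i ω => g (D (s i ω)) (ζ i ω)) νF μ n ≤
        n * ENNReal.ofReal (Real.log 2 + Real.log (c * M) + δ M * Real.log B + C) := by
  set κD : Kernel S E := κ.map D with hκD
  have : IsMarkovKernel κD := Kernel.IsMarkovKernel.map κ hD
  have hp0 : IsProbabilityMeasure (μ.map (s 0)) :=
    Measure.isProbabilityMeasure_map (hs 0).aemeasurable
  set f : S → E → ENNReal := Kernel.rnDeriv κD (Kernel.const S νE) with hf
  have hfm : Measurable (Function.uncurry f) := by
    rw [hf]
    exact Kernel.measurable_rnDeriv κD (Kernel.const S νE)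
  have hfd : ∀ᵐ x ∂(μ.map (s 0)), κD x = νE.withDensity (f x) := by
    filter_upwards [hac] with x hx
    have h1 : κD x ≪ Kernel.const S νE x := by
      rw [hκD, Kernel.map_apply _ hD, Kernel.const_apply]; exact hx
    have h2 := Kernel.withDensity_rnDeriv_eq h1
    rw [Kernel.withDensity_apply _ (Kernel.measurable_rnDeriv _ _)] at h2
    simpa using h2.symm
  have hfin : ∀ᵐ p ∂(μ.map (s 0) ⊗ₘ κD), Function.uncurry f p ≠ ⊤ := by
    refine Measure.ae_compProd_of_ae_ae ?_ ?_
    · exact (measurableSet_eq_fun hfm measurable_const).compl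
    · filter_upwards [hac] with x hx
      have h1 : κD x ≪ Kernel.const S νE x := by
        rw [hκD, Kernel.map_apply _ hD, Kernel.const_apply]; exact hx
      exact h1.ae_le (Kernel.rnDeriv_ne_top _ _)
  -- `δ M` is the probability that the conditional density of the next input exceeds `M`. It is
  -- fixed before the channel, hence does not depend on `P`.
  refine ⟨fun M => (μ.map (s 0) ⊗ₘ κD).real {p | ENNReal.ofReal M < Function.uncurry f p},
    tendsto_measureReal_lt_ofReal _ hfm hfin, ?_⟩
  intro F _ _ _ νF _ g H B c C M h hB hc hC hM n
  -- The outputs alone need not be Markov. Conditioning on the past motion and noise together keeps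
  -- the transition kernel available, and past outputs are functions of them.
  set U : ℕ → Ω → S × N := fun i ω => (s i ω, ζ i ω) with hUdef
  have hU : ∀ i, Measurable (U i) := fun i => by fun_prop
  have hGm : Measurable fun p : S × N => g (D p.1) p.2 :=
    h.measurable_channel.comp (by fun_prop : Measurable fun p : S × N => (D p.1, p.2))
  have hUs : IsStationary U μ := isStationary_pair hs hζ hstat hlaw hind
  refine blockDiv_le_mul hU hGm (isStationary_comp hU hUs hGm) (fun n => ?_) n
  have hP := isProbabilityMeasure_map_block (μ := μ) hU (n + 1)
  set e : (Fin (n + 1) → S × N) → S := fun b => (b (Fin.last n)).1 with he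
  have hem : Measurable e := by fun_prop
  have hPe : (μ.map (block (n + 1) U)).map e = μ.map (s 0) := by
    rw [Measure.map_map hem (measurable_block hU _), ← map_eq_of_isStationary hs hstat n]
    rfl
  have hlaw0 : ∀ n, μ.map (block n ζ) = Measure.pi fun _ => ν := fun n => by
    simpa using hlaw 0 n
  have hstep := map_block_pair_succ hs hζ hlaw0 hind (hκ n)
  have hcomap : κD.comap e hem = (κ.comap e hem).map D := by
    ext1 b
    rw [Kernel.comap_apply, hκD, Kernel.map_apply _ hD, Kernel.map_apply _ hD, Kernel.comap_apply]
  have hPD : μ.map (block (n + 1) U) ⊗ₘ κD.comap e hem =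
      (μ.map (block (n + 1) U) ⊗ₘ κ.comap e hem).map (Prod.map id D) := by
    rw [hcomap, Measure.compProd_map hD]
  have hjoint : μ.map (fun ω => ((block (n + 1) U ω, D (s (n + 1) ω)), ζ (n + 1) ω)) =
      (μ.map (block (n + 1) U) ⊗ₘ κD.comap e hem).prod ν := by
    have hm := congrArg (Measure.map fun p : ((Fin (n + 1) → S × N) × S) × N =>
      ((p.1.1, D p.1.2), p.2)) hstep
    have hbU := measurable_block hU (n + 1)
    rw [Measure.map_map (by fun_prop) (by fun_prop)] at hm
    rw [hPD, map_prod_left _ _ (by fun_prop)]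
    exact hm
  have hgm : Measurable fun p : ((Fin (n + 1) → S × N) × E) × N => (p.1.1, g p.1.2 p.2) := by
    have := h.measurable_channel.comp
      (by fun_prop : Measurable fun p : ((Fin (n + 1) → S × N) × E) × N => (p.1.2, p.2))
    exact (by fun_prop : Measurable fun p : ((Fin (n + 1) → S × N) × E) × N => p.1.1).prodMk this
  have hbU := measurable_block hU (n + 1)
  have hout : μ.map (fun ω => (block (n + 1) U ω, g (D (U (n + 1) ω).1) (U (n + 1) ω).2)) =
      ((μ.map (block (n + 1) U) ⊗ₘ κD.comap e hem).prod ν).map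
        fun p => (p.1.1, g p.1.2 p.2) := by
    rw [← hjoint, Measure.map_map hgm (by fun_prop)]
    rfl
  have hae : ∀ᵐ b ∂(μ.map (block (n + 1) U)), κD.comap e hem b = νE.withDensity (f (e b)) := by
    rw [← hPe] at hfd
    exact ae_of_ae_map hem.aemeasurable hfd
  have hKp : ∀ᵐ p ∂(μ.map (block (n + 1) U) ⊗ₘ κD.comap e hem), p.2 ∈ K := by
    have h1 : ∀ᵐ ω ∂μ, ((block (n + 1) U ω, D (s (n + 1) ω)), ζ (n + 1) ω).1.2 ∈ K := hK (n + 1)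
    have h2 : (μ.map (fun ω => ((block (n + 1) U ω, D (s (n + 1) ω)), ζ (n + 1) ω))).map
        (fun p => p.1) = μ.map (block (n + 1) U) ⊗ₘ κD.comap e hem := by
      rw [hjoint, Measure.map_fst_prod, measure_univ, one_smul]
    rw [← h2, Measure.map_map (by fun_prop) (by fun_prop),
      ae_map_iff (by fun_prop) (measurable_snd hKm)]
    exact h1
  have hfe : Measurable (Function.uncurry fun b => f (e b)) :=
    hfm.comp (by fun_prop : Measurable fun p : (Fin (n + 1) → S × N) × E => (e p.1, p.2))
  have hmain := h.klDiv_le hB hc hC hM (μ.map (block (n + 1) U)) (κD.comap e hem) hfe hae hKp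
  -- The last past position has the law of `s 0`, so the probability of a large density is the same
  -- in every slot.
  have hδ : (μ.map (block (n + 1) U) ⊗ₘ κD.comap e hem).real
      {p | ENNReal.ofReal M < f (e p.1) p.2} =
      (μ.map (s 0) ⊗ₘ κD).real {p | ENNReal.ofReal M < Function.uncurry f p} := by
    rw [← hPe, map_compProd_comap _ hem, map_measureReal_apply (by fun_prop)
      (measurableSet_lt measurable_const hfm)]
    rfl
  rw [hδ] at hmain
  rw [hout]
  exact hmain

end NoisyFunctions

/-! ### Existence of the two key rates and bounds for them. -/

section RateLimits

variable {Ω A B E : Type*} [MeasurableSpace Ω] [MeasurableSpace A] [MeasurableSpace B]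
  [MeasurableSpace E] [StandardBorelSpace A] [Nonempty A] [StandardBorelSpace B] [Nonempty B]
  [StandardBorelSpace E] [Nonempty E] {μ : Measure Ω} [IsProbabilityMeasure μ]
  {ν₁ : Measure A} {ν₂ : Measure B} {νₑ : Measure E} [IsProbabilityMeasure ν₁]
  [IsProbabilityMeasure ν₂] [IsProbabilityMeasure νₑ]

lemma blockDiv_pair_eq_add {X : ℕ → Ω → A} {Y : ℕ → Ω → B} (hX : ∀ i, Measurable (X i))
    (hY : ∀ i, Measurable (Y i)) (n : ℕ) :
    blockDiv (fun i ω => (X i ω, Y i ω)) (ν₁.prod ν₂) μ n =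
      blockDiv X ν₁ μ n + blockDiv Y ν₂ μ n + mutualInfo (block n X) (block n Y) μ := by
  rw [blockDiv_pair hX hY]
  exact klDiv_pair_eq_add_mutualInfo (measurable_block hX n) (measurable_block hY n) _ _

lemma blockDiv_triple_add_eq {X : ℕ → Ω → A} {Y : ℕ → Ω → B} {Z : ℕ → Ω → E}
    (hX : ∀ i, Measurable (X i)) (hY : ∀ i, Measurable (Y i)) (hZ : ∀ i, Measurable (Z i)) (n : ℕ) :
    blockDiv (fun i ω => (Z i ω, (X i ω, Y i ω))) (νₑ.prod (ν₁.prod ν₂)) μ n + blockDiv Z νₑ μ n =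
      blockDiv (fun i ω => (X i ω, Z i ω)) (ν₁.prod νₑ) μ n +
        blockDiv (fun i ω => (Y i ω, Z i ω)) (ν₂.prod νₑ) μ n +
        condMutualInfo (block n X) (block n Y) (block n Z) μ := by
  have h := klDiv_triple_add_eq (μ := μ) (measurable_block hX n) (measurable_block hY n)
    (measurable_block hZ n) (Measure.pi fun _ => ν₁) (Measure.pi fun _ => ν₂)
    (Measure.pi fun _ => νₑ)
  rw [← blockDiv_triple hZ hX hY, ← blockDiv_pair hZ hX, ← blockDiv_pair hZ hY,
    blockDiv_pair_eq_add hZ hX, blockDiv_pair_eq_add hZ hY,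
    mutualInfo_comm (measurable_block hZ n) (measurable_block hX n),
    mutualInfo_comm (measurable_block hZ n) (measurable_block hY n)] at h
  rw [blockDiv_pair_eq_add hX hZ, blockDiv_pair_eq_add hY hZ, add_comm (blockDiv X ν₁ μ n),
    add_comm (blockDiv Y ν₂ μ n)]
  exact h

/-- In terms of entropy rates, the first branch of the lower rate is the positive part of `a12 - a2
- a1e + ae`. Nonnegative information gives `a2 ≤ a2e - ae`, hence the bound `a12 - a1e - a2e` from
below. For the upper rate both members of the minimum satisfy the same bound. From above, only `a12`
is retained. -/
lemma exists_rates_of_blockDiv_le {X : ℕ → Ω → A} {Y : ℕ → Ω → B} {Z : ℕ → Ω → E}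
    (hX : ∀ i, Measurable (X i)) (hY : ∀ i, Measurable (Y i)) (hZ : ∀ i, Measurable (Z i))
    (hstat : IsStationary (fun i ω => (Z i ω, (X i ω, Y i ω))) μ) {C L C₁₂ C₁ C₂ : ℝ}
    (hC0 : 0 ≤ C)
    (hC : ∀ n, blockDiv (fun i ω => (Z i ω, (X i ω, Y i ω))) (νₑ.prod (ν₁.prod ν₂)) μ n ≤
      n * ENNReal.ofReal C)
    (hC₁₂0 : 0 ≤ C₁₂)
    (hC₁₂ : ∀ n, blockDiv (fun i ω => (X i ω, Y i ω)) (ν₁.prod ν₂) μ n ≤ n * ENNReal.ofReal C₁₂)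
    (hC₁0 : 0 ≤ C₁)
    (hC₁ : ∀ n, blockDiv (fun i ω => (X i ω, Z i ω)) (ν₁.prod νₑ) μ n ≤ n * ENNReal.ofReal C₁)
    (hC₂0 : 0 ≤ C₂)
    (hC₂ : ∀ n, blockDiv (fun i ω => (Y i ω, Z i ω)) (ν₂.prod νₑ) μ n ≤ n * ENNReal.ofReal C₂)
    (hL : ENNReal.ofReal L ≤ blockDiv (fun i ω => (X i ω, Y i ω)) (ν₁.prod ν₂) μ 1) :
    ∃ R_L R_U : ℝ, IsLowerRate X Y Z μ R_L ∧ IsUpperRate X Y Z μ R_U ∧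
      L - C₁ - C₂ ≤ R_L ∧ R_L ≤ C₁₂ ∧ L - C₁ - C₂ ≤ R_U ∧ R_U ≤ C₁₂ := by
  have hXY : ∀ i, Measurable fun ω => (X i ω, Y i ω) := fun i => by fun_prop
  have hXZ : ∀ i, Measurable fun ω => (X i ω, Z i ω) := fun i => by fun_prop
  have hYZ : ∀ i, Measurable fun ω => (Y i ω, Z i ω) := fun i => by fun_prop
  have hT : ∀ i, Measurable fun ω => (Z i ω, (X i ω, Y i ω)) := fun i => by fun_prop
  -- finiteness
  have fin : ∀ {a : ENNReal} (n : ℕ) {c : ℝ}, a ≤ n * ENNReal.ofReal c → a ≠ ⊤ := fun n c h =>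
    (h.trans_lt (ENNReal.mul_lt_top (by simp) ENNReal.ofReal_lt_top)).ne
  have e12 := fun n => blockDiv_pair_eq_add (μ := μ) (ν₁ := ν₁) (ν₂ := ν₂) hX hY n
  have e1 := fun n => blockDiv_pair_eq_add (μ := μ) (ν₁ := ν₁) (ν₂ := νₑ) hX hZ n
  have e2 := fun n => blockDiv_pair_eq_add (μ := μ) (ν₁ := ν₂) (ν₂ := νₑ) hY hZ n
  have eT := fun n => blockDiv_pair_eq_add (μ := μ) (ν₁ := νₑ) (ν₂ := ν₁.prod ν₂) hZ hXY n
  have eC := fun n => blockDiv_triple_add_eq (μ := μ) (ν₁ := ν₁) (ν₂ := ν₂) (νₑ := νₑ) hX hY hZ n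
  have f12 := fun n => fin n (hC₁₂ n)
  have f1 := fun n => fin n (hC₁ n)
  have f2 := fun n => fin n (hC₂ n)
  have fT := fun n => fin n (hC n)
  have hX_le : ∀ n, blockDiv X ν₁ μ n ≤ n * ENNReal.ofReal C₁₂ := fun n =>
    (le_self_add.trans (le_self_add.trans (e12 n).ge)).trans (hC₁₂ n)
  have hY_le : ∀ n, blockDiv Y ν₂ μ n ≤ n * ENNReal.ofReal C₁₂ := fun n =>
    (le_add_self.trans (le_self_add.trans (e12 n).ge)).trans (hC₁₂ n)
  have hZ_le : ∀ n, blockDiv Z νₑ μ n ≤ n * ENNReal.ofReal C₁ := fun n =>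
    (le_add_self.trans (le_self_add.trans (e1 n).ge)).trans (hC₁ n)
  have i12 : ∀ n, mutualInfo (block n X) (block n Y) μ ≠ ⊤ := fun n =>
    ne_top_of_le_ne_top (f12 n) (le_add_self.trans (e12 n).ge)
  have i1 : ∀ n, mutualInfo (block n X) (block n Z) μ ≠ ⊤ := fun n =>
    ne_top_of_le_ne_top (f1 n) (le_add_self.trans (e1 n).ge)
  have i2 : ∀ n, mutualInfo (block n Y) (block n Z) μ ≠ ⊤ := fun n =>
    ne_top_of_le_ne_top (f2 n) (le_add_self.trans (e2 n).ge)
  have iC : ∀ n, condMutualInfo (block n X) (block n Y) (block n Z) μ ≠ ⊤ := fun n =>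
    ne_top_of_le_ne_top (ENNReal.add_ne_top.2 ⟨fT n, fin n (hZ_le n)⟩)
      (le_add_self.trans (eC n).ge)
  have r12 : ∀ n, (blockDiv (fun i ω => (X i ω, Y i ω)) (ν₁.prod ν₂) μ n).toReal =
      (blockDiv X ν₁ μ n).toReal + (blockDiv Y ν₂ μ n).toReal +
        (mutualInfo (block n X) (block n Y) μ).toReal := fun n => by
    rw [e12, ENNReal.toReal_add (ENNReal.add_ne_top.2 ⟨fin n (hX_le n), fin n (hY_le n)⟩) (i12 n),
      ENNReal.toReal_add (fin n (hX_le n)) (fin n (hY_le n))]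
  have r1 : ∀ n, (blockDiv (fun i ω => (X i ω, Z i ω)) (ν₁.prod νₑ) μ n).toReal =
      (blockDiv X ν₁ μ n).toReal + (blockDiv Z νₑ μ n).toReal +
        (mutualInfo (block n X) (block n Z) μ).toReal := fun n => by
    rw [e1, ENNReal.toReal_add (ENNReal.add_ne_top.2 ⟨fin n (hX_le n), fin n (hZ_le n)⟩) (i1 n),
      ENNReal.toReal_add (fin n (hX_le n)) (fin n (hZ_le n))]
  have r2 : ∀ n, (blockDiv (fun i ω => (Y i ω, Z i ω)) (ν₂.prod νₑ) μ n).toReal =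
      (blockDiv Y ν₂ μ n).toReal + (blockDiv Z νₑ μ n).toReal +
        (mutualInfo (block n Y) (block n Z) μ).toReal := fun n => by
    rw [e2, ENNReal.toReal_add (ENNReal.add_ne_top.2 ⟨fin n (hY_le n), fin n (hZ_le n)⟩) (i2 n),
      ENNReal.toReal_add (fin n (hY_le n)) (fin n (hZ_le n))]
  have rT : ∀ n, (blockDiv Z νₑ μ n).toReal +
      (blockDiv (fun i ω => (X i ω, Y i ω)) (ν₁.prod ν₂) μ n).toReal ≤
      (blockDiv (fun i ω => (Z i ω, (X i ω, Y i ω))) (νₑ.prod (ν₁.prod ν₂)) μ n).toReal :=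
    fun n => by
      rw [← ENNReal.toReal_add (fin n (hZ_le n)) (f12 n)]
      exact ENNReal.toReal_mono (fT n) (le_self_add.trans (eT n).ge)
  have rC : ∀ n, (condMutualInfo (block n X) (block n Y) (block n Z) μ).toReal =
      (blockDiv (fun i ω => (Z i ω, (X i ω, Y i ω))) (νₑ.prod (ν₁.prod ν₂)) μ n).toReal +
      (blockDiv Z νₑ μ n).toReal -
      (blockDiv (fun i ω => (X i ω, Z i ω)) (ν₁.prod νₑ) μ n).toReal -
      (blockDiv (fun i ω => (Y i ω, Z i ω)) (ν₂.prod νₑ) μ n).toReal := fun n => by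
    have h := congrArg ENNReal.toReal (eC n)
    rw [ENNReal.toReal_add (fT n) (fin n (hZ_le n)),
      ENNReal.toReal_add (ENNReal.add_ne_top.2 ⟨f1 n, f2 n⟩) (iC n),
      ENNReal.toReal_add (f1 n) (f2 n)] at h
    linarith
  -- limits
  obtain ⟨a12, t12, l12, -⟩ := exists_tendsto_blockDiv hXY
    (isStationary_comp (G := fun p => p.2) hT hstat (by fun_prop)) hC₁₂0 hC₁₂
  obtain ⟨a1e, t1e, -, -⟩ := exists_tendsto_blockDiv hXZ
    (isStationary_comp (G := fun p => (p.2.1, p.1)) hT hstat (by fun_prop)) hC₁0 hC₁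
  obtain ⟨a2e, t2e, -, -⟩ := exists_tendsto_blockDiv hYZ
    (isStationary_comp (G := fun p => (p.2.2, p.1)) hT hstat (by fun_prop)) hC₂0 hC₂
  obtain ⟨aT, tT, -, -⟩ := exists_tendsto_blockDiv hT hstat hC0 hC
  obtain ⟨a1, t1, -, n1⟩ := exists_tendsto_blockDiv hX
    (isStationary_comp (G := fun p => p.2.1) hT hstat (by fun_prop)) hC₁₂0 hX_le
  obtain ⟨a2, t2, -, n2⟩ := exists_tendsto_blockDiv hY
    (isStationary_comp (G := fun p => p.2.2) hT hstat (by fun_prop)) hC₁₂0 hY_le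
  obtain ⟨ae, te, -, ne⟩ := exists_tendsto_blockDiv hZ
    (isStationary_comp (G := fun p => p.1) hT hstat (by fun_prop)) hC₁0 hZ_le
  have m12 : Tendsto (fun n : ℕ => (1 / (n : ℝ)) *
      (mutualInfo (block n X) (block n Y) μ).toReal) atTop (𝓝 (a12 - a1 - a2)) :=
    ((t12.sub t1).sub t2).congr fun n => by rw [r12]; ring
  have m1 : Tendsto (fun n : ℕ => (1 / (n : ℝ)) *
      (mutualInfo (block n X) (block n Z) μ).toReal) atTop (𝓝 (a1e - a1 - ae)) :=
    ((t1e.sub t1).sub te).congr fun n => by rw [r1]; ring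
  have m2 : Tendsto (fun n : ℕ => (1 / (n : ℝ)) *
      (mutualInfo (block n Y) (block n Z) μ).toReal) atTop (𝓝 (a2e - a2 - ae)) :=
    ((t2e.sub t2).sub te).congr fun n => by rw [r2]; ring
  have mC : Tendsto (fun n : ℕ => (1 / (n : ℝ)) *
      (condMutualInfo (block n X) (block n Y) (block n Z) μ).toReal) atTop
      (𝓝 (aT + ae - a1e - a2e)) :=
    (((tT.add te).sub t1e).sub t2e).congr fun n => by rw [rC]; ring
  have p12 : 0 ≤ a12 - a1 - a2 := ge_of_tendsto' m12 fun n => by positivity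
  have p1 : 0 ≤ a1e - a1 - ae := ge_of_tendsto' m1 fun n => by positivity
  have p2 : 0 ≤ a2e - a2 - ae := ge_of_tendsto' m2 fun n => by positivity
  -- Nonnegativity of the information between `Z` and `(X, Y)`; this bounds the conditional
  -- information below.
  have pT : ae + a12 ≤ aT := le_of_tendsto_of_tendsto' (te.add t12) tT fun n => by
    rw [← mul_add]
    exact mul_le_mul_of_nonneg_left (rT n) (by positivity)
  have ub : ∀ {a : ℕ → ENNReal} {l c : ℝ}, 0 ≤ c → (∀ n, a n ≤ n * ENNReal.ofReal c) →
      Tendsto (fun n : ℕ => (1 / (n : ℝ)) * (a n).toReal) atTop (𝓝 l) → l ≤ c := by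
    intro a l c hc h ht
    refine le_of_tendsto' ht fun n => ?_
    have : (a n).toReal ≤ n * c := by
      refine ENNReal.toReal_le_of_le_ofReal (by positivity) ?_
      rw [ENNReal.ofReal_mul (by positivity), ENNReal.ofReal_natCast]
      exact h n
    rcases Nat.eq_zero_or_pos n with rfl | hn
    · simpa using hc
    · have hn' : (0 : ℝ) < n := by exact_mod_cast hn
      rw [one_div, inv_mul_le_iff₀ hn']
      exact this
  have u12 := ub hC₁₂0 hC₁₂ t12
  have u1 := ub hC₁0 hC₁ t1e
  have u2 := ub hC₂0 hC₂ t2e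
  have lL : L ≤ a12 := ((ENNReal.ofReal_le_iff_le_toReal (f12 1)).1 hL).trans l12
  have max_lim : ∀ {x y : ℕ → ℝ} {a b : ℝ},
      Tendsto (fun n : ℕ => (1 / (n : ℝ)) * x n) atTop (𝓝 a) →
      Tendsto (fun n : ℕ => (1 / (n : ℝ)) * y n) atTop (𝓝 b) →
      Tendsto (fun n : ℕ => (1 / (n : ℝ)) * max 0 (x n - y n)) atTop (𝓝 (max 0 (a - b))) := by
    intro x y a b hx hy
    refine (tendsto_const_nhds.max (hx.sub hy)).congr fun n => ?_
    rw [mul_max_of_nonneg _ _ (by positivity), mul_zero, mul_sub]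
  have comm : ∀ n, mutualInfo (block n Y) (block n X) μ = mutualInfo (block n X) (block n Y) μ :=
    fun n => mutualInfo_comm (measurable_block hY n) (measurable_block hX n)
  refine ⟨max (max 0 (a12 - a1 - a2 - (a1e - a1 - ae))) (max 0 (a12 - a1 - a2 - (a2e - a2 - ae))),
    min (a12 - a1 - a2) (aT + ae - a1e - a2e), ⟨fun n => ⟨i12 n, ?_, i1 n, i2 n⟩, _, _,
      max_lim m12 m1, ?_, rfl⟩, ⟨fun n => ⟨i12 n, iC n⟩, ?_⟩, ?_, ?_, ?_, ?_⟩
  · rw [comm]; exact i12 n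
  · simp only [comm]
    exact max_lim m12 m2
  · refine (m12.min mC).congr fun n => ?_
    rw [mul_min_of_nonneg _ _ (by positivity)]
  · exact le_max_of_le_left (le_max_of_le_right (by linarith))
  · exact max_le (max_le hC₁₂0 (by linarith)) (max_le hC₁₂0 (by linarith))
  · exact le_min (by linarith) (by linarith)
  · exact min_le_of_left_le (by linarith)

end RateLimits

/-! ### The law of the noise. -/

section Noise

/-- Law of the noise in one slot: first the two noise terms of the eavesdropper, then those of the
legitimate nodes. -/
abbrev noiseLaw : Measure ((ℝ × ℝ) × (ℝ × ℝ)) :=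
  (stdGaussian.prod stdGaussian).prod (stdGaussian.prod stdGaussian)

variable {Ω : Type*} [MeasurableSpace Ω] {μ : Measure Ω} [IsProbabilityMeasure μ]

lemma map_block_noise {z : Fin 4 → ℕ → Ω → ℝ} (hz : ∀ k i, Measurable (z k i))
    (hzlaw : ∀ k i, μ.map (z k i) = gaussianReal 0 1)
    (hzindep : iIndepFun (fun p : Fin 4 × ℕ => z p.1 p.2) μ) (k n : ℕ) :
    μ.map (block n fun i ω => ((z 2 (k + i) ω, z 3 (k + i) ω), (z 0 (k + i) ω, z 1 (k + i) ω))) =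
      Measure.pi fun _ => noiseLaw := by
  have hT : Measurable fun x : Fin 4 → ℝ => ((x 2, x 3), (x 0, x 1)) := by fun_prop
  have hslot : (Measure.pi fun _ : Fin 4 => stdGaussian).map
      (fun x : Fin 4 → ℝ => ((x 2, x 3), (x 0, x 1))) = noiseLaw := by
    have hind : iIndepFun (fun j => z j 0) μ :=
      hzindep.precomp (g := fun j : Fin 4 => (j, 0)) fun a b h => by simpa using h
    have h0 := hind.map_fun_eq_pi_map fun j => (hz j 0).aemeasurable
    simp only [hzlaw] at h0
    have h1 := hind.indepFun_prodMk_prodMk (fun j => hz j 0) 2 3 0 1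
      (by decide) (by decide) (by decide) (by decide)
    have h2 := hind.indepFun (i := 2) (j := 3) (by decide)
    have h3 := hind.indepFun (i := 0) (j := 1) (by decide)
    rw [indepFun_iff_map_prod_eq_prod_map_map (by fun_prop) (by fun_prop)] at h1 h2 h3
    rw [hzlaw, hzlaw] at h2 h3
    rw [h2, h3] at h1
    rw [← h0, Measure.map_map hT (by fun_prop)]
    exact h1
  have hind : iIndepFun (fun p : Fin n × Fin 4 => z p.2 (k + p.1)) μ :=
    hzindep.precomp (g := fun p : Fin n × Fin 4 => (p.2, k + p.1)) fun a b h => by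
      simp only [Prod.mk.injEq, Nat.add_left_cancel_iff] at h
      exact Prod.ext (Fin.ext h.2) h.1
  have h0 := hind.map_fun_eq_pi_map fun p : Fin n × Fin 4 => (hz p.2 (k + p.1)).aemeasurable
  simp only [hzlaw] at h0
  -- The i.i.d. array over slots and noise types is curried into independent slots; over finite
  -- index sets `infinitePi` is `pi`.
  have h1 := Measure.infinitePi_map_curry (fun (_ : Fin n) (_ : Fin 4) => stdGaussian)
  simp only [Measure.infinitePi_eq_pi] at h1
  rw [← h0, Measure.map_map (MeasurableEquiv.measurable _) (by fun_prop)] at h1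
  have h2 := congrArg (Measure.map fun (b : Fin n → Fin 4 → ℝ) i =>
    ((b i 2, b i 3), (b i 0, b i 1))) h1
  rw [Measure.map_map (by fun_prop) (by fun_prop), Measure.pi_map_pi
    (f := fun _ (x : Fin 4 → ℝ) => ((x 2, x 3), (x 0, x 1))) (fun _ => hT.aemeasurable),
    hslot] at h2
  exact h2

end Noise

/-! ### Absolute continuity of the conditional law of the distances. -/

section TransitionDensity

variable {S : Type*} [MeasurableSpace S]

lemma ae_absolutelyContinuous_of_compProd [StandardBorelSpace S] {p : Measure S} [SFinite p]
    {κ : Kernel S S} [IsFiniteKernel κ] {v : Measure S} [SFinite v] (h : p ⊗ₘ κ ≪ v.prod v) :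
    ∀ᵐ x ∂p, κ x ≪ v := by
  -- `toFinite` passes to an equivalent finite measure, which makes the constant kernel finite.
  have h1 : p ⊗ₘ κ ≪ v.toFinite ⊗ₘ Kernel.const S v.toFinite := by
    rw [Measure.compProd_const]
    exact h.trans ((absolutelyContinuous_toFinite v).prod (absolutelyContinuous_toFinite v))
  filter_upwards [h1.kernel_of_compProd] with x hx
  exact hx.trans (toFinite_absolutelyContinuous v)

/-- Reference law of the three distances. -/
abbrev distanceLaw : Measure (ℝ × ℝ × ℝ) := stdGaussian.prod (stdGaussian.prod stdGaussian)

variable {Ω : Type*} [MeasurableSpace Ω] {μ : Measure Ω}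

/-- A joint density of two consecutive positions gives the second a conditional density. The
distances inherit it, and the Gaussian reference is equivalent to Lebesgue measure. -/
lemma ae_map_distances_absolutelyContinuous {s : ℕ → Ω → Plane × Plane × Plane}
    (hs : ∀ i, Measurable (s i)) [HasPDF (block 2 s) μ volume] [SFinite μ]
    {κ : Kernel (Plane × Plane × Plane) (Plane × Plane × Plane)} [IsMarkovKernel κ]
    (hκ : μ.map (fun ω => (s 0 ω, s 1 ω)) = μ.map (s 0) ⊗ₘ κ) :
    ∀ᵐ x ∂(μ.map (s 0)), (κ x).map distances ≪ distanceLaw := by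
  have h1 : μ.map (block 2 s) ≪ volume := HasPDF.absolutelyContinuous
  have h2 := (h1.map (volume_preserving_finTwoArrow (Plane × Plane × Plane)).measurable).trans
    (volume_preserving_finTwoArrow (Plane × Plane × Plane)).map_eq.absolutelyContinuous
  rw [Measure.map_map (MeasurableEquiv.measurable _) (measurable_block hs 2)] at h2
  have h3 : μ.map (s 0) ⊗ₘ κ ≪ (volume : Measure (Plane × Plane × Plane)).prod volume := by
    rw [← hκ]
    exact h2
  filter_upwards [ae_absolutelyContinuous_of_compProd h3] with x hx
  have hG : (volume : Measure ℝ) ≪ stdGaussian :=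
    gaussianReal_absolutelyContinuous' 0 one_ne_zero
  exact ((hx.map measurable_distances).trans
    quasiMeasurePreserving_distances.absolutelyContinuous).trans (hG.prod (hG.prod hG))

end TransitionDensity

/-! ### The channels of the localization model. -/

section LocalizationChannels

/-- Additive Gaussian noise with variance `γ d * ρ / P`. -/
def noisyChannel (γ : ℝ → ℝ) (ρ P : ℝ) (d z : ℝ) : ℝ := d + √(γ d * ρ / P) * z

/-- The pair of observations of the legitimate nodes. -/
def nodesChannel (γ : ℝ → ℝ) (ρ₁ ρ₂ P : ℝ) (d : ℝ × ℝ × ℝ) (z : (ℝ × ℝ) × (ℝ × ℝ)) : ℝ × ℝ :=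
  (noisyChannel γ ρ₁ P d.1 z.2.1, noisyChannel γ ρ₂ P d.1 z.2.2)

/-- The pair of observations of the eavesdropper. -/
def eveChannel (γ : ℝ → ℝ) (ρₑ P : ℝ) (d : ℝ × ℝ × ℝ) (z : (ℝ × ℝ) × (ℝ × ℝ)) : ℝ × ℝ :=
  (noisyChannel γ ρₑ P d.2.1 z.1.1, noisyChannel γ ρₑ P d.2.2 z.1.2)

/-- Common bounds for the noise parameters. -/
structure NoiseBound (γ : ℝ → ℝ) (lo hi r r' : ℝ) : Prop where
  measurable : Measurable γ
  lo_pos : 0 < lo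
  lo_le : ∀ d, lo ≤ γ d
  le_hi : ∀ d, γ d ≤ hi
  r_pos : 0 < r
  r_le : r ≤ r'

variable {γ : ℝ → ℝ} {lo hi r r' : ℝ}

lemma NoiseBound.hi_pos (h : NoiseBound γ lo hi r r') : 0 < hi :=
  h.lo_pos.trans_le ((h.lo_le 0).trans (h.le_hi 0))

/-- Bound for the peak density of one observation. -/
def peakBound (lo r P : ℝ) : ℝ := max 1 (√(lo * r))⁻¹ * √(max P 1)

/-- Bound for the mean exponent of one observation. -/
def meanBound (hi r' u P : ℝ) : ℝ := u ^ 2 + hi * r' / min P 1 + Real.log √(2 * Real.pi)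

/-- Bound for the averaged density of one observation. -/
def ratioBound (lo hi r r' : ℝ) : ℝ := √((hi * r') / (lo * r))

lemma one_le_peakBound (lo r P : ℝ) : 1 ≤ peakBound lo r P := by
  have h1 : 1 ≤ √(max P 1) := by rw [Real.one_le_sqrt]; exact le_max_right _ _
  exact one_le_mul_of_one_le_of_one_le (le_max_left _ _) h1

lemma NoiseBound.one_le_ratioBound (h : NoiseBound γ lo hi r r') :
    1 ≤ ratioBound lo hi r r' := by
  have h0 := h.lo_pos
  have h1 := h.r_pos
  rw [ratioBound, Real.one_le_sqrt, one_le_div (by positivity)]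
  exact mul_le_mul ((h.lo_le 0).trans (h.le_hi 0)) h.r_le h1.le h.hi_pos.le

lemma NoiseBound.meanBound_nonneg (h : NoiseBound γ lo hi r r') (u : ℝ) {P : ℝ} (hP : 0 < P) :
    0 ≤ meanBound hi r' u P := by
  have h0 := h.hi_pos
  have h1 := h.r_pos.trans_le h.r_le
  have h2 : 0 < min P 1 := lt_min hP one_pos
  have h3 := Real.log_nonneg one_le_sqrt_two_pi
  unfold meanBound
  positivity

lemma NoiseBound.channelBound (h : NoiseBound γ lo hi r r') {ρ : ℝ} (hρ : ρ ∈ Set.Icc r r')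
    {P : ℝ} (hP : 0 < P) {l u : ℝ} (hl : 0 ≤ l) :
    ChannelBound stdGaussian stdGaussian stdGaussian (noisyChannel γ ρ P) (Set.Icc l u)
      gaussianExponent (peakBound lo r P) (ratioBound lo hi r r') (meanBound hi r' u P) := by
  have hγ := h.measurable
  have h0 := h.lo_pos
  have h1 := h.r_pos
  have hr' := h.r_pos.trans_le h.r_le
  have hhi := h.hi_pos
  have hm : 0 < min P 1 := lt_min hP one_pos
  refine (channelBound_gaussian (v := fun d => γ d * ρ / P) (a := lo * r / P) (b := hi * r' / P)
    (by fun_prop) (by positivity) (fun d => ?_) (fun d => ?_) hl).mono ?_ ?_ ?_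
  · exact div_le_div_of_nonneg_right (mul_le_mul (h.lo_le d) hρ.1 h1.le
      (h0.le.trans (h.lo_le d))) hP.le
  · exact div_le_div_of_nonneg_right (mul_le_mul (h.le_hi d) hρ.2 (h1.le.trans hρ.1) hhi.le) hP.le
  · rw [Real.sqrt_div (by positivity), inv_div, div_eq_mul_inv, mul_comm]
    exact mul_le_mul (le_max_right _ _) (Real.sqrt_le_sqrt (le_max_left _ _)) (Real.sqrt_nonneg _)
      (by positivity)
  · rw [ratioBound, div_div_div_cancel_right₀ hP.ne']
  · have : hi * r' / P ≤ hi * r' / min P 1 := by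
      gcongr
      exact min_le_left _ _
    unfold meanBound
    linarith

/-- The three distances lie in `[l, u]`. -/
def distanceBox (l u : ℝ) : Set (ℝ × ℝ × ℝ) :=
  Set.Icc l u ×ˢ (Set.Icc l u ×ˢ Set.Icc l u)

variable {ρ₁ ρ₂ ρₑ P l u : ℝ}

/-- Two readings of one distance: the averaged constant contains one `peakBound`, of order `√P`,
whose logarithm is the `½ log P` of the upper bound. -/
lemma NoiseBound.channelBound_nodes (h : NoiseBound γ lo hi r r') (hρ₁ : ρ₁ ∈ Set.Icc r r')
    (hρ₂ : ρ₂ ∈ Set.Icc r r') (hP : 0 < P) (hl : 0 ≤ l) :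
    ChannelBound distanceLaw (stdGaussian.prod stdGaussian) (stdGaussian.prod stdGaussian)
      (fun d z => (noisyChannel γ ρ₁ P d.1 z.1, noisyChannel γ ρ₂ P d.1 z.2)) (distanceBox l u)
      (fun x => gaussianExponent x.1 + gaussianExponent x.2)
      (peakBound lo r P * peakBound lo r P) (peakBound lo r P * ratioBound lo hi r r')
      (meanBound hi r' u P + meanBound hi r' u P) :=
  ((h.channelBound hρ₁ hP hl).prodMk (h.channelBound hρ₂ hP hl)
    (zero_le_one.trans (one_le_peakBound _ _ _)) (h.meanBound_nonneg u hP)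
    (h.meanBound_nonneg u hP)).comp_fst _

lemma NoiseBound.channelBound_nodesChannel (h : NoiseBound γ lo hi r r')
    (hρ₁ : ρ₁ ∈ Set.Icc r r') (hρ₂ : ρ₂ ∈ Set.Icc r r') (hP : 0 < P) (hl : 0 ≤ l) :
    ChannelBound distanceLaw noiseLaw (stdGaussian.prod stdGaussian) (nodesChannel γ ρ₁ ρ₂ P)
      (distanceBox l u) (fun x => gaussianExponent x.1 + gaussianExponent x.2)
      (peakBound lo r P * peakBound lo r P) (peakBound lo r P * ratioBound lo hi r r')
      (meanBound hi r' u P + meanBound hi r' u P) :=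
  (h.channelBound_nodes hρ₁ hρ₂ hP hl).comp_noise measurePreserving_snd

lemma NoiseBound.channelBound_eve (h : NoiseBound γ lo hi r r') (hρₑ : ρₑ ∈ Set.Icc r r')
    (hP : 0 < P) (hl : 0 ≤ l) :
    ChannelBound (stdGaussian.prod stdGaussian) (stdGaussian.prod stdGaussian)
      (stdGaussian.prod stdGaussian)
      (fun d z => (noisyChannel γ ρₑ P d.1 z.1, noisyChannel γ ρₑ P d.2 z.2))
      (Set.Icc l u ×ˢ Set.Icc l u) (fun x => gaussianExponent x.1 + gaussianExponent x.2)
      (peakBound lo r P * peakBound lo r P) (ratioBound lo hi r r' * ratioBound lo hi r r')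
      (meanBound hi r' u P + meanBound hi r' u P) :=
  (h.channelBound hρₑ hP hl).prodMap (h.channelBound hρₑ hP hl)
    (zero_le_one.trans (one_le_peakBound _ _ _)) (zero_le_one.trans h.one_le_ratioBound)
    (h.meanBound_nonneg u hP) (h.meanBound_nonneg u hP)

/-- Three readings of three distances that are independent under `distanceLaw`: the averaged
constant is free of `P`. This is why the eavesdropper's terms are negligible. The map `π` selects
the noise of the node. -/
lemma NoiseBound.channelBound_node_eve (h : NoiseBound γ lo hi r r') {ρ : ℝ}
    (hρ : ρ ∈ Set.Icc r r') (hρₑ : ρₑ ∈ Set.Icc r r') (hP : 0 < P) (hl : 0 ≤ l)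
    {π : ℝ × ℝ → ℝ} (hπ : MeasurePreserving π (stdGaussian.prod stdGaussian) stdGaussian) :
    ChannelBound distanceLaw noiseLaw (stdGaussian.prod (stdGaussian.prod stdGaussian))
      (fun d z => (noisyChannel γ ρ P d.1 (π z.2), eveChannel γ ρₑ P d z)) (distanceBox l u)
      (fun x => gaussianExponent x.1 + (gaussianExponent x.2.1 + gaussianExponent x.2.2))
      (peakBound lo r P * (peakBound lo r P * peakBound lo r P))
      (ratioBound lo hi r r' * (ratioBound lo hi r r' * ratioBound lo hi r r'))
      (meanBound hi r' u P + (meanBound hi r' u P + meanBound hi r' u P)) := by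
  have hm := h.meanBound_nonneg u hP
  have hσ : MeasurePreserving (fun z : (ℝ × ℝ) × (ℝ × ℝ) => (π z.2, z.1)) noiseLaw
      (stdGaussian.prod (stdGaussian.prod stdGaussian)) :=
    (hπ.prod (MeasurePreserving.id _)).comp Measure.measurePreserving_swap
  exact ((h.channelBound hρ hP hl).prodMap (h.channelBound_eve hρₑ hP hl)
    (zero_le_one.trans (one_le_peakBound _ _ _)) (zero_le_one.trans h.one_le_ratioBound)
    hm (add_nonneg hm hm)).comp_noise hσ

/-- For all observations together only finiteness and existence of the entropy rate are needed, so
the constants stay unspecified. -/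
lemma NoiseBound.channelBound_eve_nodes (h : NoiseBound γ lo hi r r')
    (hρ₁ : ρ₁ ∈ Set.Icc r r') (hρ₂ : ρ₂ ∈ Set.Icc r r') (hρₑ : ρₑ ∈ Set.Icc r r')
    (hP : 0 < P) (hl : 0 ≤ l) :
    ∃ (H : (ℝ × ℝ) × (ℝ × ℝ) → ℝ) (B c C : ℝ), 1 ≤ B ∧ 1 ≤ c ∧ 0 ≤ C ∧
      ChannelBound distanceLaw noiseLaw noiseLaw
        (fun d z => (eveChannel γ ρₑ P d z, nodesChannel γ ρ₁ ρ₂ P d z)) (distanceBox l u) H B c C := by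
  have hm := h.meanBound_nonneg u hP
  have hB := one_le_peakBound lo r P
  have hB' : 1 ≤ peakBound lo r P * peakBound lo r P := one_le_mul_of_one_le_of_one_le hB hB
  have hc := h.one_le_ratioBound
  exact ⟨_, _, _, _, one_le_mul_of_one_le_of_one_le hB' hB',
    one_le_mul_of_one_le_of_one_le hB' (one_le_mul_of_one_le_of_one_le hB hc), by positivity,
    ((h.channelBound_eve hρₑ hP hl).comp_snd _).prodMk (h.channelBound_nodes hρ₁ hρ₂ hP hl)
      (zero_le_one.trans hB') (by positivity) (by positivity)⟩

end LocalizationChannels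

/-! ### Lower bound for the relative entropy of two close observations. -/

section InformationLowerBound

variable {Ω : Type*} [MeasurableSpace Ω] {μ : Measure Ω} [IsProbabilityMeasure μ]

lemma klDiv_map_le_blockDiv_one {S : Type*} [MeasurableSpace S] {X : ℕ → Ω → S}
    (hX : ∀ i, Measurable (X i)) (ν : Measure S) [IsProbabilityMeasure ν] :
    klDiv (μ.map (X 0)) ν ≤ blockDiv X ν μ 1 := by
  have := isProbabilityMeasure_map_block (μ := μ) hX 1
  have h := klDiv_map_le (μ.map (block 1 X)) (Measure.pi fun _ : Fin 1 => ν)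
    (measurable_pi_apply 0)
  rw [Measure.map_map (by fun_prop) (measurable_block hX 1),
    (measurePreserving_eval (fun _ : Fin 1 => ν) 0).map_eq] at h
  exact h

/-- For fixed `x`, the integrand times the standard Gaussian density in `y` is at most the density
of `N(x, 1/P)`: the term `½ log P` supplies its normalization `√P`. -/
lemma lintegral_exp_neg_sq_le {P : ℝ} (hP : 0 < P) :
    ∫⁻ q : ℝ × ℝ, ENNReal.ofReal (Real.exp (1 / 2 * Real.log P - P / 2 * (q.1 - q.2) ^ 2))
      ∂(stdGaussian.prod stdGaussian) ≤ 1 := by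
  rw [lintegral_prod _ (by fun_prop)]
  have h : ∀ x : ℝ, ∫⁻ y, ENNReal.ofReal (Real.exp (1 / 2 * Real.log P - P / 2 * (x - y) ^ 2))
      ∂stdGaussian ≤ 1 := fun x => by
    have hv : (P⁻¹.toNNReal) ≠ 0 := by simpa using hP
    have hv' : ((P⁻¹.toNNReal : NNReal) : ℝ) = P⁻¹ := Real.coe_toNNReal _ (by positivity)
    rw [stdGaussian, gaussianReal_of_var_ne_zero _ one_ne_zero,
      lintegral_withDensity_eq_lintegral_mul _ (measurable_gaussianPDF _ _) (by fun_prop),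
      ← lintegral_gaussianPDF_eq_one x hv]
    refine lintegral_mono fun y => ?_
    rw [Pi.mul_apply, gaussianPDF, gaussianPDF, ← ENNReal.ofReal_mul (gaussianPDFReal_nonneg _ _ _)]
    refine ENNReal.ofReal_le_ofReal ?_
    rw [gaussianPDFReal, gaussianPDFReal, hv', Real.exp_sub]
    have e1 : Real.exp (1 / 2 * Real.log P) = √P := by
      rw [mul_comm, Real.exp_mul, Real.exp_log hP, Real.sqrt_eq_rpow]
    have e2 : (√(2 * Real.pi * P⁻¹))⁻¹ = (√(2 * Real.pi))⁻¹ * √P := by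
      rw [Real.sqrt_mul (by positivity), Real.sqrt_inv, mul_inv, inv_inv]
    have e3 : Real.exp (-(y - x) ^ 2 / (2 * P⁻¹)) = (Real.exp (P / 2 * (x - y) ^ 2))⁻¹ := by
      rw [← Real.exp_neg]
      congr 1
      rw [div_eq_mul_inv, mul_inv, inv_inv]
      ring
    rw [e1, e2, e3, NNReal.coe_one, mul_one, div_eq_mul_inv √P]
    have e4 : Real.exp (-(y - 0) ^ 2 / (2 * 1)) ≤ 1 := by
      rw [Real.exp_le_one_iff, neg_div]
      have : 0 ≤ (y - 0) ^ 2 / (2 * 1) := by positivity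
      linarith
    have e5 : 0 ≤ (√(2 * Real.pi))⁻¹ * (√P * (Real.exp (P / 2 * (x - y) ^ 2))⁻¹) := by positivity
    calc _ = Real.exp (-(y - 0) ^ 2 / (2 * 1)) *
          ((√(2 * Real.pi))⁻¹ * (√P * (Real.exp (P / 2 * (x - y) ^ 2))⁻¹)) := by ring
      _ ≤ 1 * ((√(2 * Real.pi))⁻¹ * (√P * (Real.exp (P / 2 * (x - y) ^ 2))⁻¹)) :=
          mul_le_mul_of_nonneg_right e4 e5
      _ = _ := by rw [one_mul, ← mul_assoc]
  calc _ ≤ ∫⁻ _, 1 ∂stdGaussian := lintegral_mono h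
    _ = 1 := by simp

/-- Two noisy observations of the same quantity have large relative entropy with respect to
independent Gaussian variables. -/
lemma le_klDiv_of_integral_sq_sub_le {X Y : Ω → ℝ} (hX : Measurable X) (hY : Measurable Y)
    {P K : ℝ} (hP : 0 < P) (hint : Integrable (fun ω => (X ω - Y ω) ^ 2) μ)
    (hK : ∫ ω, (X ω - Y ω) ^ 2 ∂μ ≤ K / P) :
    ENNReal.ofReal (1 / 2 * Real.log P - K / 2) ≤
      klDiv (μ.map fun ω => (X ω, Y ω)) (stdGaussian.prod stdGaussian) := by
  have hXY : Measurable fun ω => (X ω, Y ω) := hX.prodMk hY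
  have : IsProbabilityMeasure (μ.map fun ω => (X ω, Y ω)) :=
    Measure.isProbabilityMeasure_map hXY.aemeasurable
  have hf : Measurable fun q : ℝ × ℝ => 1 / 2 * Real.log P - P / 2 * (q.1 - q.2) ^ 2 := by fun_prop
  have hi : Integrable (fun ω => 1 / 2 * Real.log P - P / 2 * (X ω - Y ω) ^ 2) μ :=
    (integrable_const _).sub (hint.const_mul _)
  have h := ofReal_integral_le_klDiv hf (lintegral_exp_neg_sq_le hP)
    (P := μ.map fun ω => (X ω, Y ω)) (by
      rw [integrable_map_measure hf.aestronglyMeasurable hXY.aemeasurable]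
      exact hi)
  refine le_trans (ENNReal.ofReal_le_ofReal ?_) h
  rw [integral_map hXY.aemeasurable hf.aestronglyMeasurable]
  simp only
  rw [integral_sub (integrable_const _) (hint.const_mul _), integral_const_mul (P / 2)]
  have : P / 2 * ∫ ω, (X ω - Y ω) ^ 2 ∂μ ≤ P / 2 * (K / P) :=
    mul_le_mul_of_nonneg_left hK (by positivity)
  have e : P / 2 * (K / P) = K / 2 := by field_simp
  simp only [integral_const, probReal_univ, smul_eq_mul, one_mul]
  linarith

end InformationLowerBound

/-! ### Uniqueness of the rates and invariance under almost sure equality. -/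

section RateProperties

variable {Ω A B E : Type*} [MeasurableSpace Ω] [MeasurableSpace A] [MeasurableSpace B]
  [MeasurableSpace E] {μ : Measure Ω} {X X' : ℕ → Ω → A} {Y Y' : ℕ → Ω → B} {Z Z' : ℕ → Ω → E}

/-- The rates are produced separately for each truncation level `M`; uniqueness makes all the bounds
apply to one function of `P`. -/
lemma IsLowerRate.unique {R R' : ℝ} (h : IsLowerRate X Y Z μ R) (h' : IsLowerRate X Y Z μ R') :
    R = R' := by
  obtain ⟨-, a, b, ha, hb, rfl⟩ := h
  obtain ⟨-, a', b', ha', hb', rfl⟩ := h'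
  rw [tendsto_nhds_unique ha ha', tendsto_nhds_unique hb hb']

lemma IsUpperRate.unique [StandardBorelSpace A] [Nonempty A] [StandardBorelSpace B] [Nonempty B]
    [IsFiniteMeasure μ] {R R' : ℝ} (h : IsUpperRate X Y Z μ R) (h' : IsUpperRate X Y Z μ R') :
    R = R' :=
  tendsto_nhds_unique h.2 h'.2

lemma block_ae_eq {D : Type*} {x x' : ℕ → Ω → D} (h : ∀ i, x i =ᵐ[μ] x' i) (n : ℕ) :
    block n x =ᵐ[μ] block n x' := by
  filter_upwards [ae_all_iff.2 h] with ω hω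
  ext i
  exact hω i

lemma mutualInfo_congr {x x' : Ω → A} {y y' : Ω → B} (hx : x =ᵐ[μ] x') (hy : y =ᵐ[μ] y') :
    mutualInfo x y μ = mutualInfo x' y' μ := by
  rw [mutualInfo, mutualInfo, Measure.map_congr hx, Measure.map_congr hy,
    Measure.map_congr (hx.prodMk hy)]

lemma condMutualInfo_congr [StandardBorelSpace A] [Nonempty A] [StandardBorelSpace B] [Nonempty B]
    [IsFiniteMeasure μ] {x x' : Ω → A} {y y' : Ω → B} {z z' : Ω → E} (hx : x =ᵐ[μ] x')
    (hy : y =ᵐ[μ] y') (hz : z =ᵐ[μ] z') :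
    condMutualInfo x y z μ = condMutualInfo x' y' z' μ := by
  rw [condMutualInfo, condMutualInfo, Measure.map_congr hz, condDistrib_congr hx hz,
    condDistrib_congr hy hz, Measure.map_congr (hz.prodMk (hx.prodMk hy))]

/-- Allows `γ` to be changed outside the interval of distances, which alters the observations only
on a null set. -/
lemma IsLowerRate.congr {R : ℝ} (h : IsLowerRate X Y Z μ R) (hX : ∀ i, X i =ᵐ[μ] X' i)
    (hY : ∀ i, Y i =ᵐ[μ] Y' i) (hZ : ∀ i, Z i =ᵐ[μ] Z' i) : IsLowerRate X' Y' Z' μ R := by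
  have hX := block_ae_eq hX
  have hY := block_ae_eq hY
  have hZ := block_ae_eq hZ
  have h1 := fun n => mutualInfo_congr (hX n) (hY n)
  have h2 := fun n => mutualInfo_congr (hY n) (hX n)
  have h3 := fun n => mutualInfo_congr (hX n) (hZ n)
  have h4 := fun n => mutualInfo_congr (hY n) (hZ n)
  simpa only [IsLowerRate, h1, h2, h3, h4] using h

lemma IsUpperRate.congr [StandardBorelSpace A] [Nonempty A] [StandardBorelSpace B] [Nonempty B]
    [IsFiniteMeasure μ] {R : ℝ} (h : IsUpperRate X Y Z μ R) (hX : ∀ i, X i =ᵐ[μ] X' i)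
    (hY : ∀ i, Y i =ᵐ[μ] Y' i) (hZ : ∀ i, Z i =ᵐ[μ] Z' i) : IsUpperRate X' Y' Z' μ R := by
  have hX := block_ae_eq hX
  have hY := block_ae_eq hY
  have hZ := block_ae_eq hZ
  have h1 := fun n => mutualInfo_congr (hX n) (hY n)
  have h2 := fun n => condMutualInfo_congr (hX n) (hY n) (hZ n)
  simpa only [IsUpperRate, h1, h2] using h

end RateProperties

/-! ### From error bounds to limits in the power. -/

section Asymptotics

lemma tendsto_div_half_log {R : ℝ → ℝ}
    (h : ∀ ε > 0, ∃ K, ∀ P ≥ 1, |R P - 1 / 2 * Real.log P| ≤ ε * Real.log P + K) :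
    Tendsto (fun P => R P / (1 / 2 * Real.log P)) atTop (𝓝 1) := by
  rw [Metric.tendsto_atTop']
  intro ε hε
  -- Division by `½ log P` turns the error into `ε/2 + 2K / log P`; the second term is below `ε/2`
  -- once `log P > 4K/ε`.
  obtain ⟨K, hK⟩ := h (ε / 4) (by positivity)
  obtain ⟨N, hN⟩ := (Real.tendsto_log_atTop.eventually
    (eventually_gt_atTop (max 0 (4 * K / ε)))).exists_forall_of_atTop
  refine ⟨max N 1, fun P hP => ?_⟩
  have hlog := hN P ((le_max_left _ _).trans hP.le)
  have h0 : 0 < Real.log P := (le_max_left _ _).trans_lt hlog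
  have h1 : 4 * K / ε < Real.log P := (le_max_right _ _).trans_lt hlog
  rw [div_lt_iff₀ hε] at h1
  have h2 := hK P ((le_max_right _ _).trans hP.le)
  rw [Real.dist_eq, div_sub_one (by positivity), abs_div, abs_of_pos (a := 1 / 2 * Real.log P)
    (by positivity), div_lt_iff₀ (by positivity)]
  nlinarith

lemma tendsto_atTop_of_half_log {R : ℝ → ℝ}
    (h : ∀ ε > 0, ∃ K, ∀ P ≥ 1, |R P - 1 / 2 * Real.log P| ≤ ε * Real.log P + K) :
    Tendsto R atTop atTop := by
  obtain ⟨K, hK⟩ := h (1 / 4) (by positivity)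
  have h1 : Tendsto (fun P => 1 / 4 * Real.log P + -K) atTop atTop :=
    tendsto_atTop_add_const_right _ _ (Real.tendsto_log_atTop.const_mul_atTop (by norm_num))
  refine tendsto_atTop_mono' _ ?_ h1
  filter_upwards [eventually_ge_atTop 1] with P hP
  have := (abs_le.1 (hK P hP)).1
  linarith

end Asymptotics

/-! ### Entropy bounds for the localization model and the conclusion. -/

section Localization

variable {Ω : Type*} [MeasurableSpace Ω] {μ : Measure Ω} [IsProbabilityMeasure μ]
  {γ : ℝ → ℝ} {lo hi r r' : ℝ}

/-- The common distance cancels in the difference of the readings. The inequality `(a - b)² ≤ 2a² +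
2b²` bounds its second moment by `4 hi r' / P`, without using independence of the two noises. -/
lemma NoiseBound.le_blockDiv_nodes (h : NoiseBound γ lo hi r r') {ρ₁ ρ₂ P : ℝ}
    (hρ₁ : ρ₁ ∈ Set.Icc r r') (hρ₂ : ρ₂ ∈ Set.Icc r r') (hP : 0 < P)
    {d x y : ℕ → Ω → ℝ} (hd : ∀ i, Measurable (d i)) (hx : ∀ i, Measurable (x i))
    (hy : ∀ i, Measurable (y i)) (hxl : μ.map (x 0) = stdGaussian)
    (hyl : μ.map (y 0) = stdGaussian) :
    ENNReal.ofReal (1 / 2 * Real.log P - 4 * (hi * r') / 2) ≤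
      blockDiv (fun i ω => (noisyChannel γ ρ₁ P (d i ω) (x i ω),
        noisyChannel γ ρ₂ P (d i ω) (y i ω))) (stdGaussian.prod stdGaussian) μ 1 := by
  have hγ := h.measurable
  have hhi := h.hi_pos
  have hr := h.r_pos
  have hr' := h.r_pos.trans_le h.r_le
  have m₁ : ∀ i, Measurable fun ω => noisyChannel γ ρ₁ P (d i ω) (x i ω) := fun i => by
    unfold noisyChannel; fun_prop
  have m₂ : ∀ i, Measurable fun ω => noisyChannel γ ρ₂ P (d i ω) (y i ω) := fun i => by
    unfold noisyChannel; fun_prop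
  refine le_trans ?_ (klDiv_map_le_blockDiv_one (fun i => (m₁ i).prodMk (m₂ i)) _)
  have sq : ∀ {w : Ω → ℝ}, Measurable w → μ.map w = stdGaussian →
      Integrable (fun ω => w ω ^ 2) μ ∧ ∫ ω, w ω ^ 2 ∂μ = 1 := fun {w} hw hl => by
    have hi := integrable_sq_stdGaussian
    have he := integral_sq_stdGaussian
    rw [← hl] at hi he
    rw [integrable_map_measure (by fun_prop) hw.aemeasurable] at hi
    rw [integral_map hw.aemeasurable (by fun_prop)] at he
    exact ⟨hi, he⟩
  obtain ⟨ix, ex⟩ := sq (hx 0) hxl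
  obtain ⟨iy, ey⟩ := sq (hy 0) hyl
  have hvar : ∀ {ρ : ℝ}, ρ ∈ Set.Icc r r' → ∀ t, 0 ≤ γ t * ρ / P ∧ γ t * ρ / P ≤ hi * r' / P :=
    fun {ρ} hρ t => by
      have h1 : 0 ≤ γ t := h.lo_pos.le.trans (h.lo_le t)
      have h2 : 0 ≤ ρ := hr.le.trans hρ.1
      exact ⟨by positivity, div_le_div_of_nonneg_right
        (mul_le_mul (h.le_hi t) hρ.2 h2 hhi.le) hP.le⟩
  have ib : Integrable (fun ω => 2 * (hi * r' / P) * (x 0 ω ^ 2 + y 0 ω ^ 2)) μ :=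
    (ix.add iy).const_mul _
  have hb : ∀ ω, (noisyChannel γ ρ₁ P (d 0 ω) (x 0 ω) - noisyChannel γ ρ₂ P (d 0 ω) (y 0 ω)) ^ 2 ≤
      2 * (hi * r' / P) * (x 0 ω ^ 2 + y 0 ω ^ 2) := fun ω => by
    obtain ⟨a1, b1⟩ := hvar hρ₁ (d 0 ω)
    obtain ⟨a2, b2⟩ := hvar hρ₂ (d 0 ω)
    have s1 := Real.sq_sqrt a1
    have s2 := Real.sq_sqrt a2
    have t1 := mul_le_mul_of_nonneg_right b1 (sq_nonneg (x 0 ω))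
    have t2 := mul_le_mul_of_nonneg_right b2 (sq_nonneg (y 0 ω))
    rw [← s1] at t1
    rw [← s2] at t2
    unfold noisyChannel
    nlinarith [sq_nonneg (√(γ (d 0 ω) * ρ₁ / P) * x 0 ω + √(γ (d 0 ω) * ρ₂ / P) * y 0 ω)]
  have hint : Integrable (fun ω =>
      (noisyChannel γ ρ₁ P (d 0 ω) (x 0 ω) - noisyChannel γ ρ₂ P (d 0 ω) (y 0 ω)) ^ 2) μ := by
    refine ib.mono' (((m₁ 0).sub (m₂ 0)).pow_const 2).aestronglyMeasurable (ae_of_all _ fun ω => ?_)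
    rw [Real.norm_of_nonneg (sq_nonneg _)]
    exact hb ω
  refine le_klDiv_of_integral_sq_sub_le (m₁ 0) (m₂ 0) hP hint ?_
  calc _ ≤ ∫ ω, 2 * (hi * r' / P) * (x 0 ω ^ 2 + y 0 ω ^ 2) ∂μ := integral_mono hint ib hb
    _ = _ := by
      rw [integral_const_mul, integral_add ix iy, ex, ey]
      ring

/-- The extension of a function on `[l, u]` by constants. -/
lemma exists_noiseBound_eq_on {l u : ℝ} (hlu : l ≤ u) (hmono : MonotoneOn γ (Set.Icc l u))
    (hpos : ∀ d ∈ Set.Icc l u, 0 < γ d) (hr : 0 < r) (hrr : r ≤ r') :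
    ∃ γ' : ℝ → ℝ, NoiseBound γ' (γ l) (γ u) r r' ∧ ∀ d ∈ Set.Icc l u, γ' d = γ d := by
  have hl : l ∈ Set.Icc l u := ⟨le_rfl, hlu⟩
  have hu : u ∈ Set.Icc l u := ⟨hlu, le_rfl⟩
  -- `γ` is not assumed measurable; its extension is monotone on the whole line and therefore is.
  have hm : Monotone fun d => γ (Set.projIcc l u hlu d) := fun a b hab =>
    hmono (Set.projIcc l u hlu a).2 (Set.projIcc l u hlu b).2 (Set.monotone_projIcc hlu hab)
  refine ⟨fun d => γ (Set.projIcc l u hlu d), ⟨hm.measurable, hpos l hl, fun d => ?_, fun d => ?_,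
    hr, hrr⟩, fun d hd => by
      simp only [Set.projIcc_of_mem hlu hd]⟩
  · exact hmono hl (Set.projIcc l u hlu d).2 (Set.projIcc l u hlu d).2.1
  · exact hmono (Set.projIcc l u hlu d).2 hu (Set.projIcc l u hlu d).2.2

/-- The order of quantifiers matters: `δ` is chosen before `M` and `P`, so that `M` can be fixed in
terms of `ε` while `P` grows. -/
lemma exists_rates_localization (h : NoiseBound γ lo hi r r')
    {l₁ l₂ lₑ : ℕ → Ω → Plane}
    (hl₁ : ∀ i, Measurable (l₁ i)) (hl₂ : ∀ i, Measurable (l₂ i)) (hlₑ : ∀ i, Measurable (lₑ i))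
    (hstat : IsStationary (fun i ω => (l₁ i ω, l₂ i ω, lₑ i ω)) μ)
    (hmarkov : IsMarkov (fun i ω => (l₁ i ω, l₂ i ω, lₑ i ω)) μ)
    (hpdf : HasPDF (block 2 fun i ω => (l₁ i ω, l₂ i ω, lₑ i ω)) μ volume)
    {l u : ℝ} (hl : 0 ≤ l)
    (hd : ∀ i, ∀ᵐ ω ∂μ, distance l₁ l₂ i ω ∈ Set.Icc l u ∧ distance l₁ lₑ i ω ∈ Set.Icc l u ∧
      distance l₂ lₑ i ω ∈ Set.Icc l u)
    {ρ₁ ρ₂ ρₑ : ℝ} (hρ₁ : ρ₁ ∈ Set.Icc r r') (hρ₂ : ρ₂ ∈ Set.Icc r r') (hρₑ : ρₑ ∈ Set.Icc r r')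
    {z : Fin 4 → ℕ → Ω → ℝ} (hz : ∀ k i, Measurable (z k i))
    (hzlaw : ∀ k i, μ.map (z k i) = gaussianReal 0 1)
    (hzindep : iIndepFun (fun p : Fin 4 × ℕ => z p.1 p.2) μ)
    (hzl : IndepFun (fun ω (i : ℕ) => (l₁ i ω, l₂ i ω, lₑ i ω))
      (fun ω (p : Fin 4 × ℕ) => z p.1 p.2 ω) μ) :
    ∃ δ : ℝ → ℝ, Tendsto δ atTop (𝓝 0) ∧ ∀ M P : ℝ, 1 ≤ M → 0 < P → ∃ R_L R_U : ℝ,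
      IsLowerRate (noisy γ ρ₁ P (distance l₁ l₂) (z 0)) (noisy γ ρ₂ P (distance l₁ l₂) (z 1))
        (pair (noisy γ ρₑ P (distance l₁ lₑ) (z 2)) (noisy γ ρₑ P (distance l₂ lₑ) (z 3))) μ R_L ∧
      IsUpperRate (noisy γ ρ₁ P (distance l₁ l₂) (z 0)) (noisy γ ρ₂ P (distance l₁ l₂) (z 1))
        (pair (noisy γ ρₑ P (distance l₁ lₑ) (z 2)) (noisy γ ρₑ P (distance l₂ lₑ) (z 3))) μ R_U ∧
      ∀ R ∈ ({R_L, R_U} : Set ℝ),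
        1 / 2 * Real.log P - 4 * (hi * r') / 2 - 2 * (Real.log 2 +
          Real.log (ratioBound lo hi r r' ^ 3 * M) + |δ M| * Real.log (peakBound lo r P ^ 3) +
          3 * meanBound hi r' u P) ≤ R ∧
        R ≤ Real.log 2 + Real.log (peakBound lo r P * ratioBound lo hi r r' * M) +
          |δ M| * Real.log (peakBound lo r P ^ 2) + 2 * meanBound hi r' u P := by
  set s : ℕ → Ω → Plane × Plane × Plane := fun i ω => (l₁ i ω, l₂ i ω, lₑ i ω) with hsdef
  set ζ : ℕ → Ω → (ℝ × ℝ) × (ℝ × ℝ) := fun i ω => ((z 2 i ω, z 3 i ω), (z 0 i ω, z 1 i ω)) with hζdef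
  have hs : ∀ i, Measurable (s i) := fun i => by fun_prop
  have hζ : ∀ i, Measurable (ζ i) := fun i => by fun_prop
  have hlaw : ∀ k n, μ.map (block n fun i => ζ (k + i)) = Measure.pi fun _ => noiseLaw :=
    fun k n => map_block_noise hz hzlaw hzindep k n
  have hind : IndepFun (fun ω i => s i ω) (fun ω i => ζ i ω) μ :=
    hzl.comp (φ := id) (ψ := fun (f : Fin 4 × ℕ → ℝ) (i : ℕ) =>
      ((f (2, i), f (3, i)), (f (0, i), f (1, i)))) measurable_id (by fun_prop)
  obtain ⟨κ, hκm, hκ0, hκ⟩ := exists_transition_kernel hs hstat hmarkov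
  have hKm : MeasurableSet (distanceBox l u) :=
    measurableSet_Icc.prod (measurableSet_Icc.prod measurableSet_Icc)
  have hK : ∀ n, ∀ᵐ ω ∂μ, distances (s n ω) ∈ distanceBox l u := fun n =>
    (hd n).mono fun ω hω => ⟨hω.1, hω.2.1, hω.2.2⟩
  obtain ⟨δ, hδ, hbound⟩ := exists_blockDiv_le_of_channelBound hs hζ hstat hlaw hind
    measurable_distances hκ (ae_map_distances_absolutelyContinuous hs hκ0) hKm hK
  refine ⟨δ, hδ, fun M P hM hP => ?_⟩
  have hpk := one_le_peakBound lo r P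
  have hrt := h.one_le_ratioBound
  have hmn := h.meanBound_nonneg u hP
  have one_mul_le : ∀ {a b : ℝ}, 1 ≤ a → 1 ≤ b → 1 ≤ a * b := one_le_mul_of_one_le_of_one_le
  have hpk2 := one_mul_le hpk hpk
  have hpk3 := one_mul_le hpk hpk2
  have hrt3 := one_mul_le hrt (one_mul_le hrt hrt)
  -- measurability of the observations
  have hγ := h.measurable
  have mo : ∀ (ρ : ℝ) {d w : ℕ → Ω → ℝ}, (∀ i, Measurable (d i)) → (∀ i, Measurable (w i)) →
      ∀ i, Measurable (noisy γ ρ P d w i) := fun ρ d w hd hw i => by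
    unfold noisy; fun_prop
  have md : ∀ {a b : ℕ → Ω → Plane}, (∀ i, Measurable (a i)) → (∀ i, Measurable (b i)) →
      ∀ i, Measurable (distance a b i) := fun ha hb i => (ha i).dist (hb i)
  have m₁ := mo ρ₁ (md hl₁ hl₂) (hz 0)
  have m₂ := mo ρ₂ (md hl₁ hl₂) (hz 1)
  have mₑ : ∀ i, Measurable (pair (noisy γ ρₑ P (distance l₁ lₑ) (z 2))
      (noisy γ ρₑ P (distance l₂ lₑ) (z 3)) i) := fun i =>
    (mo ρₑ (md hl₁ hlₑ) (hz 2) i).prodMk (mo ρₑ (md hl₂ hlₑ) (hz 3) i)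
  -- relative entropy bounds
  obtain ⟨H, B, c, C, hB, hc, hC, hfull⟩ :=
    h.channelBound_eve_nodes (u := u) hρ₁ hρ₂ hρₑ hP hl
  have b12 := hbound _ (h.channelBound_nodesChannel (u := u) hρ₁ hρ₂ hP hl) hpk2
    (one_mul_le hpk hrt) (by positivity) hM
  have b1 := hbound _ (h.channelBound_node_eve (u := u) hρ₁ hρₑ hP hl
    (measurePreserving_fst (μ := stdGaussian) (ν := stdGaussian))) hpk3 hrt3 (by positivity) hM
  have b2 := hbound _ (h.channelBound_node_eve (u := u) hρ₂ hρₑ hP hl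
    (measurePreserving_snd (μ := stdGaussian) (ν := stdGaussian))) hpk3 hrt3 (by positivity) hM
  have b := hbound _ hfull hB hc hC hM
  have hUstat := isStationary_pair hs hζ hstat hlaw hind
  have hGm : Measurable fun p : (Plane × Plane × Plane) × ((ℝ × ℝ) × (ℝ × ℝ)) =>
      (eveChannel γ ρₑ P (distances p.1) p.2, nodesChannel γ ρ₁ ρ₂ P (distances p.1) p.2) :=
    hfull.measurable_channel.comp (by fun_prop :
      Measurable fun p : (Plane × Plane × Plane) × ((ℝ × ℝ) × (ℝ × ℝ)) => (distances p.1, p.2))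
  have hTstat := isStationary_comp (fun i => (hs i).prodMk (hζ i)) hUstat hGm
  have hL := h.le_blockDiv_nodes hρ₁ hρ₂ hP (md hl₁ hl₂) (hz 0) (hz 1) (hzlaw 0 0) (hzlaw 1 0)
  have weaken : ∀ {a : ℕ → ENNReal} {x x' : ℝ}, x ≤ x' → (∀ n, a n ≤ n * ENNReal.ofReal x) →
      ∀ n, a n ≤ n * ENNReal.ofReal x' := fun hx ha n =>
    (ha n).trans (mul_le_mul_right (ENNReal.ofReal_le_ofReal hx) _)
  have lg : ∀ {x : ℝ}, 1 ≤ x → 0 ≤ Real.log x := Real.log_nonneg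
  have hlog2 := lg one_le_two
  have hrM : 1 ≤ ratioBound lo hi r r' ^ 3 * M := one_mul_le (one_le_pow₀ hrt) hM
  have hpM : 1 ≤ peakBound lo r P * ratioBound lo hi r r' * M :=
    one_mul_le (one_mul_le hpk hrt) hM
  have lp2 := lg (one_le_pow₀ hpk (n := 2))
  have lp3 := lg (one_le_pow₀ hpk (n := 3))
  have lr := lg hrM
  have lp := lg hpM
  -- Only the limit of `δ` is known at this point; the absolute value keeps the constants
  -- nonnegative.
  have hδle := le_abs_self (δ M)
  have w1 : Real.log 2 + Real.log (ratioBound lo hi r r' *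
      (ratioBound lo hi r r' * ratioBound lo hi r r') * M) +
      δ M * Real.log (peakBound lo r P * (peakBound lo r P * peakBound lo r P)) +
      (meanBound hi r' u P + (meanBound hi r' u P + meanBound hi r' u P)) ≤
      Real.log 2 + Real.log (ratioBound lo hi r r' ^ 3 * M) +
        |δ M| * Real.log (peakBound lo r P ^ 3) + 3 * meanBound hi r' u P := by
    have := mul_le_mul_of_nonneg_right hδle lp3
    rw [show ratioBound lo hi r r' * (ratioBound lo hi r r' * ratioBound lo hi r r') =
      ratioBound lo hi r r' ^ 3 by ring, show peakBound lo r P * (peakBound lo r P *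
      peakBound lo r P) = peakBound lo r P ^ 3 by ring]
    linarith
  have w12 : Real.log 2 + Real.log (peakBound lo r P * ratioBound lo hi r r' * M) +
      δ M * Real.log (peakBound lo r P * peakBound lo r P) +
      (meanBound hi r' u P + meanBound hi r' u P) ≤
      Real.log 2 + Real.log (peakBound lo r P * ratioBound lo hi r r' * M) +
        |δ M| * Real.log (peakBound lo r P ^ 2) + 2 * meanBound hi r' u P := by
    have := mul_le_mul_of_nonneg_right hδle lp2
    rw [← pow_two]
    linarith
  -- The constant for all observations together only has to exist; its maximum with `0` makes it
  -- nonnegative.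
  obtain ⟨R_L, R_U, hRL, hRU, g1, g2, g3, g4⟩ := exists_rates_of_blockDiv_le m₁ m₂ mₑ hTstat
    (le_max_left 0 _) (weaken (le_max_right _ _) b) (by positivity) (weaken w12 b12)
    (by positivity) (weaken w1 b1) (by positivity) (weaken w1 b2) hL
  refine ⟨R_L, R_U, hRL, hRU, fun R hR => ?_⟩
  rcases hR with rfl | rfl
  · exact ⟨by linarith, g2⟩
  · exact ⟨by linarith, g4⟩

end Localization

lemma log_peakBound_of_one_le {P : ℝ} (lo r : ℝ) (hP : 1 ≤ P) :
    Real.log (peakBound lo r P) = Real.log (max 1 (√(lo * r))⁻¹) + 1 / 2 * Real.log P := by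
  have h1 : 0 < max 1 (√(lo * r))⁻¹ := zero_lt_one.trans_le (le_max_left _ _)
  have h2 : 0 < P := zero_lt_one.trans_le hP
  rw [peakBound, max_eq_left hP, Real.log_mul h1.ne' (Real.sqrt_pos.2 h2).ne',
    Real.log_sqrt h2.le]
  ring

lemma NoiseBound.exists_abs_sub_half_log_le {γ : ℝ → ℝ} {lo hi r r' u : ℝ}
    (h : NoiseBound γ lo hi r r') {δ : ℝ → ℝ} (hδ : Tendsto δ atTop (𝓝 0)) {R : ℝ → ℝ}
    (hR : ∀ M P : ℝ, 1 ≤ M → 0 < P →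
      1 / 2 * Real.log P - 4 * (hi * r') / 2 - 2 * (Real.log 2 +
        Real.log (ratioBound lo hi r r' ^ 3 * M) + |δ M| * Real.log (peakBound lo r P ^ 3) +
        3 * meanBound hi r' u P) ≤ R P ∧
      R P ≤ Real.log 2 + Real.log (peakBound lo r P * ratioBound lo hi r r' * M) +
        |δ M| * Real.log (peakBound lo r P ^ 2) + 2 * meanBound hi r' u P) :
    ∀ ε > 0, ∃ K, ∀ P ≥ 1, |R P - 1 / 2 * Real.log P| ≤ ε * Real.log P + K := by
  intro ε hε
  -- In the lower bound the peaks contribute `2 · |δ M| · 3 · ½ log P = 3 |δ M| log P`, which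
  -- explains `ε / 3`.
  obtain ⟨M, hM1, hM⟩ := ((eventually_ge_atTop 1).and
    (Metric.tendsto_nhds.1 hδ (ε / 3) (by positivity))).exists
  rw [Real.dist_eq, sub_zero] at hM
  have hc := h.one_le_ratioBound
  have hm := h.meanBound_nonneg u one_pos
  have hhi := h.hi_pos
  have hr' := h.r_pos.trans_le h.r_le
  set b := Real.log (max 1 (√(lo * r))⁻¹)
  have hb : 0 ≤ b := Real.log_nonneg (le_max_left _ _)
  have hM0 : 0 ≤ Real.log M := Real.log_nonneg hM1
  have hc0 : 0 ≤ Real.log (ratioBound lo hi r r') := Real.log_nonneg hc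
  have hlog2 : 0 ≤ Real.log 2 := Real.log_nonneg one_le_two
  have hδb : 0 ≤ |δ M| * b := by positivity
  have hhr : 0 ≤ hi * r' := by positivity
  refine ⟨2 * (hi * r') + 2 * Real.log 2 + 6 * Real.log (ratioBound lo hi r r') + 2 * Real.log M +
    6 * (|δ M| * b) + 6 * meanBound hi r' u 1 + b, fun P hP => ?_⟩
  obtain ⟨h1, h2⟩ := hR M P hM1 (zero_lt_one.trans_le hP)
  have hp := one_le_peakBound lo r P
  have hmP : meanBound hi r' u P = meanBound hi r' u 1 := by
    rw [meanBound, meanBound, min_eq_right hP, min_self]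
  have hL : 0 ≤ Real.log P := Real.log_nonneg hP
  have hδL : |δ M| * Real.log P ≤ ε / 3 * Real.log P := mul_le_mul_of_nonneg_right hM.le hL
  have hδL0 : 0 ≤ |δ M| * Real.log P := by positivity
  rw [Real.log_mul (by positivity) (by positivity), Real.log_pow, Real.log_pow,
    log_peakBound_of_one_le lo r hP, hmP] at h1
  rw [Real.log_mul (by positivity) (by positivity), Real.log_mul (by positivity) (by positivity),
    Real.log_pow, log_peakBound_of_one_le lo r hP, hmP] at h2
  push_cast at h1 h2
  rw [abs_le]
  constructor <;> nlinarith

end LocationKey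

end

theorem theorem3
    {Ω : Type*} [MeasurableSpace Ω] (μ : Measure Ω) [IsProbabilityMeasure μ]
    -- locations of node 1, node 2 and the eavesdropper in each slot
    (l₁ l₂ lₑ : ℕ → Ω → LocationKey.Plane)
    (hl₁ : ∀ i, Measurable (l₁ i)) (hl₂ : ∀ i, Measurable (l₂ i)) (hlₑ : ∀ i, Measurable (lₑ i))
    (hstat : LocationKey.IsStationary (fun i ω => (l₁ i ω, l₂ i ω, lₑ i ω)) μ)
    (hmarkov : LocationKey.IsMarkov (fun i ω => (l₁ i ω, l₂ i ω, lₑ i ω)) μ)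
    (hpdf : ∀ n : ℕ,
      HasPDF (LocationKey.block n fun i ω => (l₁ i ω, l₂ i ω, lₑ i ω)) μ volume)
    (dmin dmax : ℝ) (hdmin : 0 < dmin)
    (hd : ∀ i, ∀ᵐ ω ∂μ,
      LocationKey.distance l₁ l₂ i ω ∈ Set.Icc dmin dmax ∧
      LocationKey.distance l₁ lₑ i ω ∈ Set.Icc dmin dmax ∧
      LocationKey.distance l₂ lₑ i ω ∈ Set.Icc dmin dmax)
    -- noise model
    (γ : ℝ → ℝ) (hγmono : MonotoneOn γ (Set.Icc dmin dmax))
    (hγpos : ∀ d ∈ Set.Icc dmin dmax, 0 < γ d)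
    (ρ₁ ρ₂ ρₑ : ℝ) (hρ₁ : 0 < ρ₁) (hρ₂ : 0 < ρ₂) (hρₑ : 0 < ρₑ)
    (z : Fin 4 → ℕ → Ω → ℝ) (hz : ∀ k i, Measurable (z k i))
    (hzlaw : ∀ k i, μ.map (z k i) = gaussianReal 0 1)
    (hzindep : iIndepFun (fun p : Fin 4 × ℕ => z p.1 p.2) μ)
    (hzl : IndepFun (fun ω (i : ℕ) => (l₁ i ω, l₂ i ω, lₑ i ω))
      (fun ω (p : Fin 4 × ℕ) => z p.1 p.2 ω) μ)
    -- observations at beacon power `P`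
    (o₁ o₂ : ℝ → ℕ → Ω → ℝ) (oₑ : ℝ → ℕ → Ω → ℝ × ℝ)
    (ho₁ : ∀ P, o₁ P = LocationKey.noisy γ ρ₁ P (LocationKey.distance l₁ l₂) (z 0))
    (ho₂ : ∀ P, o₂ P = LocationKey.noisy γ ρ₂ P (LocationKey.distance l₁ l₂) (z 1))
    (hoₑ : ∀ P, oₑ P = LocationKey.pair
      (LocationKey.noisy γ ρₑ P (LocationKey.distance l₁ lₑ) (z 2))
      (LocationKey.noisy γ ρₑ P (LocationKey.distance l₂ lₑ) (z 3))) :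
    ∃ R_L R_U : ℝ → ℝ,
      (∀ P : ℝ, 0 < P →
        LocationKey.IsLowerRate (o₁ P) (o₂ P) (oₑ P) μ (R_L P) ∧
        LocationKey.IsUpperRate (o₁ P) (o₂ P) (oₑ P) μ (R_U P)) ∧
      Tendsto (fun P : ℝ => R_L P / (1 / 2 * Real.log P)) atTop (𝓝 1) ∧
      Tendsto (fun P : ℝ => R_U P / (1 / 2 * Real.log P)) atTop (𝓝 1) ∧
      Tendsto R_L atTop atTop := by
  have hlu : dmin ≤ dmax := by
    obtain ⟨ω, hω⟩ := (hd 0).exists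
    exact hω.1.1.trans hω.1.2
  set r := min ρ₁ (min ρ₂ ρₑ) with hr
  set r' := max ρ₁ (max ρ₂ ρₑ) with hr'
  have hρ₁' : ρ₁ ∈ Set.Icc r r' := ⟨min_le_left _ _, le_max_left _ _⟩
  have hρ₂' : ρ₂ ∈ Set.Icc r r' :=
    ⟨(min_le_right _ _).trans (min_le_left _ _), (le_max_left _ _).trans (le_max_right _ _)⟩
  have hρₑ' : ρₑ ∈ Set.Icc r r' :=
    ⟨(min_le_right _ _).trans (min_le_right _ _), (le_max_right _ _).trans (le_max_right _ _)⟩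
  obtain ⟨γ', hγ', heq⟩ := LocationKey.exists_noiseBound_eq_on hlu hγmono hγpos
    (lt_min hρ₁ (lt_min hρ₂ hρₑ)) (hρ₁'.1.trans hρ₁'.2)
  obtain ⟨δ, hδ, hrates⟩ := LocationKey.exists_rates_localization hγ' hl₁ hl₂ hlₑ hstat hmarkov
    (hpdf 2) hdmin.le hd hρ₁' hρ₂' hρₑ' hz hzlaw hzindep hzl
  have hnoisy : ∀ {d w : ℕ → Ω → ℝ} (ρ P : ℝ), (∀ i, ∀ᵐ ω ∂μ, d i ω ∈ Set.Icc dmin dmax) →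
      ∀ i, LocationKey.noisy γ' ρ P d w i =ᵐ[μ] LocationKey.noisy γ ρ P d w i :=
    fun ρ P h i => (h i).mono fun ω hω => by
      simp only [LocationKey.noisy, heq _ hω]
  have e₁ : ∀ P i, LocationKey.noisy γ' ρ₁ P (LocationKey.distance l₁ l₂) (z 0) i =ᵐ[μ] o₁ P i :=
    fun P => by rw [ho₁]; exact hnoisy _ _ fun i => (hd i).mono fun ω hω => hω.1
  have e₂ : ∀ P i, LocationKey.noisy γ' ρ₂ P (LocationKey.distance l₁ l₂) (z 1) i =ᵐ[μ] o₂ P i :=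
    fun P => by rw [ho₂]; exact hnoisy _ _ fun i => (hd i).mono fun ω hω => hω.1
  have eₑ : ∀ P i, LocationKey.pair
      (LocationKey.noisy γ' ρₑ P (LocationKey.distance l₁ lₑ) (z 2))
      (LocationKey.noisy γ' ρₑ P (LocationKey.distance l₂ lₑ) (z 3)) i =ᵐ[μ] oₑ P i := fun P i => by
    rw [hoₑ]
    exact (hnoisy _ _ (fun i => (hd i).mono fun ω hω => hω.2.1) i).prodMk
      (hnoisy _ _ (fun i => (hd i).mono fun ω hω => hω.2.2) i)
  -- The level `M = 1` only serves to define the rates; by uniqueness the bounds at every other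
  -- level hold for them too. The value `0` given below for `P ≤ 0` is immaterial.
  choose R_L R_U hL hU hb using hrates 1
  set F_L : ℝ → ℝ := fun P => if hP : 0 < P then R_L P le_rfl hP else 0 with hF_L
  set F_U : ℝ → ℝ := fun P => if hP : 0 < P then R_U P le_rfl hP else 0 with hF_U
  have hFL : ∀ {P : ℝ} (hP : 0 < P), F_L P = R_L P le_rfl hP := fun hP => dif_pos hP
  have hFU : ∀ {P : ℝ} (hP : 0 < P), F_U P = R_U P le_rfl hP := fun hP => dif_pos hP
  have hLbound := hγ'.exists_abs_sub_half_log_le (u := dmax) hδ (R := F_L) fun M P hM hP => by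
    obtain ⟨R, R', h1, h2, h3⟩ := hrates M P hM hP
    rw [hFL hP, (hL P le_rfl hP).unique h1]
    exact h3 R (by simp)
  have hUbound := hγ'.exists_abs_sub_half_log_le (u := dmax) hδ (R := F_U) fun M P hM hP => by
    obtain ⟨R, R', h1, h2, h3⟩ := hrates M P hM hP
    rw [hFU hP, (hU P le_rfl hP).unique h2]
    exact h3 R' (by simp)
  refine ⟨F_L, F_U, fun P hP => ⟨?_, ?_⟩, LocationKey.tendsto_div_half_log hLbound,
    LocationKey.tendsto_div_half_log hUbound, LocationKey.tendsto_atTop_of_half_log hLbound⟩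
  · rw [hFL hP]
    exact (hL P le_rfl hP).congr (e₁ P) (e₂ P) (eₑ P)
  · rw [hFU hP]
    exact (hU P le_rfl hP).congr (e₁ P) (e₂ P) (eₑ P)
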